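/- **Setting.** Let $R_\nu$ be a complete discrete valuation ring with uniformiser $p$ and residue field $\mathfrak K$, and let $R\subseteq R_\nu$ be a dense noetherian subring with $p\in R$ and $R/\langle p\rangle=\mathfrak K$ (that is, $R\cap pR_\nu=pR$). Let $x=(x_1,\dots,x_n)$, $n\ge 0$. A $t$-local monomial ordering $>$ is a total ordering on the monomials $t^\beta x^\alpha$ compatible with multiplication and with $1>t$. For $0\ne f\in R[[t]][x]$ let $\mathrm{lm}(f)$, $\mathrm{lc}(f)$, $\mathrm{lt}(f)=\mathrm{lc}(f)\,\mathrm{lm}(f)$ belong to the greatest monomial occurring in $f$, let $\mathrm{tail}(f)=f-\mathrm{lt}(f)$, and for a set $S$ let $\mathrm{lt}(S)\trianglelefteq R[t,x]$ be the ideal generated by the leading terms of its elements. An element is $x$-homogeneous if all its monomials have the same degree in $x$. A standard basis of an ideal $I$ is a finite $G\subseteq I$ with $\mathrm{lt}(G)=\mathrm{lt}(I)$; it is minimal if no proper subset of $G$ is a standard basis. For $g=\sum_\alpha g_\alpha x^\alpha$ with $g_\alpha\in R[[t]]$ put $g'=\sum_\alpha \mathrm{lt}(g_\alpha)x^\alpha$;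 the set $G$ is initially reduced w.r.t. $H$ if no term of $\mathrm{tail}(g')$, $g\in G$, lies in $\mathrm{lt}(H)$. An initially reduced standard basis is a minimal standard basis that is initially reduced w.r.t. itself. **Algorithm.** *Input:* a finite set $F\subseteq R[t,x]$ of $x$-homogeneous polynomials with $p-t\in F$, and $>$. Put $I=\langle F\rangle\trianglelefteq R[[t]][x]$. 1. Compute an $x$-homogeneous polynomial standard basis $G''$ of $I$. 2. Drop the $g\in G''$ with $p\mid \mathrm{lc}(g)$. Replace each other $g$ with $\mathrm{lc}(g)\neq1$ by $a g+b\,\mathrm{lm}(g)(p-t)$, where $1=a\,\mathrm{lc}(g)+bp$. Then remove one after the other elements whose leading monomial is divisible by the leading monomial of another remaining element. Call the result $G'$ and set $G=\emptyset$. 3. While $G'\ne\emptyset$: take the set $H$ of elements of $G'$ of least $x$-degree out of $G'$, reduce $H$ by (C) w.r.t. $G$, and add the result to $G$. 4. Return $G\cup\{p-t\}$. (A) *$(p-t)$-reduction of $g$.* Set $g':=g_\gamma x^\gamma$, where $x^\gamma$ is the $x$-part of $\mathrm{lm}(g)$, and $g'':=g-g'$. While $g''\neq0$, with $\mathrm{lt}(g'')=c\,t^\beta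 x^\gamma$: if $p\mid c$, let $l$ be maximal with $p^l\mid c$ and set $g'':=g''-\frac{c}{p^l}t^\beta x^\gamma(p^l-t^l)$; otherwise move $g''_\gamma x^\gamma$ from $g''$ to $g'$. Return $g'$. (B) *Reduction of $g_1,\dots,g_k$ of the same $x$-degree.* Apply (A) to every $g_i$; order them so that $\mathrm{lm}(g_1)>\dots>\mathrm{lm}(g_k)$ and let $\mathrm{lm}(g_i)=t^{\beta_i}x^{\alpha_i}$. First, for $i=1,\dots,k-1$ and $j=i+1,\dots,k$: if $g_{j,\alpha_i}\ne0$, set $g_j:=\frac{g_{i,\alpha_i}}{t^{\beta_i}}g_j-\frac{g_{j,\alpha_i}}{t^{\beta_i}}g_i$ and apply (A) to $g_j$. Then, for the same pairs $(i,j)$ in the same order: if $t^{\beta_j}\mid g_{i,\alpha_j}$, set $g_i:=\frac{g_{j,\alpha_j}}{t^{\beta_j}}g_i-\frac{g_{i,\alpha_j}}{t^{\beta_j}}g_j$ and apply (A) to $g_i$. (C) *Reduction of $H=\{h_1,\dots,h_k\}$ of the same $x$-degree w.r.t. $G$ of lower $x$-degrees.* Apply (B) to $H$; set $E=\emptyset$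 and let $T$ be the set of pairs $(\mathrm{lt}(h_{i,\alpha})x^\alpha,i)$ whose term is smaller than $\mathrm{lt}(h_i)$. While $T\neq\emptyset$: pick $(s,i)\in T$ with $\mathrm{lm}(s)$ maximal. If $\mathrm{lt}(g)\mid s$ for some $g\in G$, pick such a $g$, add $\frac{\mathrm{lm}(s)}{\mathrm{lm}(g)}g$ to $E$, apply (B) to $H\cup E$, and let $T$ be the set of pairs $(\mathrm{lt}(h_{i,\alpha})x^\alpha,i)$ with monomial smaller than $\mathrm{lm}(s)$; otherwise remove $(s,i)$ from $T$. Return $H$. **Theorem.** Let $>$ be a $t$-local monomial ordering and $F$ an input as above. (i) $I$ has an $x$-homogeneous polynomial standard basis. If $I\neq R[[t]][x]$, then, whichever such standard basis $G''$ is used in step 1 and however the remaining choices are resolved, steps 2–4 stop after finitely many steps, and their output is an $x$-homogeneous polynomial initially reduced standard basis of $I$. (ii) Suppose moreover that $R$ is a coded ring with computable operations in which linear equations are solvable (ideal membership $b\in\langle c_1,\dots,c_k\rangle$ is decidable, with computable coefficients of a representation, and finite generating sets of $\mathrm{syz}_R(c_1,\dots,c_k)$ are computable), and that $>$ is decidable.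 Then there is a computable function (that is, an algorithm that always stops) that takes every input $F$ to an $x$-homogeneous polynomial initially reduced standard basis of $I=\langle F\rangle$ (here $I=R[[t]][x]$ is allowed). -/

import Mathlib

namespace InRed

universe u

/-! ## Polynomials, power series and monomials -/

/-- Exponents `(β, α)` of the monomials `t^β x^α`.  Addition of exponents is multiplication of
monomials, and the componentwise order `≤` is divisibility of monomials. -/
abbrev Mon (n : ℕ) : Type := ℕ × (Fin n →₀ ℕ)

/-- The mixed power series polynomial ring `R⟦t⟧[x₁, …, xₙ]`. -/
abbrev Ser (R : Type u) [CommRing R] (n : ℕ) : Type u := MvPolynomial (Fin n) (PowerSeries R)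

/-- The polynomial ring `R[t, x₁, …, xₙ] = R[t][x₁, …, xₙ]`. -/
abbrev Poly (R : Type u) [CommRing R] (n : ℕ) : Type u := MvPolynomial (Fin n) (Polynomial R)

noncomputable section

variable {R : Type u} [CommRing R] {n : ℕ}

/-- The inclusion `R[t, x] ⊆ R⟦t⟧[x]`. -/
def toSer : Poly R n →+* Ser R n := MvPolynomial.map Polynomial.coeToPowerSeries.ringHom

/-- The term `c · t^β x^α`. -/
def term (m : Mon n) (c : R) : Poly R n := MvPolynomial.monomial m.2 (Polynomial.monomial m.1 c)

/-- The coefficient of `t^β x^α` in `f`. -/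
def coeffAt (m : Mon n) (f : Ser R n) : R := PowerSeries.coeff m.1 (MvPolynomial.coeff m.2 f)

/-- The constant `p` of `R` as a polynomial. -/
def cst (p : R) : Poly R n := MvPolynomial.C (Polynomial.C p)

/-- The variable `t` as a polynomial. -/
def tVar : Poly R n := MvPolynomial.C Polynomial.X

/-- `x`-homogeneous: all occurring monomials `x^α` have the same degree. -/
def XHomogeneous (g : Poly R n) : Prop := ∃ d, MvPolynomial.IsHomogeneous g d

/-- The degree in the variables `x`. -/
def xdeg (g : Poly R n) : ℕ := MvPolynomial.totalDegree g

end

/-- A `t`-local monomial ordering on the monomials in `t` and `x`: a total ordering that is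
compatible with multiplication, with `t < 1`.  (No condition is put on the `x`-variables.) -/
structure TLocalOrder (n : ℕ) where
  lt : Mon n → Mon n → Prop
  total : IsStrictTotalOrder (Mon n) lt
  add_right : ∀ a b c, lt a b → lt (a + c) (b + c)
  t_local : lt (1, 0) (0, 0)

/-! ## Leading terms, standard bases, initial reducedness -/

noncomputable section

variable {R : Type u} [CommRing R] {n : ℕ} (o : TLocalOrder n)

/-- `m` is the greatest monomial occurring in `f`. -/
def IsLeadMon (f : Ser R n) (m : Mon n) : Prop :=
  coeffAt m f ≠ 0 ∧ ∀ m', coeffAt m' f ≠ 0 → m' = m ∨ o.lt m' m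

open Classical in
/-- The leading monomial of `f` (meaningful for `f ≠ 0`, see `isLeadMon_lm`). -/
def lm (f : Ser R n) : Mon n := if h : ∃ m, IsLeadMon o f m then h.choose else 0

/-- The leading coefficient. -/
def lc (f : Ser R n) : R := coeffAt (lm o f) f

/-- The leading term, an element of `R[t, x]`; it is `0` for `f = 0`. -/
def lt (f : Ser R n) : Poly R n := term (lm o f) (lc o f)

/-- The tail `f - lt f`. -/
def tail (f : Ser R n) : Ser R n := f - toSer (lt o f)

/-- The ideal of `R[t, x]` generated by the leading terms of the elements of `S`. -/
def leadIdeal (S : Set (Ser R n)) : Ideal (Poly R n) := Ideal.span (lt o '' S)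

/-- A standard basis of the ideal `I`: a finite subset of `I` whose leading terms generate the
leading ideal of `I`. -/
def IsStdBasis (I : Ideal (Ser R n)) (G : Set (Ser R n)) : Prop :=
  G.Finite ∧ G ⊆ I ∧ leadIdeal o G = leadIdeal o (I : Set (Ser R n))

/-- Minimality of a standard basis: no proper subset has leading terms that generate the same
leading ideal. -/
def IsMinimal (G : Set (Ser R n)) : Prop := ∀ G' ⊂ G, leadIdeal o G' ≠ leadIdeal o G

/-- `G` is reduced with respect to `H`: no term of a tail of an element of `G` lies in the ideal
generated by the leading terms of `H`. -/
def IsReduced (G H : Set (Ser R n)) : Prop :=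
  ∀ g ∈ G, ∀ m, coeffAt m (tail o g) ≠ 0 → term m (coeffAt m (tail o g)) ∉ leadIdeal o H

/-- For `g = ∑ g_α x^α` with `g_α ∈ R⟦t⟧`, the term `lt(g_α) x^α`. -/
def initTerm (g : Ser R n) (α : Fin n →₀ ℕ) : Poly R n :=
  lt o (MvPolynomial.C (MvPolynomial.coeff α g)) * MvPolynomial.monomial α 1

/-- For `g = ∑ g_α x^α` with `g_α ∈ R⟦t⟧`, the polynomial `∑ lt(g_α) x^α`. -/
def initPart (g : Ser R n) : Poly R n := ∑ α ∈ g.support, initTerm o g α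

/-- `G` is initially reduced with respect to `H`. -/
def IsInitReduced (G H : Set (Ser R n)) : Prop :=
  IsReduced o ((fun g => toSer (initPart o g)) '' G) H

/-- An initially reduced standard basis of `I`. -/
def IsInitReducedStdBasis (I : Ideal (Ser R n)) (G : Set (Ser R n)) : Prop :=
  IsStdBasis o I G ∧ IsMinimal o G ∧ IsInitReduced o G G

/-- The subset of `R⟦t⟧[x]` given by a list of polynomials. -/
def serSet (L : List (Poly R n)) : Set (Ser R n) := {f | ∃ g ∈ L, f = toSer g}

/-- The ideal of `R⟦t⟧[x]` generated by a list of polynomials. -/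
def idealOf (L : List (Poly R n)) : Ideal (Ser R n) := Ideal.span (serSet L)

/-- Admissible input: a finite list of `x`-homogeneous polynomials that contains `p - t`. -/
def IsInput (p : R) (F : List (Poly R n)) : Prop :=
  (∀ f ∈ F, XHomogeneous f) ∧ cst p - tVar ∈ F

/-- `G` is a list of `x`-homogeneous polynomials which form a standard basis of `I`. -/
def IsXHomStdBasis (I : Ideal (Ser R n)) (G : List (Poly R n)) : Prop :=
  (∀ g ∈ G, XHomogeneous g) ∧ IsStdBasis o I (serSet G)

/-- `G` is a list of `x`-homogeneous polynomials which form an initially reduced standard basis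
of `I`. -/
def IsXHomInitReducedStdBasis (I : Ideal (Ser R n)) (G : List (Poly R n)) : Prop :=
  (∀ g ∈ G, XHomogeneous g) ∧ IsInitReducedStdBasis o I (serSet G)

/-- Every nonzero element has a leading monomial. -/
theorem exists_isLeadMon (f : Ser R n) (hf : f ≠ 0) : ∃ m, IsLeadMon o f m := by
  classical
  have := o.total
  have hpow : ∀ k : ℕ, o.lt (k + 1, 0) (0, 0) := by
    intro k
    induction k with
    | zero => simpa using o.t_local
    | succ k ih =>
      have h := o.add_right _ _ (1, 0) ih
      have h' : o.lt (k + 1 + 1, 0) (1, 0) := by simpa using h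
      exact _root_.trans h' o.t_local
  have hord : ∀ (a b : ℕ) (α : Fin n →₀ ℕ), a < b → o.lt (b, α) (a, α) := by
    intro a b α hab
    obtain ⟨k, rfl⟩ := Nat.exists_eq_add_of_lt hab
    have h := o.add_right _ _ (a, α) (hpow k)
    have e : ((k + 1, 0) + (a, α) : Mon n) = (a + k + 1, α) := by
      simp only [Prod.mk_add_mk, zero_add]; congr 1; omega
    rw [e] at h
    simpa using h
  let M : Finset (Mon n) :=
    f.support.image (fun α => ((MvPolynomial.coeff α f).order.toNat, α))
  have hM : M.Nonempty := by
    obtain ⟨α, hα⟩ := MvPolynomial.support_nonempty.2 hf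
    exact ⟨_, Finset.mem_image_of_mem _ hα⟩
  obtain ⟨m, hmM, hmax⟩ : ∃ m ∈ M, ∀ m' ∈ M, m' = m ∨ o.lt m' m := by
    clear_value M
    induction hM using Finset.Nonempty.cons_induction with
    | singleton a => exact ⟨a, by simp, fun m' hm' => Or.inl (Finset.mem_singleton.1 hm')⟩
    | cons a s ha hs ih =>
      obtain ⟨m, hm, h⟩ := ih
      rcases trichotomous_of o.lt a m with h1 | h1 | h1
      · refine ⟨m, Finset.mem_cons_of_mem hm, fun m' hm' => ?_⟩
        rcases Finset.mem_cons.1 hm' with rfl | h'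
        · exact Or.inr h1
        · exact h m' h'
      · exact absurd (h1 ▸ hm) ha
      · refine ⟨a, Finset.mem_cons_self a s, fun m' hm' => ?_⟩
        rcases Finset.mem_cons.1 hm' with rfl | h'
        · exact Or.inl rfl
        · rcases h m' h' with rfl | h2
          · exact Or.inr h1
          · exact Or.inr (_root_.trans h2 h1)
  refine ⟨m, ?_, ?_⟩
  · obtain ⟨α, hα, rfl⟩ := Finset.mem_image.1 hmM
    exact PowerSeries.coeff_order (MvPolynomial.mem_support_iff.1 hα)
  · rintro ⟨b, α⟩ hb
    have hα : α ∈ f.support := by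
      rw [MvPolynomial.mem_support_iff]
      intro h0
      simp [coeffAt, h0] at hb
    have hle : (MvPolynomial.coeff α f).order.toNat ≤ b := by
      by_contra hlt
      exact hb (PowerSeries.coeff_of_lt_order_toNat _ (not_le.1 hlt))
    have hle' : (b, α) = ((MvPolynomial.coeff α f).order.toNat, α) ∨
        o.lt (b, α) ((MvPolynomial.coeff α f).order.toNat, α) := by
      rcases hle.eq_or_lt with h | h
      · left; rw [h]
      · right; exact hord _ _ _ h
    have h2 := hmax _ (Finset.mem_image_of_mem _ hα)
    rcases hle' with h1 | h1
    · rw [h1]; exact h2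
    · rcases h2 with h2 | h2
      · right; rw [← h2]; exact h1
      · right; exact _root_.trans h1 h2

theorem isLeadMon_lm (f : Ser R n) (hf : f ≠ 0) : IsLeadMon o f (lm o f) := by
  unfold lm
  rw [dif_pos (exists_isLeadMon o f hf)]
  exact (exists_isLeadMon o f hf).choose_spec

/-! ## The algorithm

The procedures are partial functions: `g ∈ proc a` says that `proc`, run on `a`, stops after
finitely many steps and returns `g`.  A while loop with body `b` is `PFun.fix b`, where `b` returns
`Sum.inl` to leave the loop and `Sum.inr` to go on with a new state. -/

/-- Abbreviations for the leading data of polynomials. -/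
abbrev plm (g : Poly R n) : Mon n := lm o (toSer g)

/-- The leading coefficient of a polynomial. -/
abbrev plc (g : Poly R n) : R := lc o (toSer g)

/-- The leading term of a polynomial. -/
abbrev plt (g : Poly R n) : Poly R n := lt o (toSer g)

/-- A resolution of the choices that the algorithm leaves open (applied to arbitrary arguments). -/
structure Choices (R : Type u) [CommRing R] (n : ℕ) (p : R) where
  /-- a pair `(a, b)` with `1 = a c + b p` -/
  bezout : R → R × R
  bezout_spec : ∀ c, (∃ a b, a * c + b * p = 1) → (bezout c).1 * c + (bezout c).2 * p = 1
  /-- an element of a set of pairs `(term, index)` -/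
  pickTerm : Finset (Poly R n × ℕ) → Poly R n × ℕ
  pickTerm_mem : ∀ T, T.Nonempty → pickTerm T ∈ T
  /-- an element of a list of polynomials -/
  pickPoly : List (Poly R n) → Poly R n
  pickPoly_mem : ∀ L, L ≠ [] → pickPoly L ∈ L

open Classical in
/-- The exact quotient `a / b` (and `0` if `b` does not divide `a`). -/
def quot (a b : R) : R := if h : b ∣ a then h.choose else 0

open Classical in
/-- One pass through the loop of the `(p - t)`-reduction, on the state `(g', g'')`. -/
def pReduceStep (p : R) (s : Poly R n × Poly R n) : Poly R n ⊕ (Poly R n × Poly R n) :=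
  if s.2 = 0 then Sum.inl s.1
  else
    let m := plm o s.2
    let c := plc o s.2
    if p ∣ c then
      let l := multiplicity p c
      Sum.inr (s.1, s.2 - term m (quot c (p ^ l)) * (cst p ^ l - tVar ^ l))
    else
      let q := MvPolynomial.monomial m.2 (MvPolynomial.coeff m.2 s.2)
      Sum.inr (s.1 + q, s.2 - q)

/-- `(p - t)`-reduction of `g`: the `x`-monomial of the leading monomial keeps its coefficient; in
each other one, leading terms divisible by `p` are rewritten by replacing `p^l` by `t^l`. -/
def pReduce (p : R) (g : Poly R n) : Part (Poly R n) :=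
  let q := MvPolynomial.monomial (plm o g).2 (MvPolynomial.coeff (plm o g).2 g)
  PFun.fix (fun s => Part.some (pReduceStep o p s)) (q, g - q)

/-- `(p - t)`-reduction of all elements of a list. -/
def pReduceAll (p : R) : List (Poly R n) → Part (List (Poly R n))
  | [] => Part.some []
  | g :: L => do
    let g' ← pReduce o p g
    let L' ← pReduceAll p L
    pure (g' :: L')

/-- The pairs `(a i, a j)` with `i < j`, in lexicographic order of the positions `(i, j)`. -/
def orderedPairs {A : Type} : List A → List (A × A)
  | [] => []
  | a :: L => L.map (fun b => (a, b)) ++ orderedPairs L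

/-- The polynomial `(h_α / t^β) · g - (g_α / t^β) · h`, where `(β, α) = m`. -/
def cancel (m : Mon n) (g h : Poly R n) : Poly R n :=
  MvPolynomial.C (MvPolynomial.coeff m.2 h /ₘ Polynomial.X ^ m.1) * g -
    MvPolynomial.C (MvPolynomial.coeff m.2 g /ₘ Polynomial.X ^ m.1) * h

open Classical in
/-- First pass, for the pair `(i, j)`: eliminate `x^{α_i}` from `g_j`. -/
def firstPass (p : R) (M : ℕ → Mon n) (L : List (Poly R n)) (ij : ℕ × ℕ) :
    Part (List (Poly R n)) :=
  if MvPolynomial.coeff (M ij.1).2 (L.getD ij.2 0) ≠ 0 then do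
    let g ← pReduce o p (cancel (M ij.1) (L.getD ij.2 0) (L.getD ij.1 0))
    pure (L.set ij.2 g)
  else Part.some L

open Classical in
/-- Second pass, for the pair `(i, j)`: eliminate `x^{α_j}` from `g_i` if `t^{β_j}` divides its
coefficient. -/
def secondPass (p : R) (M : ℕ → Mon n) (L : List (Poly R n)) (ij : ℕ × ℕ) :
    Part (List (Poly R n)) :=
  if Polynomial.X ^ (M ij.2).1 ∣ MvPolynomial.coeff (M ij.2).2 (L.getD ij.1 0) then do
    let g ← pReduce o p (cancel (M ij.2) (L.getD ij.1 0) (L.getD ij.2 0))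
    pure (L.set ij.1 g)
  else Part.some L

open Classical in
/-- Initial reduction of a list of polynomials of the same `x`-degree.  The two passes go through
the polynomials by decreasing leading monomial; the result lists them in their original places. -/
def reduceSameDegree (p : R) (L₀ : List (Poly R n)) : Part (List (Poly R n)) := do
  let L₁ ← pReduceAll o p L₀
  let M : ℕ → Mon n := fun i => plm o (L₁.getD i 0)
  let idx := (List.range L₁.length).insertionSort (fun i j => ¬ o.lt (M i) (M j))
  let L₂ ← (orderedPairs idx).foldlM (firstPass o p M) L₁
  (orderedPairs idx).foldlM (secondPass o p M) L₂

open Classical in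
/-- The pairs `(lt(h_{i,α}) x^α, i)` whose monomial is smaller than `bound i`. -/
def workList (H : List (Poly R n)) (bound : ℕ → Mon n) : Finset (Poly R n × ℕ) :=
  (Finset.range H.length).biUnion fun i =>
    ((H.getD i 0).support.image fun α => (initTerm o (toSer (H.getD i 0)) α, i)).filter
      fun s => o.lt (plm o s.1) (bound i)

open Classical in
/-- One pass through the loop of the step by step reduction, on the state `(H, E, T)`. -/
def stepByStepBody (p : R) (σ : Choices R n p) (G : List (Poly R n))
    (s : List (Poly R n) × List (Poly R n) × Finset (Poly R n × ℕ)) :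
    Part (List (Poly R n) ⊕
      (List (Poly R n) × List (Poly R n) × Finset (Poly R n × ℕ))) :=
  let H := s.1
  let E := s.2.1
  let T := s.2.2
  if T = ∅ then Part.some (Sum.inl H)
  else
    let c := σ.pickTerm (T.filter fun a => ∀ b ∈ T, ¬ o.lt (plm o a.1) (plm o b.1))
    let D := G.filter fun g => plt o g ∣ c.1
    if D = [] then Part.some (Sum.inr (H, E, T.erase c))
    else do
      let g := σ.pickPoly D
      let e := term (plm o c.1 - plm o g) 1 * g
      let L ← reduceSameDegree o p (H ++ E ++ [e])
      let H' := L.take H.length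
      pure (Sum.inr (H', L.drop H.length, workList o H' (fun _ => plm o c.1)))

/-- Step by step initial reduction of a list `H` of polynomials of the same `x`-degree with respect
to itself, to `p - t` and to a list `G` of polynomials of lower `x`-degree. -/
def stepByStep (p : R) (σ : Choices R n p) (G H : List (Poly R n)) : Part (List (Poly R n)) := do
  let H₁ ← reduceSameDegree o p H
  PFun.fix (stepByStepBody o p σ G)
    (H₁, [], workList o H₁ (fun i => plm o (H₁.getD i 0)))

open Classical in
/-- Removal of the elements whose leading coefficient is divisible by `p`, and normalisation of
the other leading coefficients to `1` by means of `p - t`. -/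
def normalise (p : R) (σ : Choices R n p) (G : List (Poly R n)) : List (Poly R n) :=
  (G.filter fun g => ¬ p ∣ plc o g).map fun g =>
    if plc o g = 1 then g
    else
      let ab := σ.bezout (plc o g)
      cst ab.1 * g + cst ab.2 * term (plm o g) 1 * (cst p - tVar)

open Classical in
/-- Minimisation: the elements of the second list are removed one after the other if their leading
monomial is divisible by that of another element that is still there. -/
def minimise (kept : List (Poly R n)) : List (Poly R n) → List (Poly R n)
  | [] => kept
  | g :: rest =>
    if ∃ g' ∈ kept ++ rest, plm o g' ≤ plm o g then minimise kept rest
    else minimise (kept ++ [g]) rest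

open Classical in
/-- One pass through the main loop, on the state `(G, G')`: the elements of least `x`-degree in
`G'` are reduced and moved to `G`. -/
def mainBody (p : R) (σ : Choices R n p) (s : List (Poly R n) × List (Poly R n)) :
    Part (List (Poly R n) ⊕ (List (Poly R n) × List (Poly R n))) :=
  let G := s.1
  let G' := s.2
  if G' = [] then Part.some (Sum.inl G)
  else do
    let d := sInf {e | ∃ g ∈ G', xdeg g = e}
    let H ← stepByStep o p σ G (G'.filter fun g => xdeg g = d)
    pure (Sum.inr (G ++ H, G'.filter fun g => d < xdeg g))

/-- The algorithm for initially reduced standard bases, from the point on where a standard basis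
`G''` of the ideal has been computed. -/
def initReducedStdBasis (p : R) (σ : Choices R n p) (G'' : List (Poly R n)) :
    Part (List (Poly R n)) := do
  let G ← PFun.fix (mainBody o p σ) ([], minimise o [] (normalise o p σ G''))
  pure (G ++ [cst p - tVar])

end

/-! ## Effectivity -/

noncomputable section

variable {R : Type u} [CommRing R] {n : ℕ}

/-- A coded commutative ring with computable operations in which linear equations are solvable:
ideal membership is decidable, with coefficients of a representation, and finite generating sets
of syzygy modules are computable. -/
structure LinearEquationsSolvable (R : Type u) [CommRing R] [Primcodable R] : Prop where
  add : Computable₂ (fun a b : R => a + b)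
  mul : Computable₂ (fun a b : R => a * b)
  neg : Computable (fun a : R => -a)
  membership : ∃ solve : R × List R → Option (List R), Computable solve ∧
    ∀ (b : R) (c : List R),
      (∀ a, solve (b, c) = some a → a.length = c.length ∧ (List.zipWith (· * ·) a c).sum = b) ∧
      (solve (b, c) = none → b ∉ Ideal.span {x | x ∈ c})
  syzygies : ∃ syz : List R → List (List R), Computable syz ∧
    ∀ c : List R, Submodule.span R {v : Fin c.length → R | List.ofFn v ∈ syz c} =
        {v : Fin c.length → R | ∑ i, v i * c.get i = 0} ∧
      ∀ a ∈ syz c, a.length = c.length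

/-- Finite codes of polynomials: lists of triples `(c, β, α)`, one for each term `c t^β x^α`. -/
abbrev PolyCode (R : Type u) (n : ℕ) : Type u := List (R × ℕ × (Fin n → ℕ))

/-- The monomial with a given list of exponents. -/
def monOf (m : ℕ × (Fin n → ℕ)) : Mon n := (m.1, Finsupp.equivFunOnFinite.symm m.2)

/-- The polynomial with a given code. -/
def decodePoly (L : PolyCode R n) : Poly R n :=
  (L.map fun a => term (monOf a.2) a.1).sum

open Classical in
/-- The ordering of the monomials is decidable. -/
def TLocalOrder.IsComputable (o : TLocalOrder n) : Prop :=
  Computable₂ (fun a b : ℕ × (Fin n → ℕ) => decide (o.lt (monOf a) (monOf b)))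

end

end InRed

/-! The proof compares orders in t with p-adic valuations at t = p. Call a ∈ R[t] clean if its
lowest coefficient is not divisible by p. For clean a, the order of a in t is the p-adic valuation
of a(p) (`IsCleanCoeff.X_pow_dvd_iff`). Since p - t ∈ I, polynomials may be changed modulo p - t,
and the initial monomials of a polynomial with clean coefficients depend only on its value at t = p.

Part (i), reduction. Procedure (A) makes the coefficients clean; it stops because a weight on
coefficients drops (`weight_rewrite_lt`). One elimination in (B) replaces g by u g - w h with u(0) =
1. At t = p the factor u(p) is prime to p, so the order of the x^α-coefficient is unchanged as far
as it is visible below t^k, whenever t^k divides the x^α-coefficient of w h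
(`exists_mem_pReduce_cancel`). The two passes of (B) are then Gaussian elimination: triangular
first, mutually reduced afterwards (`exists_mem_reduceSameDegree`). In (C), adjoining a multiple of
some g ∈ G with leading monomial m removes m from H and leaves all initial monomials above m alone
(`StepInv.step`). The leading monomials of H ∪ E have distinct x-parts of one degree, so E stays
bounded. The main loop goes up in x-degree, so new elements cannot spoil the reducedness of old
ones. `IsReducedCore` collects the outcome and implies the claim: leading terms with coefficient in
⟨p⟩ are covered by lt(p - t) = p, the others by monic elements.

Part (i), existence. The leading ideal is generated by finitely many leading terms, because R[t, x]
is noetherian. Each of them is the leading term of an x-homogeneous polynomial in I. This is not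
mere truncation in t, since t^N x^α may stay above the leading monomial for all N; the Artin–Rees
lemma removes the unwanted x^α exactly (`exists_poly_of_isHomogeneous`).

Part (ii). The computable function does not run the algorithm; it searches for an output together
with a certificate, and part (i) guarantees that the search succeeds. A certificate consists of
identities in R[t, x], checked by testing polynomials for zero. Membership of an x-homogeneous
polynomial f in the ideal over R⟦t⟧ becomes (1 - t r) f ∈ ⟨B⟩ in R[t, x], by Krull's intersection
theorem at t = p (`exists_mul_mem_span`). The standard basis property becomes a criterion on pairs
(`IsSReducible`). It is sound by Nakayama's lemma, because in each x-degree suitably chosen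
multiples with distinct leading x-parts generate everything modulo p, and their leading monomials
cannot cancel (`cover_of_isSReducible`). It is complete because submodules with the same leading
monomials agree after localisation at p (`exists_smul_mem_of_isVLead`), and elements prime to p are
invertible modulo p. -/

namespace InRed
universe u
noncomputable section
open Polynomial (X)

/-! ## Monomial orderings -/

namespace TLocalOrder
variable {n : ℕ} (o : TLocalOrder n)

theorem lt_irrefl (a : Mon n) : ¬ o.lt a a := by
  have := o.total
  exact irrefl a

variable {o}

theorem lt_trans {a b c : Mon n} (h : o.lt a b) (h' : o.lt b c) : o.lt a c := by
  have := o.total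
  exact _root_.trans h h'

theorem lt_asymm {a b : Mon n} (h : o.lt a b) : ¬ o.lt b a :=
  fun h' => o.lt_irrefl a (lt_trans h h')

theorem ne_of_lt {a b : Mon n} (h : o.lt a b) : a ≠ b := by
  rintro rfl
  exact o.lt_irrefl a h

variable (o) in
theorem lt_trichotomy (a b : Mon n) : o.lt a b ∨ a = b ∨ o.lt b a := by
  have := o.total
  exact trichotomous_of o.lt a b

theorem not_lt {a b : Mon n} : ¬ o.lt a b ↔ b = a ∨ o.lt b a := by
  constructor
  · intro h
    rcases o.lt_trichotomy a b with h' | h' | h'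
    · exact absurd h' h
    · exact Or.inl h'.symm
    · exact Or.inr h'
  · rintro (rfl | h)
    · exact o.lt_irrefl _
    · exact lt_asymm h

theorem lt_of_lt_of_not_lt {a b c : Mon n} (h : o.lt a b) (h' : ¬ o.lt c b) : o.lt a c := by
  rcases not_lt.1 h' with rfl | h'
  · exact h
  · exact lt_trans h h'

theorem lt_of_not_lt_of_lt {a b c : Mon n} (h : ¬ o.lt b a) (h' : o.lt b c) : o.lt a c := by
  rcases not_lt.1 h with rfl | h
  · exact h'
  · exact lt_trans h h'

theorem not_lt_trans {a b c : Mon n} (h : ¬ o.lt b a) (h' : ¬ o.lt c b) : ¬ o.lt c a :=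
  fun h'' => h' (lt_of_lt_of_not_lt h'' h)

theorem add_lt_add_iff {a b : Mon n} (c : Mon n) : o.lt (a + c) (b + c) ↔ o.lt a b := by
  refine ⟨fun h => ?_, o.add_right a b c⟩
  rcases o.lt_trichotomy a b with h' | rfl | h'
  · exact h'
  · exact absurd h (o.lt_irrefl _)
  · exact absurd h (lt_asymm (o.add_right _ _ c h'))

variable (o) in
theorem lt_of_t_lt {a b : ℕ} (α : Fin n →₀ ℕ) (hab : a < b) : o.lt (b, α) (a, α) := by
  have hpow : ∀ k : ℕ, o.lt (k + 1, 0) (0, 0) := by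
    intro k
    induction k with
    | zero => simpa using o.t_local
    | succ k ih =>
      have h := o.add_right _ _ (1, 0) ih
      have h' : o.lt (k + 1 + 1, 0) (1, 0) := by simpa using h
      exact lt_trans h' o.t_local
  obtain ⟨k, rfl⟩ := Nat.exists_eq_add_of_lt hab
  have h := o.add_right _ _ (a, α) (hpow k)
  have e : ((k + 1, 0) + (a, α) : Mon n) = (a + k + 1, α) := by
    simp only [Prod.mk_add_mk, zero_add]; congr 1; omega
  rw [e] at h
  simpa using h

variable (o) in
theorem t_lt_iff {a b : ℕ} (α : Fin n →₀ ℕ) : o.lt (b, α) (a, α) ↔ a < b := by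
  refine ⟨fun h => ?_, o.lt_of_t_lt α⟩
  by_contra hab
  rcases (_root_.not_lt.1 hab).eq_or_lt with rfl | h'
  · exact o.lt_irrefl _ h
  · exact lt_asymm h (o.lt_of_t_lt α h')

/-- A nonempty set of monomials with finitely many `x`-parts has a greatest element. -/
theorem exists_greatest (A : Finset (Fin n →₀ ℕ)) (Ω : Set (Mon n)) (hne : Ω.Nonempty)
    (hA : ∀ m ∈ Ω, m.2 ∈ A) : ∃ m ∈ Ω, ∀ m' ∈ Ω, ¬ o.lt m m' := by
  classical
  induction A using Finset.induction_on generalizing Ω with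
  | empty => obtain ⟨m, hm⟩ := hne; exact absurd (hA m hm) (by simp)
  | insert α A hα ih =>
    -- Since t < 1, the greatest monomial with a fixed x-part is the one with the least exponent of
    -- t, which exists because ℕ is well-ordered. It remains to compare it with the greatest
    -- monomial among the other x-parts.
    by_cases h1 : ∃ k, (k, α) ∈ Ω
    · have hk := Nat.find_spec h1
      set k := Nat.find h1
      have hmin : ∀ j, (j, α) ∈ Ω → ¬ o.lt (k, α) (j, α) := fun j hj => by
        rw [t_lt_iff]; exact _root_.not_lt.2 (Nat.find_min' h1 hj)
      by_cases h2 : (Ω ∩ {m | m.2 ≠ α}).Nonempty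
      · obtain ⟨m, hm, hmax⟩ := ih (Ω ∩ {m | m.2 ≠ α}) h2 (fun m hm => by
          rcases Finset.mem_insert.1 (hA m hm.1) with h | h
          · exact absurd h hm.2
          · exact h)
        have hall : ∀ m' ∈ Ω, ¬ o.lt m m' ∨ ¬ o.lt (k, α) m' := fun m' hm' => by
          by_cases h : m'.2 = α
          · right
            obtain ⟨j, β⟩ := m'
            obtain rfl : β = α := h
            exact hmin j hm'
          · exact Or.inl (hmax m' ⟨hm', h⟩)
        by_cases h3 : o.lt m (k, α)
        · refine ⟨_, hk, fun m' hm' h => ?_⟩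
          rcases hall m' hm' with h' | h'
          · exact h' (lt_trans h3 h)
          · exact h' h
        · refine ⟨_, hm.1, fun m' hm' h => ?_⟩
          rcases hall m' hm' with h' | h'
          · exact h' h
          · exact h' (lt_of_not_lt_of_lt h3 h)
      · refine ⟨_, hk, fun m' hm' => ?_⟩
        by_cases h : m'.2 = α
        · obtain ⟨j, β⟩ := m'
          obtain rfl : β = α := h
          exact hmin j hm'
        · exact absurd ⟨m', hm', h⟩ h2
    · refine ih Ω hne fun m hm => ?_
      rcases Finset.mem_insert.1 (hA m hm) with h | h
      · obtain ⟨j, β⟩ := m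
        obtain rfl : β = α := h
        exact absurd ⟨j, hm⟩ h1
      · exact h

theorem exists_greatest_image {A : Type*} {T : Finset A} (hT : T.Nonempty) (f : A → Mon n) :
    ∃ a ∈ T, ∀ b ∈ T, ¬ o.lt (f a) (f b) := by
  classical
  obtain ⟨a₀, ha₀⟩ := hT
  obtain ⟨_, ⟨a, ha, rfl⟩, hmax⟩ := exists_greatest (o := o) (T.image fun a => (f a).2)
    (f '' (T : Set A)) ⟨_, a₀, ha₀, rfl⟩ (by
      rintro _ ⟨a, ha, rfl⟩
      exact Finset.mem_image_of_mem (fun a => (f a).2) ha)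
  exact ⟨a, ha, fun b hb => hmax _ ⟨b, hb, rfl⟩⟩

end TLocalOrder

/-! ## Coefficients -/

section Coeff
variable {R : Type u} [CommRing R] {n : ℕ} (o : TLocalOrder n)

/-- The coefficient of a monomial in a polynomial. -/
def pc (m : Mon n) (g : Poly R n) : R := (MvPolynomial.coeff m.2 g).coeff m.1

theorem coeff_toSer (α : Fin n →₀ ℕ) (g : Poly R n) :
    MvPolynomial.coeff α (toSer g) = ((MvPolynomial.coeff α g : Polynomial R) : PowerSeries R) := by
  simp [toSer, MvPolynomial.coeff_map]

@[simp] theorem coeffAt_toSer (m : Mon n) (g : Poly R n) : coeffAt m (toSer g) = pc m g := by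
  simp [coeffAt, coeff_toSer, pc]

theorem toSer_injective : Function.Injective (toSer : Poly R n → Ser R n) := by
  intro f g h
  ext α k
  have := congrArg (coeffAt (k, α)) h
  simpa [pc] using this

@[simp] theorem pc_add (m : Mon n) (f g : Poly R n) : pc m (f + g) = pc m f + pc m g := by
  simp [pc]

@[simp] theorem pc_sub (m : Mon n) (f g : Poly R n) : pc m (f - g) = pc m f - pc m g := by
  simp [pc]

@[simp] theorem pc_zero (m : Mon n) : pc m (0 : Poly R n) = 0 := by
  simp [pc]

open Classical in
theorem pc_term (m m' : Mon n) (c : R) : pc m (term m' c) = if m' = m then c else 0 := by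
  obtain ⟨b, α⟩ := m
  obtain ⟨b', α'⟩ := m'
  simp only [pc, term, MvPolynomial.coeff_monomial, Prod.mk.injEq]
  by_cases h : α' = α
  · simp [h, Polynomial.coeff_monomial]
  · simp [h]

@[simp] theorem pc_term_self (m : Mon n) (c : R) : pc m (term m c) = c := by
  simp [pc_term]

theorem term_mul_term (m m' : Mon n) (c c' : R) :
    term m c * term m' c' = term (m + m') (c * c') := by
  simp [term, MvPolynomial.monomial_mul, Polynomial.monomial_mul_monomial]

theorem poly_ext {f g : Poly R n} (h : ∀ m, pc m f = pc m g) : f = g := by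
  ext α k
  exact h (k, α)

theorem exists_pc_ne_zero {g : Poly R n} (h : g ≠ 0) : ∃ m, pc m g ≠ 0 := by
  by_contra! h'
  exact h (poly_ext (by simpa using h'))

theorem X_pow_dvd_coeff_iff (g : Poly R n) (α : Fin n →₀ ℕ) (k : ℕ) :
    X ^ k ∣ MvPolynomial.coeff α g ↔ ∀ j < k, pc (j, α) g = 0 :=
  Polynomial.X_pow_dvd_iff

theorem eq_zero_of_forall_X_pow_dvd {a : Polynomial R} (h : ∀ k, X ^ k ∣ a) : a = 0 := by
  ext k
  exact Polynomial.X_pow_dvd_iff.1 (h (k + 1)) k (Nat.lt_succ_self k)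

/-! ## Leading monomials -/

theorem IsLeadMon.eq {f : Ser R n} {m m' : Mon n} (h : IsLeadMon o f m) (h' : IsLeadMon o f m') :
    m = m' := by
  rcases h.2 m' h'.1 with h1 | h1
  · exact h1.symm
  · rcases h'.2 m h.1 with h2 | h2
    · exact h2
    · exact absurd h1 (TLocalOrder.lt_asymm h2)

variable {o}

theorem IsLeadMon.lm_eq {f : Ser R n} {m : Mon n} (h : IsLeadMon o f m) : lm o f = m := by
  have hf : f ≠ 0 := by
    rintro rfl
    exact h.1 (by simp [coeffAt])
  exact (isLeadMon_lm o f hf).eq o h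

variable (o)

theorem lc_ne_zero {f : Ser R n} (hf : f ≠ 0) : lc o f ≠ 0 := (isLeadMon_lm o f hf).1

@[simp] theorem lc_zero : lc o (0 : Ser R n) = 0 := by simp [lc, coeffAt]

@[simp] theorem lt_zero : lt o (0 : Ser R n) = 0 := by simp [lt, term]

theorem toSer_ne_zero {g : Poly R n} : toSer g ≠ 0 ↔ g ≠ 0 := by
  rw [Ne, map_eq_zero_iff _ toSer_injective]

theorem coeffAt_eq_zero_of_lm_lt {f : Ser R n} {m : Mon n} (h : o.lt (lm o f) m) :
    coeffAt m f = 0 := by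
  by_cases hf : f = 0
  · simp [hf, coeffAt]
  by_contra hm
  rcases (isLeadMon_lm o f hf).2 m hm with h' | h'
  · exact TLocalOrder.ne_of_lt h h'.symm
  · exact TLocalOrder.lt_asymm h h'

/-- `g` has leading term `1 · m`. -/
def IsMonicAt (g : Poly R n) (m : Mon n) : Prop := pc m g = 1 ∧ ∀ m', o.lt m m' → pc m' g = 0

variable {o}

section
variable [Nontrivial R] {g : Poly R n} {m : Mon n}

theorem IsMonicAt.isLeadMon (h : IsMonicAt o g m) : IsLeadMon o (toSer g) m := by
  refine ⟨by simp [h.1], fun m' hm' => ?_⟩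
  rcases o.lt_trichotomy m m' with h' | h' | h'
  · exact absurd (h.2 m' h') (by simpa using hm')
  · exact Or.inl h'.symm
  · exact Or.inr h'

theorem IsMonicAt.plm_eq (h : IsMonicAt o g m) : plm o g = m := h.isLeadMon.lm_eq

theorem IsMonicAt.plc_eq (h : IsMonicAt o g m) : plc o g = 1 := by
  rw [plc, lc, h.isLeadMon.lm_eq, coeffAt_toSer, h.1]

theorem IsMonicAt.plt_eq (h : IsMonicAt o g m) : plt o g = term m 1 := by
  rw [plt, lt, show lc o (toSer g) = 1 from h.plc_eq, h.isLeadMon.lm_eq]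

theorem IsMonicAt.ne_zero (h : IsMonicAt o g m) : g ≠ 0 := by
  rintro rfl
  exact zero_ne_one ((pc_zero m).symm.trans h.1)

theorem IsMonicAt.coeff_ne_zero (h : IsMonicAt o g m) : MvPolynomial.coeff m.2 g ≠ 0 := by
  intro h0
  have := h.1
  simp [pc, h0] at this

end

theorem isMonicAt_of_plc {g : Poly R n} (h : plc o g = 1) : IsMonicAt o g (plm o g) :=
  ⟨by simpa [plc, lc] using h, fun m' hm' => by
    simpa using coeffAt_eq_zero_of_lm_lt o hm'⟩

theorem IsMonicAt.sub {g f : Poly R n} {m : Mon n} (h : IsMonicAt o g m)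
    (hf : ∀ m', ¬ o.lt m' m → pc m' f = 0) : IsMonicAt o (g - f) m :=
  ⟨by simp [h.1, hf m (o.lt_irrefl m)], fun m' hm' => by
    simp [h.2 m' hm', hf m' (TLocalOrder.lt_asymm hm')]⟩

theorem pc_C_mul (m : Mon n) (w : Polynomial R) (g : Poly R n) :
    pc m (MvPolynomial.C w * g) =
      ∑ ij ∈ Finset.HasAntidiagonal.antidiagonal m.1, w.coeff ij.1 * pc (ij.2, m.2) g := by
  simp [pc, MvPolynomial.coeff_C_mul, Polynomial.coeff_mul]

/-- A power of t only lowers monomials: at a monomial not below m, the factors t^i with i > 0 would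
need coefficients of g strictly above m, and those vanish. -/
theorem IsMonicAt.C_mul {g : Poly R n} {m : Mon n} (h : IsMonicAt o g m) {w : Polynomial R}
    (hw : w.coeff 0 = 1) : IsMonicAt o (MvPolynomial.C w * g) m := by
  have key : ∀ k α, ¬ o.lt (k, α) m → pc (k, α) (MvPolynomial.C w * g) = pc (k, α) g := by
    intro k α hk
    rw [pc_C_mul, Finset.sum_eq_single (0, k)]
    · simp [hw]
    · rintro ⟨i, j⟩ hij hne
      have hij' : i + j = k := by simpa using hij
      have hj : j < k := by
        rcases Nat.eq_zero_or_pos i with rfl | hi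
        · simp at hij'; subst hij'; simp at hne
        · omega
      have : o.lt m (j, α) := TLocalOrder.lt_of_not_lt_of_lt hk (o.lt_of_t_lt α hj)
      simp [h.2 _ this]
    · simp
  exact ⟨(key m.1 m.2 (o.lt_irrefl m)).trans h.1, fun m' hm' =>
    (key m'.1 m'.2 (TLocalOrder.lt_asymm hm')).trans (h.2 m' hm')⟩

/-- Terms of `w h`, where `X ^ β * w = a` and `β` is the `t`-degree of the leading monomial of `h`,
are bounded by a term of `a x^α`, where `x^α` is the `x`-part of the leading monomial of `h`. -/
theorem IsMonicAt.exists_of_pc_C_mul_ne_zero {h : Poly R n} {m : Mon n} (hh : IsMonicAt o h m)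
    {w a : Polynomial R} (hw : X ^ m.1 * w = a) {m' : Mon n}
    (hm' : pc m' (MvPolynomial.C w * h) ≠ 0) :
    ∃ k, a.coeff k ≠ 0 ∧ ¬ o.lt (k, m.2) m' := by
  rw [pc_C_mul] at hm'
  obtain ⟨⟨i, j⟩, hij, hne⟩ := Finset.exists_ne_zero_of_sum_ne_zero hm'
  have hij' : i + j = m'.1 := by simpa using hij
  -- A term of w h comes from t^i in w and t^j x^α' in h. The former is t^(i + β) in a, and t^j x^α'
  -- is not above the leading monomial of h; multiply this comparison by t^i.
  refine ⟨i + m.1, ?_, fun hlt => ?_⟩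
  · rw [← hw, mul_comm, Polynomial.coeff_mul_X_pow]
    exact left_ne_zero_of_mul hne
  · have h1 : ¬ o.lt m (j, m'.2) := fun h1 => right_ne_zero_of_mul hne (hh.2 _ h1)
    apply h1
    rw [← TLocalOrder.add_lt_add_iff (i, 0)]
    have e1 : m + (i, 0) = (i + m.1, m.2) := by ext <;> simp [add_comm]
    have e2 : (j, m'.2) + ((i, 0) : Mon n) = m' := by ext <;> simp [← hij', add_comm]
    rwa [e1, e2]

end Coeff

/-! ## Loops -/

/-- Total correctness of a while loop: `Inv` is the loop invariant, and termination comes from a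
descent along `r` in every pass that does not leave the loop. -/
theorem exists_mem_fix {α β : Type*} {f : α →. β ⊕ α} {Inv : α → Prop} {Post : β → Prop}
    {r : α → α → Prop} (wf : WellFounded r)
    (h : ∀ a, Inv a → ∃ x ∈ f a, (∃ b, x = Sum.inl b ∧ Post b) ∨
      ∃ a', x = Sum.inr a' ∧ Inv a' ∧ r a' a) (a : α) (ha : Inv a) :
    ∃ b ∈ PFun.fix f a, Post b := by
  induction a using wf.induction with
  | _ a ih =>
    obtain ⟨x, hx, ⟨b, rfl, hb⟩ | ⟨a', rfl, ha', hr⟩⟩ := h a ha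
    · exact ⟨b, PFun.mem_fix_iff.2 (Or.inl hx), hb⟩
    · obtain ⟨b, hb, hP⟩ := ih a' hr ha'
      exact ⟨b, PFun.mem_fix_iff.2 (Or.inr ⟨a', hx, hb⟩), hP⟩

/-! ## Reduction with respect to `p - t` -/

section PReduce
variable {R : Type u} [CommRing R] {n : ℕ} {o : TLocalOrder n}

/-- The polynomial `p - t` in `R[t]`. -/
def pMinusT (p : R) : Polynomial R := Polynomial.C p - X

theorem cst_sub_tVar (p : R) : (cst p - tVar : Poly R n) = MvPolynomial.C (pMinusT p) := by
  simp [cst, tVar, pMinusT]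

@[simp] theorem eval_pMinusT (p : R) : (pMinusT p).eval p = 0 := by simp [pMinusT]

theorem eval_eq_of_pMinusT_dvd {p : R} {a b : Polynomial R} (h : pMinusT p ∣ a - b) :
    a.eval p = b.eval p := by
  obtain ⟨c, hc⟩ := h
  have := congrArg (Polynomial.eval p) hc
  simpa [sub_eq_zero] using this

theorem pMinusT_dvd_pow_sub (p : R) (l : ℕ) :
    pMinusT p ∣ Polynomial.C p ^ l - X ^ l := sub_dvd_pow_sub_pow _ _ _

/-- The lowest coefficient is not divisible by `p`. -/
def IsCleanCoeff (p : R) (a : Polynomial R) : Prop := a ≠ 0 → ¬ p ∣ a.trailingCoeff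

theorem dvd_eval_of_X_pow_dvd (p : R) {a : Polynomial R} {k : ℕ} (h : X ^ k ∣ a) :
    p ^ k ∣ a.eval p := by
  obtain ⟨c, rfl⟩ := h
  simp

/-- The values of a at p and at 0 are congruent modulo p. -/
theorem dvd_eval_iff_dvd_coeff_zero (p : R) (a : Polynomial R) : p ∣ a.eval p ↔ p ∣ a.coeff 0 := by
  have h := congrArg (Polynomial.eval p) (Polynomial.X_mul_divX_add a)
  rw [Polynomial.eval_add, Polynomial.eval_mul, Polynomial.eval_X, Polynomial.eval_C] at h
  rw [← h, dvd_add_right (dvd_mul_right _ _)]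

/-- Write a = t^e c with c(0) prime to p. Then a(p) = p^e c(p) and c(p) ≡ c(0) modulo p, so the
p-adic valuation of a(p) is exactly e. This is the bridge between initial monomials and values at t
= p. -/
theorem IsCleanCoeff.X_pow_dvd {p : R} (hp : Prime p) [IsDomain R] {a : Polynomial R}
    (ha : IsCleanCoeff p a) {k : ℕ} (h : p ^ k ∣ a.eval p) : X ^ k ∣ a := by
  by_cases h0 : a = 0
  · simp [h0]
  have h1 : X ^ a.natTrailingDegree ∣ a :=
    Polynomial.X_pow_dvd_iff.2 fun d hd => Polynomial.coeff_eq_zero_of_lt_natTrailingDegree hd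
  obtain ⟨c, hc⟩ := h1
  have hc0 : c.coeff 0 = a.trailingCoeff := by
    have := congrArg (fun f => Polynomial.coeff f a.natTrailingDegree) hc
    simp only [Polynomial.coeff_X_pow_mul', le_refl, if_true, Nat.sub_self] at this
    exact this.symm
  have hev : a.eval p = p ^ a.natTrailingDegree * c.eval p := by
    have := congrArg (Polynomial.eval p) hc
    rwa [Polynomial.eval_mul, Polynomial.eval_pow, Polynomial.eval_X] at this
  rw [hc]
  refine Dvd.dvd.mul_right (pow_dvd_pow _ ?_) _
  by_contra! hlt
  apply ha h0
  rw [← hc0, ← dvd_eval_iff_dvd_coeff_zero]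
  have : p ^ (a.natTrailingDegree + 1) ∣ p ^ a.natTrailingDegree * c.eval p :=
    (pow_dvd_pow _ hlt).trans (hev ▸ h)
  rw [pow_succ] at this
  exact (mul_dvd_mul_iff_left (pow_ne_zero _ hp.ne_zero)).1 this

theorem IsCleanCoeff.X_pow_dvd_iff {p : R} (hp : Prime p) [IsDomain R] {a : Polynomial R}
    (ha : IsCleanCoeff p a) {k : ℕ} : X ^ k ∣ a ↔ p ^ k ∣ a.eval p :=
  ⟨dvd_eval_of_X_pow_dvd p, ha.X_pow_dvd hp⟩

/-- Weight of a coefficient for the termination of `pReduce`. -/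
def coeffWeight (p c : R) : ℕ := open Classical in if c = 0 then 0 else if p ∣ c then 2 else 1

/-- Weight of a univariate polynomial for the termination of `pReduce`. -/
def weight (p : R) (a : Polynomial R) : ℕ := ∑ k ∈ a.support, coeffWeight p (a.coeff k)

theorem weight_eq_sum (p : R) (a : Polynomial R) {S : Finset ℕ} (h : a.support ⊆ S) :
    weight p a = ∑ k ∈ S, coeffWeight p (a.coeff k) :=
  Finset.sum_subset h fun k _ hk => by
    simp [coeffWeight, Polynomial.notMem_support_iff.1 hk]

/-- Position k loses weight 2. Position k + l gains at most 1: if its coefficient was 0, it becomes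
c, which is prime to p and has weight 1; otherwise its weight was already at least 1 and never
exceeds 2. -/
theorem weight_rewrite_lt {p : R} (a : Polynomial R) {k l : ℕ} {c : R} (hl : l ≠ 0)
    (hk : a.coeff k = p ^ l * c) (h0 : a.coeff k ≠ 0) (hc : ¬ p ∣ c) :
    weight p (a - Polynomial.monomial k c * (Polynomial.C p ^ l - X ^ l)) < weight p a := by
  classical
  set b := a - Polynomial.monomial k c * (Polynomial.C p ^ l - X ^ l) with hb
  have hcoeff : ∀ j, b.coeff j = a.coeff j - (if k = j then p ^ l * c else 0)
      + (if k + l = j then c else 0) := by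
    intro j
    have : b = a - Polynomial.monomial k (p ^ l * c) + Polynomial.monomial (k + l) c := by
      rw [hb, mul_sub, ← Polynomial.C_pow, Polynomial.monomial_mul_C,
        Polynomial.monomial_mul_X_pow, mul_comm c]
      ring
    rw [this]
    simp [Polynomial.coeff_monomial]
  have hkl : k + l ≠ k := by omega
  have h1 : b.coeff k = 0 := by rw [hcoeff]; simp [hk, hl]
  have h2 : b.coeff (k + l) = a.coeff (k + l) + c := by rw [hcoeff]; simp [hl]
  have h3 : ∀ j, j ≠ k → j ≠ k + l → b.coeff j = a.coeff j := fun j hj hj' => by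
    rw [hcoeff]; simp [hj.symm, hj'.symm]
  set S := ((a.support ∪ b.support) ∪ {k, k + l})
  have hkS : k ∈ S := by simp [S]
  have hklS : k + l ∈ S.erase k := by simp [S, hl]
  rw [weight_eq_sum p b (S := S) (fun x hx => by simp [S, Polynomial.mem_support_iff.1 hx]),
    weight_eq_sum p a (S := S) (fun x hx => by simp [S, Polynomial.mem_support_iff.1 hx]),
    ← Finset.add_sum_erase S _ hkS, ← Finset.add_sum_erase S _ hkS,
    ← Finset.add_sum_erase _ _ hklS, ← Finset.add_sum_erase _ _ hklS]
  have h4 : ∑ x ∈ (S.erase k).erase (k + l), coeffWeight p (b.coeff x) =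
      ∑ x ∈ (S.erase k).erase (k + l), coeffWeight p (a.coeff x) :=
    Finset.sum_congr rfl fun x hx => by
      simp only [Finset.mem_erase] at hx
      rw [h3 x hx.2.1 hx.1]
  have h5 : coeffWeight p (a.coeff k) = 2 := by
    have : p ∣ a.coeff k := hk ▸ (dvd_pow_self p hl).mul_right c
    simp [coeffWeight, h0, this]
  have h6 : coeffWeight p (b.coeff (k + l)) ≤ coeffWeight p (a.coeff (k + l)) + 1 := by
    rw [h2]
    by_cases h : a.coeff (k + l) = 0
    · rw [h, zero_add]
      simp only [coeffWeight, hc, if_false]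
      split_ifs <;> omega
    · have : 1 ≤ coeffWeight p (a.coeff (k + l)) := by
        simp only [coeffWeight, h, if_false]
        split_ifs <;> omega
      have : coeffWeight p (a.coeff (k + l) + c) ≤ 2 := by
        simp only [coeffWeight]
        split_ifs <;> omega
      omega
  have h7 : coeffWeight p (b.coeff k) = 0 := by simp [h1, coeffWeight]
  omega

theorem weight_pos {p : R} {a : Polynomial R} (h : a ≠ 0) : 0 < weight p a := by
  obtain ⟨k, hk⟩ := Polynomial.support_nonempty.2 h
  refine Finset.sum_pos' (fun _ _ => Nat.zero_le _) ⟨k, hk, ?_⟩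
  simp only [coeffWeight, Polynomial.mem_support_iff.1 hk, if_false]
  split_ifs <;> omega

theorem quot_mul {a b : R} (h : b ∣ a) : b * quot a b = a := by
  rw [quot, dif_pos h]
  exact h.choose_spec.symm

/-- What is preserved by the loop of the `(p - t)`-reduction of `g`; here `γ` is the `x`-part of
the leading monomial of `g`. -/
structure PReduceInv (p : R) (g : Poly R n) (γ : Fin n →₀ ℕ) (s : Poly R n × Poly R n) : Prop where
  lead : MvPolynomial.coeff γ s.1 = MvPolynomial.coeff γ g
  lead' : MvPolynomial.coeff γ s.2 = 0
  disj : ∀ α, MvPolynomial.coeff α s.1 = 0 ∨ MvPolynomial.coeff α s.2 = 0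
  clean : ∀ α, α ≠ γ → IsCleanCoeff p (MvPolynomial.coeff α s.1)
  dvd : MvPolynomial.C (pMinusT p) ∣ s.1 + s.2 - g
  pow_dvd : ∀ α k, X ^ k ∣ MvPolynomial.coeff α g →
    X ^ k ∣ MvPolynomial.coeff α s.1 ∧ X ^ k ∣ MvPolynomial.coeff α s.2

/-- Because t < 1, a lower power of t with the same x-part would give a greater monomial. -/
theorem IsLeadMon.natTrailingDegree_eq {g : Poly R n} {m : Mon n} (h : IsLeadMon o (toSer g) m) :
    (MvPolynomial.coeff m.2 g).natTrailingDegree = m.1 := by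
  have hne : (MvPolynomial.coeff m.2 g).coeff m.1 ≠ 0 := by simpa [pc] using h.1
  refine le_antisymm (Polynomial.natTrailingDegree_le_of_ne_zero hne) ?_
  by_contra! hlt
  have h0 : MvPolynomial.coeff m.2 g ≠ 0 := by
    intro h0; simp [h0] at hne
  have h1 : coeffAt ((MvPolynomial.coeff m.2 g).natTrailingDegree, m.2) (toSer g) ≠ 0 := by
    rw [coeffAt_toSer]
    exact Polynomial.trailingCoeff_nonzero_iff_nonzero.2 h0
  rcases h.2 _ h1 with h2 | h2
  · rw [← h2] at hlt
    simp at hlt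
  · exact TLocalOrder.lt_asymm h2 (o.lt_of_t_lt m.2 hlt)

/-- Each pass either rewrites p^l by t^l in a leading term or moves an x-part whose lowest
coefficient is prime to p to the finished side. The last clause says that no x-part acquires a lower
power of t; applied for all k it also keeps vanishing coefficients zero. -/
theorem exists_mem_pReduce [IsDomain R] [IsNoetherianRing R] {p : R} (hp : Prime p)
    (g : Poly R n) : ∃ g' ∈ pReduce o p g,
      MvPolynomial.coeff (plm o g).2 g' = MvPolynomial.coeff (plm o g).2 g ∧
      (∀ α, α ≠ (plm o g).2 → IsCleanCoeff p (MvPolynomial.coeff α g')) ∧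
      MvPolynomial.C (pMinusT p) ∣ g' - g ∧
      ∀ α k, X ^ k ∣ MvPolynomial.coeff α g → X ^ k ∣ MvPolynomial.coeff α g' := by
  classical
  set γ := (plm o g).2 with hγ
  -- It suffices to sum over the support of g: by `PReduceInv.pow_dvd`, an x-part absent from g
  -- never appears.
  let μ : Poly R n × Poly R n → ℕ := fun s =>
    ∑ α ∈ g.support, weight p (MvPolynomial.coeff α s.2)
  have start : PReduceInv p g γ (MvPolynomial.monomial γ (MvPolynomial.coeff γ g),
      g - MvPolynomial.monomial γ (MvPolynomial.coeff γ g)) := by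
    constructor
    · simp
    · simp
    · intro α
      by_cases h : γ = α
      · right; simp [h]
      · left; simp [MvPolynomial.coeff_monomial, h]
    · intro α h h'
      simp [MvPolynomial.coeff_monomial, h.symm] at h'
    · simp
    · intro α k hk
      by_cases h : γ = α
      · subst h; simp [hk]
      · simp [MvPolynomial.coeff_monomial, h, hk]
  suffices hstep : ∀ s, PReduceInv p g γ s → ∃ x ∈ Part.some (pReduceStep o p s),
      (∃ b, x = Sum.inl b ∧ PReduceInv p g γ (b, 0)) ∨
        ∃ s', x = Sum.inr s' ∧ PReduceInv p g γ s' ∧ μ s' < μ s by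
    obtain ⟨g', hg', h⟩ := exists_mem_fix (f := fun s => Part.some (pReduceStep o p s))
      (measure μ).wf hstep _ start
    exact ⟨g', hg', h.lead, h.clean, by simpa using h.dvd, fun α k hk => (h.pow_dvd α k hk).1⟩
  rintro ⟨a, b⟩ inv
  refine ⟨_, Part.mem_some _, ?_⟩
  by_cases hb : b = 0
  · left
    subst hb
    exact ⟨a, by simp [pReduceStep], inv⟩
  right
  set m := plm o b with hm
  have hlm : IsLeadMon o (toSer b) m := isLeadMon_lm o _ ((toSer_ne_zero).2 hb)
  have hc0 : pc m b ≠ 0 := by simpa using hlm.1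
  have hplc : plc o b = pc m b := by simp [plc, lc, hm]
  have hbm : MvPolynomial.coeff m.2 b ≠ 0 := by intro h; simp [pc, h] at hc0
  have hmγ : m.2 ≠ γ := by intro h; rw [h] at hbm; exact hbm inv.lead'
  have ham : MvPolynomial.coeff m.2 a = 0 := (inv.disj m.2).resolve_right hbm
  have hms : m.2 ∈ g.support := by
    rw [MvPolynomial.mem_support_iff]
    intro h
    exact hbm (eq_zero_of_forall_X_pow_dvd fun k => (inv.pow_dvd m.2 k (by simp [h])).2)
  have htd := hlm.natTrailingDegree_eq
  by_cases hpc : p ∣ pc m b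
  -- Rewriting: c is the cofactor of the full power of p, hence prime to p, which is what makes the
  -- weight drop.
  · set l := multiplicity p (pc m b) with hl
    have hfin : FiniteMultiplicity p (pc m b) := FiniteMultiplicity.of_not_isUnit hp.not_isUnit hc0
    have hl0 : l ≠ 0 := by
      intro h
      exact hfin.not_pow_dvd_of_multiplicity_lt (m := 1) (by omega) (by simpa using hpc)
    set c := quot (pc m b) (p ^ l) with hcdef
    have hc : p ^ l * c = pc m b := quot_mul (pow_multiplicity_dvd p _)
    have hpnc : ¬ p ∣ c := by
      rintro ⟨d, hd⟩
      refine hfin.not_pow_dvd_of_multiplicity_lt (m := l + 1) (by omega) ⟨d, ?_⟩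
      rw [← hc, hd]; ring
    set q : Polynomial R := Polynomial.monomial m.1 c * (Polynomial.C p ^ l - X ^ l) with hq
    have hqt : term m c * (cst p ^ l - tVar ^ l) = (MvPolynomial.monomial m.2 q : Poly R n) := by
      simp only [term, cst, tVar, ← MvPolynomial.C_pow, ← MvPolynomial.C_sub, hq]
      rw [mul_comm, MvPolynomial.C_mul_monomial, mul_comm]
    have hstep : pReduceStep o p (a, b) = Sum.inr (a, b - MvPolynomial.monomial m.2 q) := by
      simp only [pReduceStep, hb, if_false, hplc, hpc, if_true]
      rw [← hqt, hcdef, hl, hm]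
    refine ⟨_, hstep, ?_, ?_⟩
    · constructor
      · exact inv.lead
      · simp [MvPolynomial.coeff_monomial, hmγ, inv.lead']
      · intro α
        by_cases h : m.2 = α
        · left; rw [← h]; exact ham
        · simpa [MvPolynomial.coeff_monomial, h] using inv.disj α
      · exact inv.clean
      · have h1 : MvPolynomial.C (pMinusT p) ∣ (MvPolynomial.monomial m.2 q : Poly R n) := by
          obtain ⟨d, hd⟩ := (pMinusT_dvd_pow_sub p l).mul_left (Polynomial.monomial m.1 c)
          rw [hq, hd, ← MvPolynomial.C_mul_monomial]
          exact dvd_mul_right _ _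
        have h2 := dvd_sub inv.dvd h1
        have e : a + b - g - MvPolynomial.monomial m.2 q =
          a + (b - MvPolynomial.monomial m.2 q) - g := by ring
        rwa [e] at h2
      · intro α k hk
        refine ⟨(inv.pow_dvd α k hk).1, ?_⟩
        by_cases h : m.2 = α
        · subst h
          have hk' := (inv.pow_dvd _ k hk).2
          have hkm : k ≤ m.1 := by
            by_contra! hlt
            exact hc0 (Polynomial.X_pow_dvd_iff.1 hk' _ hlt)
          simp only [MvPolynomial.coeff_sub, MvPolynomial.coeff_monomial, if_true]
          refine dvd_sub hk' (Dvd.dvd.mul_right ?_ _)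
          rw [← Polynomial.C_mul_X_pow_eq_monomial]
          exact Dvd.dvd.mul_left (pow_dvd_pow _ hkm) _
        · simpa [MvPolynomial.coeff_monomial, h] using (inv.pow_dvd α k hk).2
    · unfold μ
      refine Finset.sum_lt_sum (fun α _ => ?_) ⟨m.2, hms, ?_⟩
      · by_cases h : m.2 = α
        · subst h
          simp only [MvPolynomial.coeff_sub, MvPolynomial.coeff_monomial, if_true]
          exact (weight_rewrite_lt _ hl0 hc.symm hc0 hpnc).le
        · simp [MvPolynomial.coeff_monomial, h]
      · simp only [MvPolynomial.coeff_sub, MvPolynomial.coeff_monomial, if_true]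
        exact weight_rewrite_lt _ hl0 hc.symm hc0 hpnc
  -- Moving: the coefficient of x^α is clean because its lowest coefficient is the leading
  -- coefficient of b. The weight of this x-part drops to 0.
  · set q : Poly R n := MvPolynomial.monomial m.2 (MvPolynomial.coeff m.2 b) with hq
    have hstep : pReduceStep o p (a, b) = Sum.inr (a + q, b - q) := by
      simp only [pReduceStep, hb, if_false, hplc, hpc]
      rw [hq, hm]
    have hq1 : MvPolynomial.coeff m.2 q = MvPolynomial.coeff m.2 b := by simp [hq]
    have hq2 : ∀ α, m.2 ≠ α → MvPolynomial.coeff α q = 0 := fun α h => by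
      simp [hq, MvPolynomial.coeff_monomial, h]
    refine ⟨_, hstep, ?_, ?_⟩
    · constructor
      · simp [hq2 γ hmγ, inv.lead]
      · simp [hq2 γ hmγ, inv.lead']
      · intro α
        by_cases h : m.2 = α
        · right; subst h; simp [hq1]
        · simpa [hq2 α h] using inv.disj α
      · intro α hα
        by_cases h : m.2 = α
        · subst h
          simp only [MvPolynomial.coeff_add, ham, hq1, zero_add]
          intro _
          rwa [Polynomial.trailingCoeff, htd]
        · simpa [hq2 α h] using inv.clean α hα
      · simpa using inv.dvd
      · intro α k hk
        by_cases h : m.2 = α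
        · subst h
          simpa [ham, hq1] using (inv.pow_dvd _ k hk).2
        · simpa [hq2 α h] using inv.pow_dvd α k hk
    · unfold μ
      refine Finset.sum_lt_sum (fun α _ => ?_) ⟨m.2, hms, ?_⟩
      · by_cases h : m.2 = α
        · subst h
          simp [hq1, weight]
        · simp [hq2 α h]
      · simp only [MvPolynomial.coeff_sub, hq1, sub_self]
        simpa [weight] using weight_pos (p := p) hbm

end PReduce

/-! ## Reduction of polynomials of the same degree -/

section SameDegree
variable {R : Type u} [CommRing R] {n : ℕ}

/-- A homogeneous polynomial of degree `d` in `I` whose leading term is the monomial `m`. -/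
structure IsPre (o : TLocalOrder n) (I : Ideal (Ser R n)) (d : ℕ) (g : Poly R n) (m : Mon n) :
    Prop where
  monic : IsMonicAt o g m
  hom : MvPolynomial.IsHomogeneous g d
  mem : toSer g ∈ I

/-- A homogeneous polynomial of degree `d` in `I` whose leading term is the monomial `m` and all of
whose coefficients are clean. -/
structure IsGood (o : TLocalOrder n) (p : R) (I : Ideal (Ser R n)) (d : ℕ) (g : Poly R n)
    (m : Mon n) : Prop extends IsPre o I d g m where
  clean : ∀ α, IsCleanCoeff p (MvPolynomial.coeff α g)

variable {o : TLocalOrder n} {p : R} {I : Ideal (Ser R n)} {d : ℕ}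

theorem toSer_mem_of_dvd (hI : toSer (cst p - tVar) ∈ I) {f : Poly R n}
    (h : MvPolynomial.C (pMinusT p) ∣ f) : toSer f ∈ I := by
  obtain ⟨c, rfl⟩ := h
  rw [map_mul, ← cst_sub_tVar]
  exact I.mul_mem_right _ hI

theorem coeff_dvd_of_C_dvd {q : Polynomial R} {f : Poly R n} (h : MvPolynomial.C q ∣ f)
    (α : Fin n →₀ ℕ) : q ∣ MvPolynomial.coeff α f := by
  obtain ⟨c, rfl⟩ := h
  simp [MvPolynomial.coeff_C_mul]

theorem isHomogeneous_of_X_pow_dvd {g g' : Poly R n} (hg : MvPolynomial.IsHomogeneous g d)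
    (h : ∀ α k, X ^ k ∣ MvPolynomial.coeff α g → X ^ k ∣ MvPolynomial.coeff α g') :
    MvPolynomial.IsHomogeneous g' d := fun α hα => hg fun h0 =>
  hα (eq_zero_of_forall_X_pow_dvd fun k => h α k (by simp [h0]))

theorem X_pow_mul_divByMonic {a : Polynomial R} {b : ℕ} (h : X ^ b ∣ a) :
    X ^ b * (a /ₘ X ^ b) = a := by
  have h1 := (Polynomial.modByMonic_eq_zero_iff_dvd (Polynomial.monic_X_pow b)).2 h
  have h2 := Polynomial.modByMonic_add_div a (X ^ b : Polynomial R)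
  rwa [h1, zero_add] at h2

theorem IsMonicAt.X_pow_dvd {g : Poly R n} {m : Mon n} (h : IsMonicAt o g m) :
    X ^ m.1 ∣ MvPolynomial.coeff m.2 g :=
  (X_pow_dvd_coeff_iff _ _ _).2 fun _ hj => h.2 _ (o.lt_of_t_lt _ hj)

variable (M : ℕ → Mon n) (N : ℕ)

/-- `g` and `g'` have the same initial monomials above `s`. -/
def SameAbove (o : TLocalOrder n) (s : Mon n) (g g' : Poly R n) : Prop :=
  ∀ α k, o.lt s (k, α) →
    (X ^ (k + 1) ∣ MvPolynomial.coeff α g' ↔ X ^ (k + 1) ∣ MvPolynomial.coeff α g)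

/-- The list is mutually reduced as far as initial monomials above `s` are concerned. -/
def FineAbove (o : TLocalOrder n) (s : Mon n) (L : List (Poly R n)) : Prop :=
  ∀ i < N, ∀ j < N, i ≠ j → X ^ (M j).1 ∣ MvPolynomial.coeff (M j).2 (L.getD i 0) →
    ∀ k, o.lt s (k, (M j).2) → X ^ (k + 1) ∣ MvPolynomial.coeff (M j).2 (L.getD i 0)

/-- Initial monomials above `s` are preserved whenever the list is mutually reduced above `s`. -/
def Follows (o : TLocalOrder n) (L L' : List (Poly R n)) : Prop :=
  ∀ s, FineAbove M N o s L → ∀ i < N, SameAbove o s (L.getD i 0) (L'.getD i 0)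

/-- All entries of the list are good, with leading monomials given by `M`. -/
structure PassInv (o : TLocalOrder n) (p : R) (I : Ideal (Ser R n)) (d : ℕ)
    (L : List (Poly R n)) : Prop where
  len : L.length = N
  good : ∀ i < N, IsGood o p I d (L.getD i 0) (M i)

variable {M N}

theorem Follows.refl (L : List (Poly R n)) : Follows M N o L L :=
  fun _ _ _ _ _ _ _ => Iff.rfl

theorem FineAbove.of_sameAbove {s : Mon n} {L L' : List (Poly R n)} (h : FineAbove M N o s L)
    (hs : ∀ i < N, SameAbove o s (L.getD i 0) (L'.getD i 0)) : FineAbove M N o s L' := by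
  intro i hi j hj hij hdvd k hk
  rcases Nat.lt_or_ge k (M j).1 with h1 | h1
  · exact (pow_dvd_pow _ h1).trans hdvd
  · rw [hs i hi _ _ hk]
    refine h i hi j hj hij ?_ k hk
    -- Divisibility by t^(b + 1) concerns exponents up to b. As b < k, the monomial t^b x^α is above
    -- s as well, so the hypothesis on initial monomials transfers the divisibility back to the old
    -- list.
    rcases hb : (M j).1 with _ | b
    · simp
    · have hlt : o.lt (k, (M j).2) (b, (M j).2) := o.lt_of_t_lt _ (by omega)
      rw [hb] at hdvd
      exact (hs i hi _ _ (TLocalOrder.lt_trans hk hlt)).1 hdvd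

theorem Follows.trans {L L' L'' : List (Poly R n)} (h : Follows M N o L L')
    (h' : Follows M N o L' L'') : Follows M N o L L'' := fun s hs i hi α k hk =>
  (h' s (hs.of_sameAbove (h s hs)) i hi α k hk).trans (h s hs i hi α k hk)

theorem mem_foldlM_cons {α β : Type*} {f : β → α → Part β} {s s' t : β} {a : α} {l : List α}
    (h : s' ∈ f s a) (h' : t ∈ l.foldlM f s') : t ∈ (a :: l).foldlM f s := by
  rw [List.foldlM_cons, Part.bind_eq_bind]
  exact Part.mem_bind h h'

theorem mem_foldlM_append {α β : Type*} {f : β → α → Part β} {s s' t : β} {l l' : List α}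
    (h : s' ∈ l.foldlM f s) (h' : t ∈ l'.foldlM f s') : t ∈ (l ++ l').foldlM f s := by
  rw [List.foldlM_append, Part.bind_eq_bind]
  exact Part.mem_bind h h'

variable [IsDomain R] [IsNoetherianRing R]

/-- Procedure (A) leaves the leading x-part untouched, but its lowest coefficient is the leading
coefficient 1, which is prime to p. So every coefficient of the result is clean. -/
theorem IsPre.exists_mem_pReduce (hp : Prime p) (hI : toSer (cst p - tVar) ∈ I) {g : Poly R n}
    {m : Mon n} (hg : IsPre o I d g m) : ∃ g' ∈ pReduce o p g, IsGood o p I d g' m ∧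
      MvPolynomial.C (pMinusT p) ∣ g' - g ∧
      ∀ α k, X ^ k ∣ MvPolynomial.coeff α g → X ^ k ∣ MvPolynomial.coeff α g' := by
  obtain ⟨g', hg', hlead, hclean, hdvd, hpow⟩ := InRed.exists_mem_pReduce (o := o) hp g
  rw [hg.monic.plm_eq] at hlead hclean
  have hmon : IsMonicAt o g' m := by
    refine ⟨by rw [pc, hlead]; exact hg.monic.1, fun m' hm' => ?_⟩
    have h1 : X ^ (m'.1 + 1) ∣ MvPolynomial.coeff m'.2 g := by
      rw [X_pow_dvd_coeff_iff]
      intro j hj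
      apply hg.monic.2
      rcases (Nat.lt_succ_iff.1 hj).eq_or_lt with rfl | hj
      · exact hm'
      · exact TLocalOrder.lt_trans hm' (o.lt_of_t_lt _ hj)
    exact (X_pow_dvd_coeff_iff _ _ _).1 (hpow _ _ h1) _ (Nat.lt_succ_self _)
  refine ⟨g', hg', ⟨⟨hmon, isHomogeneous_of_X_pow_dvd hg.hom hpow, ?_⟩, fun α => ?_⟩, hdvd, hpow⟩
  · have := I.add_mem (toSer_mem_of_dvd hI hdvd) hg.mem
    rwa [← map_add, sub_add_cancel] at this
  · by_cases h : α = m.2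
    · subst h
      intro _
      rw [Polynomial.trailingCoeff, hmon.isLeadMon.natTrailingDegree_eq]
      have : (MvPolynomial.coeff m.2 g').coeff m.1 = 1 := hmon.1
      rw [this]
      exact fun h => hp.not_isUnit (isUnit_of_dvd_one h)
    · exact hclean α h

/-- Modulo p - t the result is u g - w h, where u(0) = 1 and hence u(p) is prime to p. If t^k
divides a coefficient of w h, then p^k divides its value at p, so p^k divides the value of g'
exactly when it divides that of g. Cleanness translates this back into divisibility by t^k. -/
theorem exists_mem_pReduce_cancel (hp : Prime p) (hI : toSer (cst p - tVar) ∈ I)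
    {g h : Poly R n} {mg mh : Mon n} (hg : IsGood o p I d g mg) (hh : IsGood o p I d h mh)
    (hne : mg.2 ≠ mh.2) (hdvd : X ^ mh.1 ∣ MvPolynomial.coeff mh.2 g) :
    ∃ g' ∈ pReduce o p (cancel mh g h), IsGood o p I d g' mg ∧ MvPolynomial.coeff mh.2 g' = 0 ∧
      ∀ α k, (∀ w : Polynomial R, X ^ mh.1 * w = MvPolynomial.coeff mh.2 g →
          X ^ k ∣ MvPolynomial.coeff α (MvPolynomial.C w * h)) →
        (X ^ k ∣ MvPolynomial.coeff α g' ↔ X ^ k ∣ MvPolynomial.coeff α g) := by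
  set u := MvPolynomial.coeff mh.2 h /ₘ X ^ mh.1 with hu
  set w := MvPolynomial.coeff mh.2 g /ₘ X ^ mh.1 with hw
  have hu' : X ^ mh.1 * u = MvPolynomial.coeff mh.2 h := X_pow_mul_divByMonic hh.monic.X_pow_dvd
  have hw' : X ^ mh.1 * w = MvPolynomial.coeff mh.2 g := X_pow_mul_divByMonic hdvd
  have hu0 : u.coeff 0 = 1 := by
    have h1 : (MvPolynomial.coeff mh.2 h).coeff mh.1 = 1 := hh.monic.1
    rw [← hu', Polynomial.coeff_X_pow_mul'] at h1
    simpa using h1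
  have hpu : ¬ p ∣ u.eval p := by
    rw [dvd_eval_iff_dvd_coeff_zero, hu0]
    exact fun h => hp.not_isUnit (isUnit_of_dvd_one h)
  have hc : cancel mh g h = MvPolynomial.C u * g - MvPolynomial.C w * h := rfl
  have hpre : IsPre o I d (cancel mh g h) mg := by
    rw [hc]
    refine ⟨(hg.monic.C_mul hu0).sub fun m' hm' => ?_, ?_, ?_⟩
    -- A term of w h not below the leading monomial of g would, after bounding it by a term of g
    -- with x-part that of h, give a term of g at or above its leading monomial with another x-part.
    · by_contra hne'
      obtain ⟨k, hk, hlt⟩ := hh.monic.exists_of_pc_C_mul_ne_zero hw' hne'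
      have h1 : ¬ o.lt mg (k, mh.2) := fun h1 => hk (hg.monic.2 _ h1)
      rcases TLocalOrder.not_lt.1 (TLocalOrder.not_lt_trans hm' hlt) with h2 | h2
      · exact hne (congrArg Prod.snd h2 : mg.2 = (k, mh.2).2)
      · exact h1 h2
    · have h1 := (MvPolynomial.isHomogeneous_C (Fin n) u).mul hg.hom
      have h2 := (MvPolynomial.isHomogeneous_C (Fin n) w).mul hh.hom
      rw [zero_add] at h1 h2
      exact h1.sub h2
    · rw [map_sub, map_mul, map_mul]
      exact I.sub_mem (I.mul_mem_left _ hg.mem) (I.mul_mem_left _ hh.mem)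
  obtain ⟨g', hg', hgood, hcong, hpow⟩ := hpre.exists_mem_pReduce hp hI
  refine ⟨g', hg', hgood, eq_zero_of_forall_X_pow_dvd fun k => hpow _ k ?_, fun α k hk => ?_⟩
  · have : MvPolynomial.coeff mh.2 (cancel mh g h) = 0 := by
      rw [hc, MvPolynomial.coeff_sub, MvPolynomial.coeff_C_mul, MvPolynomial.coeff_C_mul,
        ← hu', ← hw']
      ring
    rw [this]
    exact dvd_zero _
  · have h1 := eval_eq_of_pMinusT_dvd (by
      simpa only [MvPolynomial.coeff_sub] using coeff_dvd_of_C_dvd hcong α)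
    have h2 := dvd_eval_of_X_pow_dvd p (hk w hw')
    rw [(hgood.clean α).X_pow_dvd_iff hp, (hg.clean α).X_pow_dvd_iff hp, h1, hc,
      MvPolynomial.coeff_sub, Polynomial.eval_sub, MvPolynomial.coeff_C_mul, Polynomial.eval_mul,
      dvd_sub_left h2]
    exact ⟨fun h => hp.pow_dvd_of_dvd_mul_left k hpu h, fun h => h.mul_left _⟩

/-- One elimination of entry i by entry j. The terms of w h are bounded by terms t^k x^(α_j) of
entry i. If the list is mutually reduced above s, none of these is above s, so initial monomials
above s survive. -/
theorem PassInv.exists_set (hp : Prime p) (hI : toSer (cst p - tVar) ∈ I)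
    {L : List (Poly R n)} (hL : PassInv M N o p I d L) {i j : ℕ} (hi : i < N) (hj : j < N)
    (hM : (M i).2 ≠ (M j).2) (hdvd : X ^ (M j).1 ∣ MvPolynomial.coeff (M j).2 (L.getD i 0)) :
    ∃ g' ∈ pReduce o p (cancel (M j) (L.getD i 0) (L.getD j 0)),
      PassInv M N o p I d (L.set i g') ∧ Follows M N o L (L.set i g') ∧
      MvPolynomial.coeff (M j).2 ((L.set i g').getD i 0) = 0 ∧
      (∀ α, MvPolynomial.coeff α (L.getD j 0) = 0 → ∀ k,
        (X ^ k ∣ MvPolynomial.coeff α ((L.set i g').getD i 0) ↔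
          X ^ k ∣ MvPolynomial.coeff α (L.getD i 0))) ∧
      ∀ i', i' ≠ i → (L.set i g').getD i' 0 = L.getD i' 0 := by
  obtain ⟨g', hg', hgood, hz, hiff⟩ :=
    exists_mem_pReduce_cancel hp hI (hL.good i hi) (hL.good j hj) hM hdvd
  have hset : (L.set i g').getD i 0 = g' := by
    simp [List.getD_eq_getElem?_getD, hL.len, hi]
  have hother : ∀ i', i' ≠ i → (L.set i g').getD i' 0 = L.getD i' 0 := fun i' h => by
    simp [List.getD_eq_getElem?_getD, h.symm]
  refine ⟨g', hg', ⟨by simp [hL.len], fun i' hi' => ?_⟩, ?_, ?_, ?_, hother⟩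
  · by_cases h : i' = i
    · subst h; rwa [hset]
    · rw [hother i' h]; exact hL.good i' hi'
  · intro s hs i' hi' α k hk
    by_cases h : i' = i
    · subst h
      rw [hset]
      refine hiff α (k + 1) fun w hw => ?_
      rw [X_pow_dvd_coeff_iff]
      intro l hl
      by_contra hne
      obtain ⟨k', hk', hlt⟩ := (hL.good j hj).monic.exists_of_pc_C_mul_ne_zero hw hne
      have h1 : ¬ o.lt s (k', (M j).2) := fun h1 =>
        hk' (Polynomial.X_pow_dvd_iff.1
          (hs i' hi' j hj (fun h => hM (by rw [h])) hdvd k' h1) k' (Nat.lt_succ_self _))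
      have h2 : o.lt s (l, α) := by
        rcases (Nat.lt_succ_iff.1 hl).eq_or_lt with rfl | hl
        · exact hk
        · exact TLocalOrder.lt_trans hk (o.lt_of_t_lt _ hl)
      exact TLocalOrder.not_lt_trans hlt h1 h2
    · rw [hother i' h]
  · rwa [hset]
  · intro α hα k
    rw [hset]
    exact hiff α k fun w _ => by
      rw [MvPolynomial.coeff_C_mul, hα, mul_zero]
      exact dvd_zero _

theorem firstPass_step (hp : Prime p) (hI : toSer (cst p - tVar) ∈ I)
    {L : List (Poly R n)} (hL : PassInv M N o p I d L) {a b : ℕ} (ha : a < N) (hb : b < N)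
    (hM : (M b).2 ≠ (M a).2) (hlt : o.lt (M b) (M a)) :
    ∃ L' ∈ firstPass o p M L (a, b), PassInv M N o p I d L' ∧ Follows M N o L L' ∧
      MvPolynomial.coeff (M a).2 (L'.getD b 0) = 0 ∧
      (∀ α, MvPolynomial.coeff α (L.getD a 0) = 0 → MvPolynomial.coeff α (L.getD b 0) = 0 →
        MvPolynomial.coeff α (L'.getD b 0) = 0) ∧
      ∀ i, i ≠ b → L'.getD i 0 = L.getD i 0 := by
  by_cases h : MvPolynomial.coeff (M a).2 (L.getD b 0) = 0
  · exact ⟨L, by simp only [firstPass, h, ne_eq, not_true_eq_false, if_false, Part.mem_some_iff],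
      hL, Follows.refl L, h, fun _ _ h => h, fun _ _ => rfl⟩
  -- The exact quotient exists: t^j x^α with j smaller than the exponent of the pivot is above the
  -- pivot, hence above the leading monomial of entry b.
  · have hdvd : X ^ (M a).1 ∣ MvPolynomial.coeff (M a).2 (L.getD b 0) := by
      rw [X_pow_dvd_coeff_iff]
      intro j hj
      refine (hL.good b hb).monic.2 _ (TLocalOrder.lt_trans hlt (o.lt_of_t_lt _ hj))
    obtain ⟨g', hg', h1, h2, h3, h4, h5⟩ := hL.exists_set hp hI hb ha hM hdvd
    refine ⟨L.set b g', ?_, h1, h2, h3, fun α hα hα' => eq_zero_of_forall_X_pow_dvd fun k =>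
      (h4 α hα k).2 (by rw [hα']; exact dvd_zero _), h5⟩
    simp only [firstPass, ne_eq, h, not_false_eq_true, if_true, Part.bind_eq_bind,
      Part.mem_bind_iff]
    exact ⟨g', hg', Part.mem_some _⟩

theorem secondPass_step (hp : Prime p) (hI : toSer (cst p - tVar) ∈ I)
    {L : List (Poly R n)} (hL : PassInv M N o p I d L) {a b : ℕ} (ha : a < N) (hb : b < N)
    (hM : (M a).2 ≠ (M b).2) :
    ∃ L' ∈ secondPass o p M L (a, b), PassInv M N o p I d L' ∧ Follows M N o L L' ∧
      (X ^ (M b).1 ∣ MvPolynomial.coeff (M b).2 (L'.getD a 0) →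
        MvPolynomial.coeff (M b).2 (L'.getD a 0) = 0) ∧
      (∀ α, MvPolynomial.coeff α (L.getD b 0) = 0 → ∀ k,
        (X ^ k ∣ MvPolynomial.coeff α (L'.getD a 0) ↔
          X ^ k ∣ MvPolynomial.coeff α (L.getD a 0))) ∧
      ∀ i, i ≠ a → L'.getD i 0 = L.getD i 0 := by
  by_cases h : X ^ (M b).1 ∣ MvPolynomial.coeff (M b).2 (L.getD a 0)
  · obtain ⟨g', hg', h1, h2, h3, h4, h5⟩ := hL.exists_set hp hI ha hb hM h
    refine ⟨L.set a g', ?_, h1, h2, fun _ => h3, h4, h5⟩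
    simp only [secondPass, h, if_true, Part.bind_eq_bind, Part.mem_bind_iff]
    exact ⟨g', hg', Part.mem_some _⟩
  · exact ⟨L, by simp only [secondPass, h, if_false, Part.mem_some_iff],
      hL, Follows.refl L, fun h' => absurd h' h, fun _ _ _ => Iff.rfl, fun _ _ => rfl⟩

/-- All eliminations with a fixed pivot a. The clause on an arbitrary x^α is what keeps columns
cleared by earlier pivots at zero. -/
theorem firstPass_block (hp : Prime p) (hI : toSer (cst p - tVar) ∈ I) {a : ℕ} (ha : a < N)
    (l : List ℕ) (hl : ∀ b ∈ l, b < N) (hM : ∀ b ∈ l, (M b).2 ≠ (M a).2)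
    (hlt : ∀ b ∈ l, o.lt (M b) (M a)) (hnd : l.Nodup) (L : List (Poly R n))
    (hL : PassInv M N o p I d L) :
    ∃ L' ∈ (l.map fun b => (a, b)).foldlM (firstPass o p M) L,
      PassInv M N o p I d L' ∧ Follows M N o L L' ∧
      (∀ b ∈ l, MvPolynomial.coeff (M a).2 (L'.getD b 0) = 0) ∧
      (∀ α, MvPolynomial.coeff α (L.getD a 0) = 0 → ∀ b ∈ l,
        MvPolynomial.coeff α (L.getD b 0) = 0 → MvPolynomial.coeff α (L'.getD b 0) = 0) ∧
      ∀ i, i ∉ l → L'.getD i 0 = L.getD i 0 := by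
  induction l generalizing L with
  | nil => exact ⟨L, by simp, hL, Follows.refl L, by simp, by simp, by simp⟩
  | cons b l ih =>
    have hbl : b ∉ l := (List.nodup_cons.1 hnd).1
    have hab : a ≠ b := fun h => hM b (by simp) (by rw [h])
    obtain ⟨L₁, hm₁, hL₁, hf₁, hz₁, hk₁, hs₁⟩ := firstPass_step hp hI hL ha (hl b (by simp))
      (hM b (by simp)) (hlt b (by simp))
    obtain ⟨L₂, hm₂, hL₂, hf₂, hz₂, hk₂, hs₂⟩ := ih (fun c hc => hl c (by simp [hc]))
      (fun c hc => hM c (by simp [hc])) (fun c hc => hlt c (by simp [hc]))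
      (List.nodup_cons.1 hnd).2 L₁ hL₁
    refine ⟨L₂, mem_foldlM_cons hm₁ hm₂, hL₂, hf₁.trans hf₂, ?_, ?_, ?_⟩
    · intro c hc
      rcases List.mem_cons.1 hc with rfl | hc
      · rw [hs₂ _ hbl]; exact hz₁
      · exact hz₂ c hc
    · intro α hα c hc hc0
      rcases List.mem_cons.1 hc with rfl | hc
      · rw [hs₂ _ hbl]; exact hk₁ α hα hc0
      · refine hk₂ α (by rwa [hs₁ a hab]) c hc ?_
        rwa [hs₁ c (fun h => hbl (h ▸ hc))]
    · intro i hi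
      simp only [List.mem_cons, not_or] at hi
      rw [hs₂ i hi.2, hs₁ i hi.1]

/-- Gaussian elimination in decreasing order of pivots yields a triangular list: x^(α_a) has been
cleared from every entry after a, and the later pivots, no longer containing x^(α_a), cannot bring
it back. -/
theorem firstPass_all (hp : Prime p) (hI : toSer (cst p - tVar) ∈ I)
    (hM : ∀ i < N, ∀ j < N, i ≠ j → (M i).2 ≠ (M j).2)
    (l : List ℕ) (hl : ∀ b ∈ l, b < N) (hsort : l.Pairwise fun i j => o.lt (M j) (M i))
    (L : List (Poly R n)) (hL : PassInv M N o p I d L) :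
    ∃ L' ∈ (orderedPairs l).foldlM (firstPass o p M) L,
      PassInv M N o p I d L' ∧ Follows M N o L L' ∧
      (l.Pairwise fun a b => MvPolynomial.coeff (M a).2 (L'.getD b 0) = 0) ∧
      (∀ α, (∀ b ∈ l, MvPolynomial.coeff α (L.getD b 0) = 0) →
        ∀ b ∈ l, MvPolynomial.coeff α (L'.getD b 0) = 0) ∧
      ∀ i, i ∉ l → L'.getD i 0 = L.getD i 0 := by
  induction l generalizing L with
  | nil => exact ⟨L, by simp [orderedPairs], hL, Follows.refl L, by simp, by simp, by simp⟩
  | cons a l ih =>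
    have hnd : (a :: l).Nodup := hsort.imp fun h => fun hab => by
      rw [hab] at h; exact o.lt_irrefl _ h
    have hal : a ∉ l := (List.nodup_cons.1 hnd).1
    have hsort' := List.pairwise_cons.1 hsort
    obtain ⟨L₁, hm₁, hL₁, hf₁, hz₁, hk₁, hs₁⟩ := firstPass_block hp hI (hl a (by simp)) l
      (fun c hc => hl c (by simp [hc]))
      (fun c hc => hM c (hl c (by simp [hc])) a (hl a (by simp)) fun h => hal (h ▸ hc))
      hsort'.1 (List.nodup_cons.1 hnd).2 L hL
    obtain ⟨L₂, hm₂, hL₂, hf₂, hz₂, hk₂, hs₂⟩ := ih (fun c hc => hl c (by simp [hc])) hsort'.2 L₁ hL₁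
    refine ⟨L₂, mem_foldlM_append hm₁ hm₂, hL₂, hf₁.trans hf₂, ?_, ?_, ?_⟩
    · exact List.pairwise_cons.2 ⟨hk₂ _ hz₁, hz₂⟩
    · intro α hα c hc
      rcases List.mem_cons.1 hc with rfl | hc
      · rw [hs₂ _ hal, hs₁ _ hal]; exact hα _ (by simp)
      · exact hk₂ α (fun b hb => hk₁ α (hα a (by simp)) b hb (hα b (by simp [hb]))) c hc
    · intro i hi
      simp only [List.mem_cons, not_or] at hi
      rw [hs₂ i hi.2, hs₁ i hi.2]

/-- Triangularity makes one sweep sufficient for row a: once column b has been treated, the later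
pivots do not contain x^(α_b), so the order in t of this coefficient no longer changes. Columns
whose coefficient is not divisible by the required power of t may remain nonzero. -/
theorem secondPass_block (hp : Prime p) (hI : toSer (cst p - tVar) ∈ I) {a : ℕ} (ha : a < N)
    (l : List ℕ) (hl : ∀ b ∈ l, b < N) (hM : ∀ b ∈ l, (M a).2 ≠ (M b).2) (L : List (Poly R n))
    (hL : PassInv M N o p I d L)
    (htri : l.Pairwise fun b c => MvPolynomial.coeff (M b).2 (L.getD c 0) = 0) :
    ∃ L' ∈ (l.map fun b => (a, b)).foldlM (secondPass o p M) L,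
      PassInv M N o p I d L' ∧ Follows M N o L L' ∧
      (∀ b ∈ l, X ^ (M b).1 ∣ MvPolynomial.coeff (M b).2 (L'.getD a 0) →
        MvPolynomial.coeff (M b).2 (L'.getD a 0) = 0) ∧
      (∀ α, (∀ b ∈ l, MvPolynomial.coeff α (L.getD b 0) = 0) → ∀ k,
        (X ^ k ∣ MvPolynomial.coeff α (L'.getD a 0) ↔
          X ^ k ∣ MvPolynomial.coeff α (L.getD a 0))) ∧
      ∀ i, i ≠ a → L'.getD i 0 = L.getD i 0 := by
  induction l generalizing L with
  | nil => exact ⟨L, by simp, hL, Follows.refl L, by simp, by simp, by simp⟩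
  | cons b l ih =>
    have htri' := List.pairwise_cons.1 htri
    obtain ⟨L₁, hm₁, hL₁, hf₁, hz₁, hk₁, hs₁⟩ := secondPass_step hp hI hL ha (hl b (by simp))
      (hM b (by simp))
    have hne : ∀ c ∈ l, c ≠ a := fun c hc h => hM c (by simp [hc]) (by rw [h])
    obtain ⟨L₂, hm₂, hL₂, hf₂, hz₂, hk₂, hs₂⟩ := ih (fun c hc => hl c (by simp [hc]))
      (fun c hc => hM c (by simp [hc])) L₁ hL₁ (htri'.2.imp_of_mem fun _ hc h => by
        rwa [hs₁ _ (hne _ hc)])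
    refine ⟨L₂, mem_foldlM_cons hm₁ hm₂, hL₂, hf₁.trans hf₂, ?_, ?_, ?_⟩
    · intro c hc
      rcases List.mem_cons.1 hc with rfl | hc
      · intro h
        have hiff := hk₂ (M c).2 fun b hb => by rw [hs₁ _ (hne _ hb)]; exact htri'.1 b hb
        have h0 := hz₁ ((hiff _).1 h)
        exact eq_zero_of_forall_X_pow_dvd fun k => (hiff k).2 (by rw [h0]; exact dvd_zero _)
      · exact hz₂ c hc
    · intro α hα k
      rw [hk₂ α (fun c hc => by rw [hs₁ _ (hne _ hc)]; exact hα c (by simp [hc])) k,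
        hk₁ α (hα b (by simp)) k]
    · intro i hi
      rw [hs₂ i hi, hs₁ i hi]

/-- Row a is final after its own block, because later blocks change only later rows. Those rows keep
a zero coefficient at x^(α_a), being combined only with rows that have none. -/
theorem secondPass_all (hp : Prime p) (hI : toSer (cst p - tVar) ∈ I)
    (hM : ∀ i < N, ∀ j < N, i ≠ j → (M i).2 ≠ (M j).2)
    (l : List ℕ) (hl : ∀ b ∈ l, b < N) (hnd : l.Nodup)
    (L : List (Poly R n)) (hL : PassInv M N o p I d L)
    (htri : l.Pairwise fun b c => MvPolynomial.coeff (M b).2 (L.getD c 0) = 0) :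
    ∃ L' ∈ (orderedPairs l).foldlM (secondPass o p M) L,
      PassInv M N o p I d L' ∧ Follows M N o L L' ∧
      (l.Pairwise fun a b => MvPolynomial.coeff (M a).2 (L'.getD b 0) = 0 ∧
        (X ^ (M b).1 ∣ MvPolynomial.coeff (M b).2 (L'.getD a 0) →
          MvPolynomial.coeff (M b).2 (L'.getD a 0) = 0)) ∧
      (∀ α, (∀ b ∈ l, MvPolynomial.coeff α (L.getD b 0) = 0) →
        ∀ b ∈ l, MvPolynomial.coeff α (L'.getD b 0) = 0) ∧
      ∀ i, i ∉ l → L'.getD i 0 = L.getD i 0 := by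
  induction l generalizing L with
  | nil => exact ⟨L, by simp [orderedPairs], hL, Follows.refl L, by simp, by simp, by simp⟩
  | cons a l ih =>
    have hal : a ∉ l := (List.nodup_cons.1 hnd).1
    have hne : ∀ c ∈ l, c ≠ a := fun c hc h => hal (h ▸ hc)
    have htri' := List.pairwise_cons.1 htri
    obtain ⟨L₁, hm₁, hL₁, hf₁, hz₁, hk₁, hs₁⟩ := secondPass_block hp hI (hl a (by simp)) l
      (fun c hc => hl c (by simp [hc]))
      (fun c hc => hM a (hl a (by simp)) c (hl c (by simp [hc])) (hne c hc).symm) L hL htri'.2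
    obtain ⟨L₂, hm₂, hL₂, hf₂, hz₂, hk₂, hs₂⟩ := ih (fun c hc => hl c (by simp [hc]))
      (List.nodup_cons.1 hnd).2 L₁ hL₁ (htri'.2.imp_of_mem fun _ hc h => by
        rwa [hs₁ _ (hne _ hc)])
    refine ⟨L₂, mem_foldlM_append hm₁ hm₂, hL₂, hf₁.trans hf₂, ?_, ?_, ?_⟩
    · refine List.pairwise_cons.2 ⟨fun c hc => ⟨hk₂ _ (fun b hb => ?_) c hc, ?_⟩, hz₂⟩
      · rw [hs₁ _ (hne _ hb)]; exact htri'.1 b hb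
      · rw [hs₂ a hal]; exact hz₁ c hc
    · intro α hα c hc
      have hα' : ∀ b ∈ l, MvPolynomial.coeff α (L.getD b 0) = 0 := fun b hb => hα b (by simp [hb])
      rcases List.mem_cons.1 hc with rfl | hc
      · rw [hs₂ _ hal]
        exact eq_zero_of_forall_X_pow_dvd fun k =>
          (hk₁ α hα' k).2 (by rw [hα _ (by simp)]; exact dvd_zero _)
      · exact hk₂ α (fun b hb => by rw [hs₁ _ (hne _ hb)]; exact hα' b hb) c hc
    · intro i hi
      simp only [List.mem_cons, not_or] at hi
      rw [hs₂ i hi.2, hs₁ i hi.1]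

/-- The list is mutually reduced. -/
def IsMutuallyReduced (M : ℕ → Mon n) (N : ℕ) (L : List (Poly R n)) : Prop :=
  ∀ i < N, ∀ j < N, i ≠ j → X ^ (M j).1 ∣ MvPolynomial.coeff (M j).2 (L.getD i 0) →
    MvPolynomial.coeff (M j).2 (L.getD i 0) = 0

theorem exists_mem_pReduceAll (hp : Prime p) (hI : toSer (cst p - tVar) ∈ I)
    (L₀ : List (Poly R n)) (h : ∀ i < L₀.length, IsPre o I d (L₀.getD i 0) (plm o (L₀.getD i 0))) :
    ∃ L ∈ pReduceAll o p L₀, L.length = L₀.length ∧ ∀ i < L₀.length,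
      IsGood o p I d (L.getD i 0) (plm o (L₀.getD i 0)) ∧
      MvPolynomial.C (pMinusT p) ∣ L.getD i 0 - L₀.getD i 0 := by
  induction L₀ with
  | nil => exact ⟨[], by simp [pReduceAll], rfl, by simp⟩
  | cons g L₀ ih =>
    obtain ⟨L, hL, hlen, hgood⟩ := ih fun i hi => h (i + 1) (by simpa using hi)
    obtain ⟨g', hg', hgood', hd, -⟩ := (h 0 (by simp)).exists_mem_pReduce hp hI
    refine ⟨g' :: L, ?_, by simp [hlen], ?_⟩
    · simp only [pReduceAll, Part.bind_eq_bind, Part.mem_bind_iff]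
      exact ⟨g', hg', L, hL, Part.mem_some _⟩
    · rintro (_ | i) hi
      · exact ⟨hgood', hd⟩
      · exact hgood i (by simpa using hi)

/-- The elimination sorts by the leading monomials after (A), which agree with the prescribed `M`.
The preservation clause needs clean input so that the initial call of (A) does not change any order
in t. -/
theorem exists_mem_reduceSameDegree (hp : Prime p) (hI : toSer (cst p - tVar) ∈ I)
    (L₀ : List (Poly R n)) (hM : ∀ i < L₀.length, IsPre o I d (L₀.getD i 0) (M i))
    (hM' : ∀ i < L₀.length, ∀ j < L₀.length, i ≠ j → (M i).2 ≠ (M j).2) :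
    ∃ L ∈ reduceSameDegree o p L₀, PassInv M L₀.length o p I d L ∧
      IsMutuallyReduced M L₀.length L ∧
      ((∀ i < L₀.length, ∀ α, IsCleanCoeff p (MvPolynomial.coeff α (L₀.getD i 0))) →
        Follows M L₀.length o L₀ L) := by
  classical
  have hplm : ∀ i < L₀.length, plm o (L₀.getD i 0) = M i := fun i hi => (hM i hi).monic.plm_eq
  obtain ⟨L₁, hm₁, hlen, hgood⟩ := exists_mem_pReduceAll (o := o) hp hI L₀ fun i hi => by
    rw [hplm i hi]; exact hM i hi
  set M' : ℕ → Mon n := fun i => plm o (L₁.getD i 0) with hM'def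
  have hMM' : ∀ i < L₀.length, M' i = M i := fun i hi => by
    rw [hM'def, ← hplm i hi]; exact (hgood i hi).1.monic.plm_eq
  have inv₁ : PassInv M' L₀.length o p I d L₁ := ⟨hlen, fun i hi => by
    rw [hMM' i hi, ← hplm i hi]; exact (hgood i hi).1⟩
  have hdist : ∀ i < L₀.length, ∀ j < L₀.length, i ≠ j → (M' i).2 ≠ (M' j).2 :=
    fun i hi j hj hij => by rw [hMM' i hi, hMM' j hj]; exact hM' i hi j hj hij
  set r : ℕ → ℕ → Prop := fun i j => ¬ o.lt (M' i) (M' j) with hr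
  have htot : Std.Total r := ⟨fun i j => by
    by_contra h
    simp only [hr, not_or, not_not] at h
    exact TLocalOrder.lt_asymm h.1 h.2⟩
  have htrans : IsTrans ℕ r := ⟨fun i j k hij hjk => TLocalOrder.not_lt_trans hjk hij⟩
  set idx := (List.range L₁.length).insertionSort r with hidx
  have hperm : List.Perm idx (List.range L₁.length) := List.perm_insertionSort _ _
  have hmem : ∀ i, i ∈ idx ↔ i < L₀.length := fun i => by rw [hperm.mem_iff, List.mem_range, hlen]
  have hnd : idx.Nodup := hperm.nodup_iff.2 List.nodup_range
  -- The sort is only weakly decreasing; distinct x-parts exclude equal leading monomials.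
  have hsort : idx.Pairwise fun i j => o.lt (M' j) (M' i) := by
    have h1 : idx.Pairwise r := List.pairwise_insertionSort r _
    refine (h1.and hnd).imp_of_mem fun hi hj h => ?_
    rcases TLocalOrder.not_lt.1 h.1 with h' | h'
    · exact absurd (congrArg Prod.snd h').symm
        (hdist _ ((hmem _).1 hi) _ ((hmem _).1 hj) h.2)
    · exact h'
  obtain ⟨L₂, hm₂, inv₂, hf₂, hz₂, -, -⟩ := firstPass_all hp hI hdist idx
    (fun b hb => (hmem b).1 hb) hsort L₁ inv₁
  obtain ⟨L₃, hm₃, inv₃, hf₃, hz₃, -, -⟩ := secondPass_all hp hI hdist idx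
    (fun b hb => (hmem b).1 hb) hnd L₂ inv₂ hz₂
  refine ⟨L₃, ?_, ⟨inv₃.len, fun i hi => hMM' i hi ▸ inv₃.good i hi⟩, ?_, ?_⟩
  · simp only [reduceSameDegree, Part.bind_eq_bind, Part.mem_bind_iff]
    exact ⟨L₁, hm₁, L₂, hm₂, hm₃⟩
  · intro i hi j hj hij hdvd
    have hsym : ∀ a ∈ idx, ∀ b ∈ idx, a ≠ b →
        (X ^ (M' b).1 ∣ MvPolynomial.coeff (M' b).2 (L₃.getD a 0) →
          MvPolynomial.coeff (M' b).2 (L₃.getD a 0) = 0) := by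
      have h2 := List.pairwise_iff_getElem.1 hz₃
      intro a ha b hb hab
      obtain ⟨x, hx, rfl⟩ := List.getElem_of_mem ha
      obtain ⟨y, hy, rfl⟩ := List.getElem_of_mem hb
      rcases lt_trichotomy x y with h | h | h
      · exact (h2 x y hx hy h).2
      · subst h; exact absurd rfl hab
      · exact fun _ => (h2 y x hy hx h).1
    have := hsym i ((hmem i).2 hi) j ((hmem j).2 hj) hij
    rw [hMM' j hj] at this
    exact this hdvd
  · intro hclean
    -- Before and after (A) all coefficients are clean and have the same value at t = p, hence the
    -- same order in t.
    have h01 : Follows M' L₀.length o L₀ L₁ := fun s _ i hi α k _ => by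
      rw [((hgood i hi).1.clean α).X_pow_dvd_iff hp, (hclean i hi α).X_pow_dvd_iff hp,
        eval_eq_of_pMinusT_dvd (by
          simpa only [MvPolynomial.coeff_sub] using coeff_dvd_of_C_dvd (hgood i hi).2 α)]
    have h03 := h01.trans (hf₂.trans hf₃)
    intro s hs
    refine h03 s fun i hi j hj hij => ?_
    rw [hMM' j hj]
    exact hs i hi j hj hij

end SameDegree

/-! ## Initial terms -/

section InitialTerms
variable {R : Type u} [CommRing R] {n : ℕ} {o : TLocalOrder n} {p : R} {I : Ideal (Ser R n)} {d : ℕ}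

/-- The finite set of `x`-monomials of degree `d`. -/
def xMonomials (n d : ℕ) : Finset (Fin n →₀ ℕ) := Finset.finsuppAntidiag Finset.univ d

theorem mem_xMonomials {α : Fin n →₀ ℕ} : α ∈ xMonomials n d ↔ α.degree = d := by
  simp [xMonomials, Finset.mem_finsuppAntidiag, Finsupp.degree_eq_sum]

theorem isHomogeneous_iff {A : Type*} [CommSemiring A] {g : MvPolynomial (Fin n) A} :
    MvPolynomial.IsHomogeneous g d ↔ ∀ α, MvPolynomial.coeff α g ≠ 0 → α.degree = d := by
  simp only [MvPolynomial.IsHomogeneous, MvPolynomial.IsWeightedHomogeneous,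
    Finsupp.degree_eq_weight_one]
  rfl

theorem coeff_term_mul (δ : Mon n) (g : Poly R n) (α : Fin n →₀ ℕ) :
    MvPolynomial.coeff α (term δ 1 * g) =
      if δ.2 ≤ α then X ^ δ.1 * MvPolynomial.coeff (α - δ.2) g else 0 := by
  classical
  rw [term, MvPolynomial.coeff_monomial_mul', Polynomial.monomial_one_right_eq_X_pow]

theorem pc_term_mul (δ m : Mon n) (g : Poly R n) : pc (δ + m) (term δ 1 * g) = pc m g := by
  simp [pc, coeff_term_mul, Polynomial.coeff_X_pow_mul']

theorem pc_term_mul_eq_zero {δ m : Mon n} (h : ¬ δ ≤ m) (c : R) (g : Poly R n) :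
    pc m (term δ c * g) = 0 := by
  classical
  rw [pc, term, MvPolynomial.coeff_monomial_mul']
  split_ifs with h2
  · rw [← Polynomial.C_mul_X_pow_eq_monomial, mul_assoc, Polynomial.coeff_C_mul,
      Polynomial.coeff_X_pow_mul', if_neg, mul_zero]
    exact fun h1 => h ⟨h1, h2⟩
  · simp

theorem IsMonicAt.term_mul {g : Poly R n} {m : Mon n} (h : IsMonicAt o g m) (δ : Mon n) :
    IsMonicAt o (term δ 1 * g) (δ + m) := by
  refine ⟨by rw [pc_term_mul, h.1], fun m' hm' => ?_⟩
  by_cases hδ : δ ≤ m'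
  · obtain ⟨m'', rfl⟩ := exists_add_of_le hδ
    rw [pc_term_mul]
    apply h.2
    rwa [add_comm δ, add_comm δ, TLocalOrder.add_lt_add_iff] at hm'
  · exact pc_term_mul_eq_zero hδ _ _

theorem term_one_dvd_term_iff [Nontrivial R] {m m' : Mon n} {c : R} (hc : c ≠ 0) :
    (term m 1 : Poly R n) ∣ term m' c ↔ m ≤ m' := by
  constructor
  · rintro ⟨q, hq⟩
    by_contra h
    have := congrArg (pc m') hq
    rw [pc_term_self, pc_term_mul_eq_zero h] at this
    exact hc this
  · intro h
    obtain ⟨δ, rfl⟩ := exists_add_of_le h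
    exact ⟨term δ c, by rw [term_mul_term, one_mul]⟩

/-- `m` is the greatest monomial of `g` with its `x`-part. -/
def IsInitial (g : Poly R n) (m : Mon n) : Prop :=
  X ^ m.1 ∣ MvPolynomial.coeff m.2 g ∧ ¬ X ^ (m.1 + 1) ∣ MvPolynomial.coeff m.2 g

theorem IsInitial.pc_ne_zero {g : Poly R n} {m : Mon n} (h : IsInitial g m) : pc m g ≠ 0 := by
  intro h0
  refine h.2 ((X_pow_dvd_coeff_iff _ _ _).2 fun j hj => ?_)
  rcases (Nat.lt_succ_iff.1 hj).eq_or_lt with rfl | hj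
  · exact h0
  · exact (X_pow_dvd_coeff_iff _ _ _).1 h.1 j hj

theorem IsInitial.coeff_ne_zero {g : Poly R n} {m : Mon n} (h : IsInitial g m) :
    MvPolynomial.coeff m.2 g ≠ 0 := by
  intro h0
  exact h.2 (by rw [h0]; exact dvd_zero _)

theorem IsInitial.natTrailingDegree_eq {g : Poly R n} {m : Mon n} (h : IsInitial g m) :
    (MvPolynomial.coeff m.2 g).natTrailingDegree = m.1 :=
  le_antisymm (Polynomial.natTrailingDegree_le_of_ne_zero h.pc_ne_zero)
    (Polynomial.le_natTrailingDegree h.coeff_ne_zero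
      fun _ hj => Polynomial.X_pow_dvd_iff.1 h.1 _ hj)

theorem isInitial_natTrailingDegree {g : Poly R n} {α : Fin n →₀ ℕ}
    (h : MvPolynomial.coeff α g ≠ 0) :
    IsInitial g ((MvPolynomial.coeff α g).natTrailingDegree, α) := by
  refine ⟨Polynomial.X_pow_dvd_iff.2 fun _ hj =>
    Polynomial.coeff_eq_zero_of_lt_natTrailingDegree hj, fun h' => ?_⟩
  exact Polynomial.trailingCoeff_nonzero_iff_nonzero.2 h
    (Polynomial.X_pow_dvd_iff.1 h' _ (Nat.lt_succ_self _))

theorem IsMonicAt.isInitial [Nontrivial R] {g : Poly R n} {m : Mon n} (h : IsMonicAt o g m) :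
    IsInitial g m :=
  ⟨(X_pow_dvd_coeff_iff _ _ _).2 fun _ hj => h.2 _ (o.lt_of_t_lt _ hj), fun h' =>
    one_ne_zero (h.1.symm.trans ((X_pow_dvd_coeff_iff _ _ _).1 h' _ (Nat.lt_succ_self _)))⟩

theorem IsInitial.eq_of_snd_eq {g : Poly R n} {m m' : Mon n} (h : IsInitial g m)
    (h' : IsInitial g m') (e : m.2 = m'.2) : m = m' := by
  ext1
  · rw [← h.natTrailingDegree_eq, ← h'.natTrailingDegree_eq, e]
  · exact e

variable (o) in
-- In one variable t with t < 1 the leading term is the term of lowest order.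
theorem initTerm_toSer (g : Poly R n) (α : Fin n →₀ ℕ) :
    initTerm o (toSer g) α = term ((MvPolynomial.coeff α g).natTrailingDegree, α)
      (MvPolynomial.coeff α g).trailingCoeff := by
  set a := MvPolynomial.coeff α g with ha
  by_cases h0 : a = 0
  · simp [initTerm, coeff_toSer, ← ha, h0, term]
  have hC : MvPolynomial.C (MvPolynomial.coeff α (toSer g)) =
      toSer (MvPolynomial.C a : Poly R n) := by
    rw [coeff_toSer, toSer, MvPolynomial.map_C]
    rfl
  have hlead : IsLeadMon o (toSer (MvPolynomial.C a : Poly R n)) (a.natTrailingDegree, 0) := by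
    refine ⟨by simpa [pc] using h0, ?_⟩
    rintro ⟨k, α'⟩ hk
    rw [coeffAt_toSer, pc, MvPolynomial.coeff_C] at hk
    by_cases h : 0 = α'
    · subst h
      simp only [if_true] at hk
      rcases (Polynomial.natTrailingDegree_le_of_ne_zero hk).eq_or_lt with h | h
      · left; rw [h]
      · right; exact o.lt_of_t_lt _ h
    · simp [h] at hk
  rw [initTerm, hC, lt, lc, hlead.lm_eq, coeffAt_toSer]
  simp [term, pc, MvPolynomial.C_mul_monomial, Polynomial.trailingCoeff]

theorem IsInitial.initTerm_eq {g : Poly R n} {m : Mon n} (h : IsInitial g m) :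
    initTerm o (toSer g) m.2 = term m (pc m g) := by
  rw [initTerm_toSer, Polynomial.trailingCoeff, h.natTrailingDegree_eq]
  rfl

theorem isLeadMon_term {m : Mon n} {c : R} (hc : c ≠ 0) :
    IsLeadMon o (toSer (term m c)) m := by
  classical
  refine ⟨by simpa using hc, fun m' hm' => Or.inl ?_⟩
  by_contra h
  rw [coeffAt_toSer, pc_term, if_neg (fun e => h e.symm)] at hm'
  exact hm' rfl

theorem IsInitial.plm_initTerm {g : Poly R n} {m : Mon n} (h : IsInitial g m) :
    plm o (initTerm o (toSer g) m.2) = m := by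
  rw [h.initTerm_eq]
  exact (isLeadMon_term h.pc_ne_zero).lm_eq

theorem mem_workList {H : List (Poly R n)} {bound : ℕ → Mon n} {c : Poly R n × ℕ} :
    c ∈ workList o H bound ↔ c.2 < H.length ∧ ∃ m, IsInitial (H.getD c.2 0) m ∧
      c.1 = initTerm o (toSer (H.getD c.2 0)) m.2 ∧ o.lt m (bound c.2) := by
  classical
  simp only [workList, Finset.mem_biUnion, Finset.mem_range, Finset.mem_filter, Finset.mem_image,
    MvPolynomial.mem_support_iff]
  constructor
  · rintro ⟨i, hi, ⟨α, hα, rfl⟩, hlt⟩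
    have h := isInitial_natTrailingDegree hα
    have e : plm o (initTerm o (toSer (H.getD i 0)) α) = _ := h.plm_initTerm (o := o)
    exact ⟨hi, _, h, rfl, e ▸ hlt⟩
  · rintro ⟨hi, m, hm, hc, hlt⟩
    refine ⟨c.2, hi, ⟨m.2, hm.coeff_ne_zero, ?_⟩, ?_⟩
    · rw [← hc]
    · rw [hc]
      have e : plm o (initTerm o (toSer (H.getD c.2 0)) m.2) = m := hm.plm_initTerm
      rwa [e]

/-- Being initial also requires divisibility by t^k, that is, information about the exponent k - 1,
whose monomial is even greater. -/
theorem SameAbove.isInitial_iff {s m : Mon n} {g g' : Poly R n} (h : SameAbove o s g g')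
    (hm : o.lt s m) : IsInitial g' m ↔ IsInitial g m := by
  unfold IsInitial
  rw [h m.2 m.1 hm]
  refine and_congr_left fun _ => ?_
  rcases hk : m.1 with _ | k
  · simp
  · refine h m.2 k (TLocalOrder.lt_trans hm ?_)
    have : o.lt (m.1, m.2) (k, m.2) := o.lt_of_t_lt _ (by omega)
    exact this

theorem IsCleanCoeff.X_pow_mul [IsDomain R] {a : Polynomial R} (h : IsCleanCoeff p a) (k : ℕ) :
    IsCleanCoeff p (X ^ k * a) := by
  intro h0
  rw [Polynomial.trailingCoeff_mul, Polynomial.trailingCoeff, Polynomial.natTrailingDegree_X_pow,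
    Polynomial.coeff_X_pow_self, one_mul]
  exact h (right_ne_zero_of_mul h0)

end InitialTerms

/-! ## Step by step reduction -/

section StepByStep
variable {R : Type u} [CommRing R] {n : ℕ} {o : TLocalOrder n} {p : R} {I : Ideal (Ser R n)} {d : ℕ}

theorem IsPre.degree_eq {g : Poly R n} {m m' : Mon n} (h : IsPre o I d g m)
    (hm' : MvPolynomial.coeff m'.2 g ≠ 0) : m'.2.degree = d :=
  isHomogeneous_iff.1 h.hom _ hm'

theorem IsPre.le_lead {g : Poly R n} {m m' : Mon n} (h : IsPre o I d g m)
    (hm' : IsInitial g m') : m' = m ∨ o.lt m' m := by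
  by_contra hc
  rw [not_or] at hc
  rcases TLocalOrder.not_lt.1 hc.2 with h' | h'
  · exact hc.1 h'.symm
  · exact hm'.pc_ne_zero (h.monic.2 _ h')

theorem IsPre.initial_eq_lead [Nontrivial R] {g : Poly R n} {m m' : Mon n} (h : IsPre o I d g m)
    (hm' : IsInitial g m') (e : m'.2 = m.2) : m' = m :=
  hm'.eq_of_snd_eq h.monic.isInitial e

/-- A monomial multiple of a good element is good. -/
theorem IsGood.term_mul [IsDomain R] {g : Poly R n} {m : Mon n} (h : IsGood o p I d g m) (δ : Mon n) :
    IsGood o p I (δ.2.degree + d) (term δ 1 * g) (δ + m) := by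
  refine ⟨⟨h.monic.term_mul δ, ?_, ?_⟩, fun α => ?_⟩
  · exact (MvPolynomial.isHomogeneous_monomial _ rfl).mul h.hom
  · rw [map_mul]; exact I.mul_mem_left _ h.mem
  · rw [coeff_term_mul]
    split_ifs
    · exact (h.clean _).X_pow_mul _
    · intro h0; exact absurd rfl h0

/-- What is preserved by the loop of the step by step reduction. -/
structure StepInv (o : TLocalOrder n) (p : R) (I : Ideal (Ser R n)) (d : ℕ) (G : List (Poly R n))
    (M₀ : ℕ → Mon n) (h : ℕ) (M : ℕ → Mon n)
    (s : List (Poly R n) × List (Poly R n) × Finset (Poly R n × ℕ)) : Prop where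
  len : s.1.length = h
  mon : ∀ i < h, M i = M₀ i
  pass : PassInv M (h + s.2.1.length) o p I d (s.1 ++ s.2.1)
  red : IsMutuallyReduced M (h + s.2.1.length) (s.1 ++ s.2.1)
  dist : ∀ i < h + s.2.1.length, ∀ j < h + s.2.1.length, i ≠ j → (M i).2 ≠ (M j).2
  work : ∀ c ∈ s.2.2, c.2 < h ∧ ∃ m, IsInitial (s.1.getD c.2 0) m ∧
    c.1 = initTerm o (toSer (s.1.getD c.2 0)) m.2 ∧
    ∀ j, h ≤ j → j < h + s.2.1.length → o.lt m (M j)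
  done : ∀ i < h, ∀ m, IsInitial (s.1.getD i 0) m →
    (initTerm o (toSer (s.1.getD i 0)) m.2, i) ∈ s.2.2 ∨ ∀ g ∈ G, ¬ plm o g ≤ m

theorem getD_append_left (H E : List (Poly R n)) {i : ℕ} (hi : i < H.length) :
    (H ++ E).getD i 0 = H.getD i 0 := List.getD_append _ _ _ _ hi

/-- The leading monomials of H ∪ E have distinct x-parts, all of degree d. This is the bound on the
size of E that makes (C) stop. -/
theorem StepInv.card_le [Nontrivial R] {G : List (Poly R n)} {M₀ : ℕ → Mon n} {h : ℕ} {M : ℕ → Mon n}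
    {s : List (Poly R n) × List (Poly R n) × Finset (Poly R n × ℕ)}
    (inv : StepInv o p I d G M₀ h M s) : h + s.2.1.length ≤ (xMonomials n d).card := by
  rw [← Finset.card_range (h + s.2.1.length)]
  refine Finset.card_le_card_of_injOn (fun i => (M i).2) (fun i hi => ?_) fun i hi j hj hij => ?_
  · have hi' : i < h + s.2.1.length := by simpa using hi
    exact mem_xMonomials.2 ((inv.pass.good i hi').degree_eq
      (inv.pass.good i hi').monic.coeff_ne_zero)
  · by_contra hne
    exact inv.dist i (by simpa using hi) j (by simpa using hj) hne hij

variable [IsDomain R] [IsNoetherianRing R]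

/-- In the invariant, `done` says that an initial monomial of H divisible by some leading monomial
of G is still on the work list, and `work` that pending monomials are below all leading monomials of
E. Processing from the top preserves both: the new element e has leading monomial m, (B) deletes m
from H and does not disturb anything above m, and the work list is rebuilt below m. -/
theorem StepInv.step (hp : Prime p) (hI : toSer (cst p - tVar) ∈ I) (σ : Choices R n p)
    {G : List (Poly R n)} (hG : ∀ g ∈ G, ∃ d', IsGood o p I d' g (plm o g))
    {M₀ : ℕ → Mon n} {h : ℕ} (hM₀ : ∀ i < h, ∀ g ∈ G, ¬ plm o g ≤ M₀ i) {M : ℕ → Mon n}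
    {s : List (Poly R n) × List (Poly R n) × Finset (Poly R n × ℕ)}
    (inv : StepInv o p I d G M₀ h M s) (hT : s.2.2 ≠ ∅) :
    ∃ M' s', Sum.inr s' ∈ stepByStepBody o p σ G s ∧ StepInv o p I d G M₀ h M' s' ∧
      (s'.2.1.length = s.2.1.length ∧ s'.2.2.card < s.2.2.card ∨
        s'.2.1.length = s.2.1.length + 1) := by
  classical
  obtain ⟨H, E, T⟩ := s
  obtain ⟨hlen, hmon, hpass, hred, hdist, hwork, hdone⟩ := inv
  dsimp only at hlen hmon hpass hred hdist hwork hdone hT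
  set N := h + E.length with hN
  set c := σ.pickTerm (T.filter fun a => ∀ b ∈ T, ¬ o.lt (plm o a.1) (plm o b.1)) with hcdef
  have hc : c ∈ T.filter fun a => ∀ b ∈ T, ¬ o.lt (plm o a.1) (plm o b.1) := by
    apply σ.pickTerm_mem
    obtain ⟨a, ha, hmax⟩ := TLocalOrder.exists_greatest_image (o := o)
      (Finset.nonempty_iff_ne_empty.2 hT) fun a => plm o a.1
    exact ⟨a, Finset.mem_filter.2 ⟨ha, hmax⟩⟩
  obtain ⟨hcT, hcmax⟩ := Finset.mem_filter.1 hc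
  obtain ⟨hi, m, hm, hc1, hmE⟩ := hwork c hcT
  set i := c.2 with hidef
  have hplm : plm o c.1 = m := by rw [hc1]; exact hm.plm_initTerm
  have hc1' : c.1 = term m (pc m (H.getD i 0)) := by rw [hc1, hm.initTerm_eq]
  have hdiv : ∀ g ∈ G, (plt o g ∣ c.1 ↔ plm o g ≤ m) := fun g hg => by
    obtain ⟨d', hg'⟩ := hG g hg
    rw [show plt o g = term (plm o g) 1 from hg'.monic.plt_eq, hc1',
      term_one_dvd_term_iff hm.pc_ne_zero]
  have hHN : h ≤ N := by omega
  have hgetH : ∀ j < h, (H ++ E).getD j 0 = H.getD j 0 := fun j hj =>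
    getD_append_left H E (by omega)
  by_cases hD : (G.filter fun g => plt o g ∣ c.1) = []
  · refine ⟨M, (H, E, T.erase c), ?_, ⟨hlen, hmon, hpass, hred, hdist, ?_, ?_⟩,
      Or.inl ⟨rfl, Finset.card_erase_lt_of_mem hcT⟩⟩
    · simp only [stepByStepBody, hT, if_false, ← hcdef, hD, if_true]
      exact Part.mem_some _
    · exact fun a ha => hwork a (Finset.mem_of_mem_erase ha)
    -- The pair that is dropped has a monomial not divisible by any leading monomial of G; all other
    -- pairs stay on the list.
    · intro j hj m' hm'
      rcases hdone j hj m' hm' with h' | h'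
      · by_cases hjc : (initTerm o (toSer (H.getD j 0)) m'.2, j) = c
        · right
          have e : m' = m := by
            rw [← hplm, ← hjc]
            exact (hm'.plm_initTerm).symm
          intro g hg hle
          rw [e, ← hdiv g hg] at hle
          have : g ∈ G.filter fun g => plt o g ∣ c.1 := List.mem_filter.2 ⟨hg, by simpa using hle⟩
          rw [hD] at this
          exact absurd this (by simp)
        · exact Or.inl (Finset.mem_erase.2 ⟨hjc, h'⟩)
      · exact Or.inr h'
  · set g := σ.pickPoly (G.filter fun g => plt o g ∣ c.1) with hgdef
    have hg := σ.pickPoly_mem _ hD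
    rw [← hgdef, List.mem_filter] at hg
    obtain ⟨hgG, hgc⟩ := hg
    have hle : plm o g ≤ m := (hdiv g hgG).1 (by simpa using hgc)
    obtain ⟨d', hg'⟩ := hG g hgG
    set e := term (m - plm o g) 1 * g with hedef
    have hgoodi := hpass.good i (by omega)
    rw [hgetH i hi] at hgoodi
    have hadd : m - plm o g + plm o g = m := by
      ext1
      · exact Nat.sub_add_cancel hle.1
      · exact tsub_add_cancel_of_le hle.2
    have hegood : IsGood o p I d e m := by
      have := hg'.term_mul (m - plm o g)
      rw [hadd] at this
      have hd1 := hg'.degree_eq hg'.monic.coeff_ne_zero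
      have hd2 := hgoodi.degree_eq hm.coeff_ne_zero
      have e1 : (m - plm o g).2.degree + d' = d := by
        rw [← hd1, ← map_add, ← hd2]
        exact congrArg Finsupp.degree (congrArg Prod.snd hadd)
      rwa [e1] at this
    set M' : ℕ → Mon n := Function.update M N m with hM'
    have hM'N : M' N = m := by simp [hM']
    have hM'lt : ∀ j < N, M' j = M j := fun j hj => by
      simp [hM', Function.update_of_ne (Nat.ne_of_lt hj)]
    have hltot : (H ++ E ++ [e]).length = N + 1 := by simp [hN, hlen, add_assoc]
    have hgete : (H ++ E ++ [e]).getD N 0 = e := by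
      rw [List.getD_append_right _ _ _ _ (by simp [hN, hlen])]
      simp [hN, hlen]
    have hgetlt : ∀ j < N, (H ++ E ++ [e]).getD j 0 = (H ++ E).getD j 0 := fun j hj =>
      getD_append_left _ _ (by simp only [List.length_append]; omega)
    have hgood' : ∀ j < N + 1, IsGood o p I d ((H ++ E ++ [e]).getD j 0) (M' j) := by
      intro j hj
      rcases (Nat.lt_succ_iff.1 hj).eq_or_lt with rfl | hj
      · rwa [hgete, hM'N]
      · rw [hgetlt j hj, hM'lt j hj]; exact hpass.good j hj
    -- The x-part of e is new. If it were that of entry i, then m would be its leading monomial,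
    -- which no leading monomial of G divides. For another entry j, mutual reducedness makes the
    -- exponent of t in m smaller than in `M j`. For j in H then lm(g) divides m, hence `M j`, again
    -- excluded; for j in E it makes m greater than `M j`, against the order of processing.
    have hnew : ∀ j < N, (M j).2 ≠ m.2 := by
      intro j hj hjm
      by_cases hij : i = j
      · have : m = M j := by
          rw [← hij]
          exact hgoodi.initial_eq_lead hm (by rw [hij]; exact hjm.symm)
        rw [this, ← hij, hmon i hi] at hle
        exact hM₀ i hi g hgG hle
      · have h1 := hred i (by omega) j hj hij
        rw [hgetH i hi, hjm] at h1
        have h2 : m.1 < (M j).1 := by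
          by_contra! h2
          exact hm.coeff_ne_zero (h1 ((pow_dvd_pow _ h2).trans hm.1))
        rcases Nat.lt_or_ge j h with hjh | hjh
        · refine hM₀ j hjh g hgG (hle.trans ?_)
          rw [← hmon j hjh]
          exact ⟨h2.le, hjm.symm.le⟩
        · have h3 := hmE j hjh hj
          have h4 : o.lt ((M j).1, m.2) (m.1, m.2) := o.lt_of_t_lt _ h2
          rw [← hjm] at h4
          refine TLocalOrder.lt_asymm h3 ?_
          rw [show m = (m.1, (M j).2) from Prod.ext rfl hjm.symm]
          exact h4
    have hdist' : ∀ a < N + 1, ∀ b < N + 1, a ≠ b → (M' a).2 ≠ (M' b).2 := by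
      intro a ha b hb hab
      rcases (Nat.lt_succ_iff.1 ha).eq_or_lt with rfl | ha <;>
        rcases (Nat.lt_succ_iff.1 hb).eq_or_lt with rfl | hb
      · exact absurd rfl hab
      · rw [hM'N, hM'lt b hb]; exact (hnew b hb).symm
      · rw [hM'N, hM'lt a ha]; exact hnew a ha
      · rw [hM'lt a ha, hM'lt b hb]; exact hdist a ha b hb hab
    obtain ⟨L, hLmem, hLpass, hLred, hLfol⟩ := exists_mem_reduceSameDegree (M := M') hp hI
      (H ++ E ++ [e]) (fun j hj => (hgood' j (hltot ▸ hj)).toIsPre) (by rwa [hltot])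
    rw [hltot] at hLpass hLred hLfol
    -- Although e is not yet reduced against the other entries, all its terms are at most m, so
    -- above m the extended list is as reduced as the old one.
    have hfine : FineAbove M' (N + 1) o m (H ++ E ++ [e]) := by
      intro a ha b hb hab hdvd k hk
      rcases (Nat.lt_succ_iff.1 hb).eq_or_lt with rfl | hb
      · rw [hM'N] at hdvd hk ⊢
        have : k < m.1 := (o.t_lt_iff m.2).1 hk
        exact (pow_dvd_pow _ this).trans hdvd
      · rcases (Nat.lt_succ_iff.1 ha).eq_or_lt with rfl | ha
        · rw [hgete, X_pow_dvd_coeff_iff]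
          intro l hl
          refine hegood.monic.2 _ ?_
          rcases (Nat.lt_succ_iff.1 hl).eq_or_lt with rfl | hl
          · exact hk
          · exact TLocalOrder.lt_trans hk (o.lt_of_t_lt _ hl)
        · rw [hgetlt a ha, hM'lt b hb] at hdvd ⊢
          rw [hred a ha b hb hab hdvd]
          exact dvd_zero _
    have hsame := hLfol (fun j hj α => (hgood' j hj).clean α) m hfine
    have hLlen : L.length = N + 1 := hLpass.len
    set H' := L.take H.length with hH'
    set E' := L.drop H.length with hE'
    have hH'len : H'.length = h := by rw [hH', List.length_take]; omega
    have hE'len : E'.length = E.length + 1 := by rw [hE', List.length_drop]; omega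
    have hHE : H' ++ E' = L := List.take_append_drop _ _
    have hN' : h + E'.length = N + 1 := by omega
    have hgetH' : ∀ j < h, H'.getD j 0 = L.getD j 0 := fun j hj => by
      rw [← hHE]; exact (getD_append_left _ _ (by omega)).symm
    refine ⟨M', (H', E', workList o H' fun _ => plm o c.1), ?_,
      ⟨hH'len, ?_, ?_, ?_, ?_, ?_, ?_⟩, Or.inr hE'len⟩
    · simp only [stepByStepBody, hT, if_false, ← hcdef, hD, ← hgdef, hplm, Part.bind_eq_bind,
        Part.mem_bind_iff]
      refine ⟨L, hLmem, ?_⟩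
      rw [hH', hE']
      exact Part.mem_some _
    · intro j hj
      rw [hM'lt j (by omega), hmon j hj]
    · dsimp only
      rwa [hHE, hN']
    · dsimp only
      rwa [hHE, hN']
    · dsimp only
      rwa [hN']
    · intro a ha
      obtain ⟨h1, m', h2, h3, h4⟩ := mem_workList.1 ha
      rw [hplm] at h4
      refine ⟨by omega, m', h2, h3, fun j hj hj' => ?_⟩
      dsimp only at hj'
      rw [hN'] at hj'
      rcases (Nat.lt_succ_iff.1 hj').eq_or_lt with rfl | hj'
      · rwa [hM'N]
      · rw [hM'lt j hj']
        exact TLocalOrder.lt_trans h4 (hmE j hj hj')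
    · intro j hj m' hm'
      dsimp only at hm' ⊢
      rcases o.lt_trichotomy m' m with h1 | rfl | h1
      · left
        rw [mem_workList]
        exact ⟨by dsimp only; omega, m', hm', rfl, by rwa [hplm]⟩
      -- The monomial m itself is gone: mutual reducedness against the entry with leading monomial m
      -- makes the whole coefficient of its x-part zero.
      · exfalso
        have h2 := hLred j (by omega) N (by omega) (by omega)
        rw [hM'N, ← hgetH' j hj] at h2
        exact hm'.coeff_ne_zero (h2 hm'.1)
      · right
        have h2 := hsame j (by omega)
        rw [hgetlt j (by omega), hgetH j hj] at h2
        rw [hgetH' j hj, h2.isInitial_iff h1] at hm'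
        rcases hdone j hj m' hm' with h3 | h3
        · exfalso
          have h4 := hcmax _ h3
          dsimp only at h4
          rw [hplm, show plm o (initTerm o (toSer (H.getD j 0)) m'.2) = m' from
            hm'.plm_initTerm] at h4
          exact h4 h1
        · exact h3

/-- The last two clauses are initial reducedness with respect to G and within H'. Preservation of
leading monomials lets minimality of the input carry over. -/
theorem exists_mem_stepByStep (hp : Prime p) (hI : toSer (cst p - tVar) ∈ I) (σ : Choices R n p)
    {G : List (Poly R n)} (hG : ∀ g ∈ G, ∃ d', IsGood o p I d' g (plm o g))
    (H : List (Poly R n)) (hH : ∀ g ∈ H, IsPre o I d g (plm o g))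
    (hdist : H.Pairwise fun g g' => (plm o g).2 ≠ (plm o g').2)
    (hHG : ∀ h ∈ H, ∀ g ∈ G, ¬ plm o g ≤ plm o h) :
    ∃ H' ∈ stepByStep o p σ G H, H'.map (plm o) = H.map (plm o) ∧
      (∀ g ∈ H', IsGood o p I d g (plm o g)) ∧
      (∀ g ∈ H', ∀ m, IsInitial g m → ∀ g' ∈ G, ¬ plm o g' ≤ m) ∧
      (∀ g ∈ H', ∀ m, IsInitial g m → ∀ g' ∈ H', plm o g' ≤ m → m = plm o g ∧ g' = g) := by
  classical
  set M₀ : ℕ → Mon n := fun i => plm o (H.getD i 0) with hM₀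
  have hget : ∀ i (hi : i < H.length), H.getD i 0 = H[i] := fun i hi =>
    List.getD_eq_getElem _ _ hi
  have hpre : ∀ i < H.length, IsPre o I d (H.getD i 0) (M₀ i) := fun i hi => by
    simp only [hM₀, hget i hi]
    exact hH _ (List.getElem_mem hi)
  have hd : ∀ i < H.length, ∀ j < H.length, i ≠ j → (M₀ i).2 ≠ (M₀ j).2 := by
    intro i hi j hj hij
    simp only [hM₀, hget i hi, hget j hj]
    rcases lt_or_gt_of_ne hij with h | h
    · exact List.pairwise_iff_getElem.1 hdist i j hi hj h
    · exact (List.pairwise_iff_getElem.1 hdist j i hj hi h).symm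
  have hMG : ∀ i < H.length, ∀ g ∈ G, ¬ plm o g ≤ M₀ i := fun i hi g hg => by
    simp only [hM₀, hget i hi]
    exact hHG _ (List.getElem_mem hi) g hg
  obtain ⟨H₁, hm₁, hpass₁, hred₁, -⟩ := exists_mem_reduceSameDegree hp hI H hpre hd
  have hplm₁ : ∀ i < H.length, plm o (H₁.getD i 0) = M₀ i := fun i hi =>
    (hpass₁.good i hi).monic.plm_eq
  have start : StepInv o p I d G M₀ H.length M₀
      (H₁, [], workList o H₁ fun i => plm o (H₁.getD i 0)) := by
    refine ⟨hpass₁.len, fun _ _ => rfl, by simpa using hpass₁, by simpa using hred₁,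
      by simpa using hd, ?_, ?_⟩
    · intro c hc
      obtain ⟨h1, m, h2, h3, -⟩ := mem_workList.1 hc
      exact ⟨by rw [← hpass₁.len]; exact h1, m, h2, h3, fun j hj hj' => by
        simp at hj'; omega⟩
    · intro i hi m hm
      dsimp only at hm ⊢
      -- The leading monomial never enters the work list; it needs no treatment because no leading
      -- monomial of G divides it.
      rcases (hpass₁.good i hi).le_lead hm with h | h
      · right
        rw [h]
        exact hMG i hi
      · left
        rw [mem_workList]
        exact ⟨by rw [hpass₁.len]; exact hi, m, hm, rfl, by rwa [hplm₁ i hi]⟩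
  -- Lexicographic descent: either E grows towards its bound, or E keeps its size and the work list
  -- shrinks.
  set μ : List (Poly R n) × List (Poly R n) × Finset (Poly R n × ℕ) → ℕ ×ₗ ℕ := fun s =>
    toLex ((xMonomials n d).card - (H.length + s.2.1.length), s.2.2.card) with hμ
  suffices hloop : ∀ s, (∃ M, StepInv o p I d G M₀ H.length M s) →
      ∃ x ∈ stepByStepBody o p σ G s,
        (∃ H', x = Sum.inl H' ∧ ∃ M E, StepInv o p I d G M₀ H.length M (H', E, ∅)) ∨
        ∃ s', x = Sum.inr s' ∧ (∃ M, StepInv o p I d G M₀ H.length M s') ∧ μ s' < μ s by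
    obtain ⟨H', hH', M, E, inv⟩ := exists_mem_fix (f := stepByStepBody o p σ G)
      (InvImage.wf μ wellFounded_lt) hloop _ ⟨M₀, start⟩
    have hlen : H'.length = H.length := inv.len
    have hgetH' : ∀ i (hi : i < H.length), (H' ++ E).getD i 0 = H'[i] := fun i hi => by
      rw [getD_append_left _ _ (by omega)]
      exact List.getD_eq_getElem _ _ (by omega)
    have hgood : ∀ i (hi : i < H.length), IsGood o p I d H'[i] (M₀ i) := fun i hi => by
      rw [← hgetH' i hi, ← inv.mon i hi]
      exact inv.pass.good i (by dsimp only; omega)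
    have hplm' : ∀ i (hi : i < H.length), plm o H'[i] = M₀ i := fun i hi =>
      (hgood i hi).monic.plm_eq
    refine ⟨H', ?_, ?_, ?_, ?_, ?_⟩
    · simp only [stepByStep, Part.bind_eq_bind, Part.mem_bind_iff]
      exact ⟨H₁, hm₁, hH'⟩
    · refine List.ext_getElem (by simp [hlen]) fun i h1 h2 => ?_
      rw [List.getElem_map, List.getElem_map]
      have hi : i < H.length := by simpa using h2
      rw [show plm o H'[i] = M₀ i from hplm' i hi]
      simp only [hM₀, hget i hi]
    · intro g hg
      obtain ⟨i, hi, rfl⟩ := List.getElem_of_mem hg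
      rw [show plm o H'[i] = M₀ i from hplm' i (by omega)]
      exact hgood i (by omega)
    · intro g hg m hm
      obtain ⟨i, hi, rfl⟩ := List.getElem_of_mem hg
      refine (inv.done i (by omega) m ?_).resolve_left (by simp)
      dsimp only
      rwa [List.getD_eq_getElem _ _ hi]
    · intro g hg m hm g' hg' hle
      obtain ⟨i, hi, rfl⟩ := List.getElem_of_mem hg
      obtain ⟨j, hj, rfl⟩ := List.getElem_of_mem hg'
      have hi' : i < H.length := by omega
      have hj' : j < H.length := by omega
      rw [show plm o H'[j] = M₀ j from hplm' j hj'] at hle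
      rw [show plm o H'[i] = M₀ i from hplm' i hi']
      -- Both x-parts have degree d, so divisibility forces equality and mutual reducedness applies.
      have e2 : m.2 = (M₀ j).2 := by
        obtain ⟨x, hx⟩ := exists_add_of_le hle.2
        have h1 := (hgood i hi').degree_eq hm.coeff_ne_zero
        have h2 := (hgood j hj').degree_eq (hgood j hj').monic.coeff_ne_zero
        have h3 : x.degree = 0 := by
          have := congrArg Finsupp.degree hx
          rw [map_add, h1, h2] at this
          omega
        rw [hx, (Finsupp.degree_eq_zero_iff x).1 h3, add_zero]
      by_cases hij : i = j
      · subst hij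
        exact ⟨(hgood i hi').initial_eq_lead hm e2, rfl⟩
      · exfalso
        have h1 := inv.red i (by dsimp only; omega) j (by dsimp only; omega) hij
        dsimp only at h1
        rw [inv.mon j hj', hgetH' i hi', ← e2] at h1
        exact hm.coeff_ne_zero (h1 ((pow_dvd_pow _ hle.1).trans hm.1))
  rintro s ⟨M, inv⟩
  by_cases hT : s.2.2 = ∅
  · refine ⟨Sum.inl s.1, ?_, Or.inl ⟨s.1, rfl, M, s.2.1, ?_⟩⟩
    · simp only [stepByStepBody, hT, if_true]
      exact Part.mem_some _
    · rw [← hT]; exact inv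
  · obtain ⟨M', s', hs', inv', hdec⟩ := inv.step hp hI σ hG hMG hT
    refine ⟨_, hs', Or.inr ⟨s', rfl, ⟨M', inv'⟩, ?_⟩⟩
    have h1 := inv'.card_le
    rw [hμ, Prod.Lex.toLex_lt_toLex]
    rcases hdec with ⟨h2, h3⟩ | h2
    · right; dsimp only; rw [h2]; exact ⟨rfl, h3⟩
    · left; dsimp only; omega

end StepByStep

/-! ## Leading ideals and initially reduced standard bases -/

section LeadIdeal
variable {R : Type u} [CommRing R] {n : ℕ} {o : TLocalOrder n} {p : R} {I : Ideal (Ser R n)}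

/-- The coefficient of a product a f at m only involves coefficients of f at divisors of m. Hence a
divisor-closed set of monomials at which all generators have coefficients in J has this property for
the whole ideal. -/
theorem pc_mem_of_mem_span (J : Ideal R) (Q : Mon n → Prop) (hQ : ∀ m m', m ≤ m' → Q m' → Q m)
    (S : Set (Poly R n)) (hS : ∀ s ∈ S, ∀ m, Q m → pc m s ∈ J) {f : Poly R n}
    (hf : f ∈ Ideal.span S) {m : Mon n} (hm : Q m) : pc m f ∈ J := by
  induction hf using Submodule.span_induction generalizing m with
  | mem s hs => exact hS s hs m hm
  | zero => simp
  | add f g _ _ hf hg => rw [pc_add]; exact J.add_mem (hf hm) (hg hm)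
  | smul a f _ hf =>
    classical
    rw [smul_eq_mul, pc, MvPolynomial.coeff_mul, Polynomial.finsetSum_coeff]
    refine J.sum_mem fun x hx => ?_
    rw [Polynomial.coeff_mul]
    refine J.sum_mem fun y hy => J.mul_mem_left _ ?_
    have hx' : x.1 + x.2 = m.2 := by simpa using hx
    have hy' : y.1 + y.2 = m.1 := by simpa using hy
    exact hf (m := (y.2, x.2)) (hQ _ m ⟨by rw [← hy']; exact Nat.le_add_left _ _,
      by rw [← hx']; exact le_add_self⟩ hm)

/-- Work modulo p: leading terms with coefficient divisible by p contribute only coefficients in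
⟨p⟩, so a coefficient outside ⟨p⟩ must come from a leading term with coefficient prime to p. Taking
p = 0 gives the statement for nonzero coefficients. -/
theorem exists_lm_le_of_mem_leadIdeal {S : Set (Ser R n)} {f : Poly R n}
    (hf : f ∈ leadIdeal o S) {m : Mon n} (hm : ¬ p ∣ pc m f) :
    ∃ s ∈ S, ¬ p ∣ lc o s ∧ lm o s ≤ m := by
  classical
  by_contra! hno
  refine hm (Ideal.mem_span_singleton.1 (pc_mem_of_mem_span (Ideal.span {p})
    (fun m => ∀ s ∈ S, ¬ p ∣ lc o s → ¬ lm o s ≤ m)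
    (fun m m' h h' s hs hps hle => h' s hs hps (hle.trans h)) _ ?_ hf hno))
  rintro _ ⟨s, hs, rfl⟩ m' hm'
  rw [lt, pc_term]
  split_ifs with h
  · rw [Ideal.mem_span_singleton]
    by_contra hps
    exact hm' s hs hps h.le
  · exact Ideal.zero_mem _

theorem exists_lm_le_of_mem_leadIdeal_of_ne_zero {S : Set (Ser R n)} {f : Poly R n}
    (hf : f ∈ leadIdeal o S) {m : Mon n} (hm : pc m f ≠ 0) : ∃ s ∈ S, lm o s ≤ m := by
  obtain ⟨s, hs, -, h⟩ := exists_lm_le_of_mem_leadIdeal (p := 0) hf (by rwa [zero_dvd_iff])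
  exact ⟨s, hs, h⟩

theorem coeffAt_tail (f : Ser R n) (m : Mon n) [Decidable (m = lm o f)] :
    coeffAt m (tail o f) = if m = lm o f then 0 else coeffAt m f := by
  classical
  have h : coeffAt m (tail o f) = coeffAt m f - coeffAt m (toSer (lt o f)) := by
    simp [coeffAt, tail]
  rw [h, coeffAt_toSer, lt, pc_term]
  by_cases e : m = lm o f
  · rw [if_pos e.symm, if_pos e, lc, e, sub_self]
  · rw [if_neg (fun h => e h.symm), if_neg e, sub_zero]

open Classical in
-- Distinct α contribute distinct x-parts, so there is no cancellation in the sum defining the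
-- initial part.
theorem pc_initPart (g : Poly R n) (m : Mon n) :
    pc m (initPart o (toSer g)) = if IsInitial g m then pc m g else 0 := by
  have h : ∀ s : Finset (Fin n →₀ ℕ), pc m (∑ α ∈ s, initTerm o (toSer g) α) =
      ∑ α ∈ s, pc m (initTerm o (toSer g) α) := fun s => by
    induction s using Finset.induction_on with
    | empty => simp
    | insert a s ha ih => rw [Finset.sum_insert ha, Finset.sum_insert ha, pc_add, ih]
  rw [initPart, h, Finset.sum_eq_single m.2]
  · by_cases h0 : MvPolynomial.coeff m.2 g = 0
    · rw [if_neg fun h => h.coeff_ne_zero h0, initTerm_toSer, h0]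
      simp [term]
    · have h1 := isInitial_natTrailingDegree h0
      rw [initTerm_toSer, pc_term]
      by_cases e : m.1 = (MvPolynomial.coeff m.2 g).natTrailingDegree
      · have e' : ((MvPolynomial.coeff m.2 g).natTrailingDegree, m.2) = m := by rw [← e]
        rw [if_pos e', if_pos (by rwa [e'] at h1), Polynomial.trailingCoeff, ← e]
        rfl
      · rw [if_neg fun h => e (congrArg Prod.fst h).symm,
          if_neg fun h => e h.natTrailingDegree_eq.symm]
  · intro α _ hα
    rw [initTerm_toSer, pc_term, if_neg]
    exact fun h => hα (congrArg Prod.snd h)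
  · intro hm
    have h0 : MvPolynomial.coeff m.2 g = 0 := by
      rw [MvPolynomial.notMem_support_iff, coeff_toSer] at hm
      exact_mod_cast hm
    rw [initTerm_toSer, h0]
    simp [term]

theorem IsLeadMon.isInitial {g : Poly R n} {m : Mon n} (h : IsLeadMon o (toSer g) m) :
    IsInitial g m := by
  have h0 : MvPolynomial.coeff m.2 g ≠ 0 := by
    intro h0
    have := h.1
    rw [coeffAt_toSer, pc, h0] at this
    simp at this
  have := isInitial_natTrailingDegree h0
  rwa [h.natTrailingDegree_eq] at this

theorem IsLeadMon.initPart {g : Poly R n} {m : Mon n} (h : IsLeadMon o (toSer g) m) :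
    IsLeadMon o (toSer (initPart o (toSer g))) m := by
  classical
  refine ⟨?_, fun m' hm' => h.2 m' ?_⟩
  · rw [coeffAt_toSer, pc_initPart, if_pos h.isInitial]
    simpa using h.1
  · rw [coeffAt_toSer, pc_initPart] at hm'
    rw [coeffAt_toSer]
    split_ifs at hm' with h1
    · exact hm'
    · exact absurd rfl hm'

/-- The terms of the tail of the initial part of `g` are the initial terms of `g` other than the
leading one. -/
theorem tail_initPart {g : Poly R n} (hg : g ≠ 0) {m : Mon n}
    (hm : coeffAt m (tail o (toSer (initPart o (toSer g)))) ≠ 0) :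
    m ≠ plm o g ∧ IsInitial g m ∧ coeffAt m (tail o (toSer (initPart o (toSer g)))) = pc m g := by
  classical
  have h := (isLeadMon_lm o _ (toSer_ne_zero.2 hg)).initPart
  rw [coeffAt_tail, h.lm_eq, coeffAt_toSer, pc_initPart] at hm ⊢
  by_cases h1 : m = plm o g
  · exact absurd (if_pos h1) hm
  · rw [if_neg h1] at hm ⊢
    by_cases h2 : IsInitial g m
    · exact ⟨h1, h2, if_pos h2⟩
    · exact absurd (if_neg h2) hm

theorem pc_pMinusT (m : Mon n) [Decidable (m = 0)] [Decidable (m = (1, 0))] :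
    pc m (cst p - tVar) = (if m = 0 then p else 0) - if m = (1, 0) then 1 else 0 := by
  classical
  have h : (cst p - tVar : Poly R n) = term 0 p - term (1, 0) 1 := rfl
  rw [h, pc_sub, pc_term, pc_term]
  simp only [eq_comm]

theorem isLeadMon_pMinusT (hp : p ≠ 0) : IsLeadMon o (toSer (cst p - tVar)) 0 := by
  classical
  have h01 : (0 : Mon n) ≠ (1, 0) := fun h => by simpa using congrArg Prod.fst h
  refine ⟨by rw [coeffAt_toSer, pc_pMinusT]; simpa [h01] using hp, fun m hm => ?_⟩
  rw [coeffAt_toSer, pc_pMinusT] at hm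
  by_cases h0 : m = 0
  · exact Or.inl h0
  · by_cases h1 : m = (1, 0)
    · right; rw [h1]; exact o.t_local
    · simp [h0, h1] at hm

theorem plc_pMinusT (hp : p ≠ 0) : plc o (cst p - tVar) = p := by
  classical
  have h01 : (0 : Mon n) ≠ (1, 0) := fun h => by simpa using congrArg Prod.fst h
  rw [plc, lc, (isLeadMon_pMinusT hp).lm_eq, coeffAt_toSer, pc_pMinusT]
  simp [h01]

theorem plt_pMinusT (hp : p ≠ 0) : plt o (cst p - tVar) = (cst p : Poly R n) := by
  rw [plt, lt, (isLeadMon_pMinusT hp).lm_eq, show lc o (toSer (cst p - tVar)) = p from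
    plc_pMinusT hp]
  rfl

/-- The properties of the output of the algorithm, without the element `p - t`. -/
structure IsReducedCore (o : TLocalOrder n) (p : R) (I : Ideal (Ser R n)) (G : List (Poly R n)) :
    Prop where
  hom : ∀ g ∈ G, XHomogeneous g
  mem : ∀ g ∈ G, toSer g ∈ I
  monic : ∀ g ∈ G, IsMonicAt o g (plm o g)
  ne_zero : ∀ g ∈ G, plm o g ≠ 0
  clean : ∀ g ∈ G, ∀ α, IsCleanCoeff p (MvPolynomial.coeff α g)
  red : ∀ g ∈ G, ∀ m, IsInitial g m → ∀ h ∈ G, plm o h ≤ m → m = plm o g ∧ h = g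
  cover : ∀ f ∈ I, ¬ p ∣ lc o f → ∃ g ∈ G, plm o g ≤ lm o f

theorem IsReducedCore.eq_of_le [Nontrivial R] {G : List (Poly R n)} (hG : IsReducedCore o p I G)
    {g h : Poly R n} (hg : g ∈ G) (hh : h ∈ G) (hle : plm o h ≤ plm o g) : h = g :=
  (hG.red g hg _ (hG.monic g hg).isInitial h hh hle).2

theorem term_mem_of_le {J : Ideal (Poly R n)} {m m' : Mon n} (h : term m 1 ∈ J) (hle : m ≤ m')
    (c : R) : term m' c ∈ J := by
  obtain ⟨δ, rfl⟩ := exists_add_of_le hle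
  have := J.mul_mem_right (term δ c) h
  rwa [term_mul_term, one_mul] at this

/-- Leading terms with coefficient in ⟨p⟩ are multiples of lt(p - t) = p; the others are multiples
of a monic leading term by `cover`. Minimality and reducedness are tested modulo p, where p - t is
invisible and only divisibility among monic leading monomials remains. -/
theorem IsReducedCore.isXHomInitReducedStdBasis [IsDomain R] (hp : Prime p)
    (hI : toSer (cst p - tVar) ∈ I) {G : List (Poly R n)} (hG : IsReducedCore o p I G) :
    IsXHomInitReducedStdBasis o I (G ++ [cst p - tVar]) := by
  classical
  have hmem : ∀ s, s ∈ serSet (G ++ [cst p - tVar]) ↔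
      (∃ g ∈ G, s = toSer g) ∨ s = toSer (cst p - tVar) := fun s => by
    simp only [serSet, List.mem_append, List.mem_singleton, Set.mem_ofPred_eq]
    constructor
    · rintro ⟨g, hg | rfl, rfl⟩
      · exact Or.inl ⟨g, hg, rfl⟩
      · exact Or.inr rfl
    · rintro (⟨g, hg, rfl⟩ | rfl)
      · exact ⟨g, Or.inl hg, rfl⟩
      · exact ⟨_, Or.inr rfl, rfl⟩
  have hlcp : lc o (toSer (cst p - tVar : Poly R n)) = p := plc_pMinusT hp.ne_zero
  have hlm : ∀ s ∈ serSet (G ++ [cst p - tVar]), ¬ p ∣ lc o s → ∃ g ∈ G, s = toSer g :=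
    fun s hs hps => ((hmem s).1 hs).resolve_right fun e => by
      rw [e, hlcp] at hps; exact hps dvd_rfl
  have hsub : serSet (G ++ [cst p - tVar]) ⊆ (I : Set (Ser R n)) := fun s hs => by
    rcases (hmem s).1 hs with ⟨g, hg, rfl⟩ | rfl
    · exact hG.mem g hg
    · exact hI
  have hlt : ∀ g ∈ G, term (plm o g) 1 ∈ leadIdeal o (serSet (G ++ [cst p - tVar])) :=
    fun g hg => by
      rw [← (hG.monic g hg).plt_eq]
      exact Ideal.subset_span ⟨_, (hmem _).2 (Or.inl ⟨g, hg, rfl⟩), rfl⟩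
  have hltp : cst p ∈ leadIdeal o (serSet (G ++ [cst p - tVar])) := by
    have h : lt o (toSer (cst p - tVar : Poly R n)) = cst p := plt_pMinusT hp.ne_zero
    exact Ideal.subset_span ⟨_, (hmem _).2 (Or.inr rfl), h⟩
  refine ⟨fun g hg => ?_, ⟨?_, hsub, le_antisymm (Ideal.span_mono (Set.image_mono hsub)) ?_⟩, ?_, ?_⟩
  · rcases List.mem_append.1 hg with h | h
    · exact hG.hom g h
    · rw [List.mem_singleton.1 h, cst_sub_tVar]
      exact ⟨0, MvPolynomial.isHomogeneous_C _ _⟩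
  · have : serSet (G ++ [cst p - tVar]) = toSer '' {g | g ∈ G ++ [cst p - tVar]} := by
      ext s; simp only [serSet, Set.mem_ofPred_eq, Set.mem_image, eq_comm]
    rw [this]
    exact (List.finite_toSet _).image _
  · refine Ideal.span_le.2 ?_
    rintro _ ⟨f, hf, rfl⟩
    by_cases hpf : p ∣ lc o f
    · obtain ⟨c, hc⟩ := hpf
      have : lt o f = cst p * term (lm o f) c := by
        rw [lt, hc, show (cst p : Poly R n) = term 0 p from rfl, term_mul_term, zero_add]
      rw [SetLike.mem_coe, this]
      exact Ideal.mul_mem_right _ _ hltp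
    · obtain ⟨g, hg, hle⟩ := hG.cover f hf hpf
      exact term_mem_of_le (hlt g hg) hle _
  · intro S hS heq
    obtain ⟨s, hs, hsS⟩ := Set.exists_of_ssubset hS
    have hSL := hS.subset
    rcases (hmem s).1 hs with ⟨g, hg, rfl⟩ | rfl
    · have h1 : term (plm o g) 1 ∈ leadIdeal o S := heq ▸ hlt g hg
      obtain ⟨s, hsS', hps, hle⟩ := exists_lm_le_of_mem_leadIdeal (p := p) h1
        (m := plm o g) (by rw [pc_term_self]; exact fun h => hp.not_isUnit (isUnit_of_dvd_one h))
      obtain ⟨h, hh, rfl⟩ := hlm s (hSL hsS') hps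
      rw [hG.eq_of_le hg hh hle] at hsS'
      exact hsS hsS'
    -- Removing p - t: the term p would need an element with leading monomial 1, but no element of G
    -- has one.
    · have h1 : cst p ∈ leadIdeal o S := heq ▸ hltp
      obtain ⟨s, hsS', hle⟩ := exists_lm_le_of_mem_leadIdeal_of_ne_zero h1 (m := 0)
        (by rw [show (cst p : Poly R n) = term 0 p from rfl, pc_term_self]; exact hp.ne_zero)
      rcases (hmem s).1 (hSL hsS') with ⟨h, hh, rfl⟩ | rfl
      · exact hG.ne_zero h hh (le_antisymm hle zero_le)
      · exact hsS hsS'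
  · rintro _ ⟨_, hs, rfl⟩ m hm hin
    dsimp only at hm hin
    rcases (hmem _).1 hs with ⟨g, hg, rfl⟩ | rfl
    · obtain ⟨h1, h2, h3⟩ := tail_initPart (hG.monic g hg).ne_zero hm
      rw [h3] at hin
      -- Cleanness is essential here: a term with coefficient divisible by p would lie in the
      -- leading ideal because of p - t.
      have hclean : ¬ p ∣ pc m g := by
        have := hG.clean g hg m.2 h2.coeff_ne_zero
        rwa [Polynomial.trailingCoeff, h2.natTrailingDegree_eq] at this
      obtain ⟨s, hsL, hps, hle⟩ := exists_lm_le_of_mem_leadIdeal (p := p) hin (m := m)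
        (by rwa [pc_term_self])
      obtain ⟨h, hh, rfl⟩ := hlm s hsL hps
      exact h1 (hG.red g hg m h2 h hh hle).1
    -- All of p - t has x-part 1, so its initial part is just p and has no tail.
    · have hlead := isLeadMon_pMinusT (o := o) (n := n) hp.ne_zero
      have hne : (cst p - tVar : Poly R n) ≠ 0 := by
        intro h0
        have := hlead.1
        simp [h0, coeffAt] at this
      obtain ⟨h1, h2, -⟩ := tail_initPart hne hm
      apply h1
      rw [show plm o (cst p - tVar) = 0 from hlead.lm_eq]
      refine h2.eq_of_snd_eq hlead.isInitial ?_
      by_contra h3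
      refine h2.coeff_ne_zero ?_
      rw [cst_sub_tVar, MvPolynomial.coeff_C, if_neg (fun h => h3 h.symm)]

end LeadIdeal

/-! ## Correctness of the algorithm -/

section Algorithm
variable {R : Type u} [CommRing R] {n : ℕ} {o : TLocalOrder n} {p : R} {I : Ideal (Ser R n)}

theorem pc_cst_mul (a : R) (g : Poly R n) (m : Mon n) : pc m (cst a * g) = a * pc m g := by
  simp [cst, pc, MvPolynomial.coeff_C_mul]

variable [IsDomain R]

/-- An x-homogeneous element with leading monomial 1 lies in R[t] with constant term 1, which is a
unit of R⟦t⟧. This is where I ≠ R⟦t⟧[x] enters the correctness of the algorithm. -/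
theorem IsPre.plm_ne_zero {d : ℕ} {g : Poly R n} {m : Mon n} (h : IsPre o I d g m) (hI : I ≠ ⊤) :
    m ≠ 0 := by
  rintro rfl
  apply hI
  have hd : 0 = d := by simpa using h.degree_eq (m' := 0) h.monic.coeff_ne_zero
  obtain ⟨a, ha⟩ : ∃ a : Polynomial R, g = MvPolynomial.C a :=
    ⟨_, MvPolynomial.totalDegree_eq_zero_iff_eq_C.1 (by
      rw [h.hom.totalDegree h.monic.ne_zero, ← hd])⟩
  have ha0 : a.coeff 0 = 1 := by simpa [ha, pc] using h.monic.1
  refine Ideal.eq_top_of_isUnit_mem _ h.mem ?_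
  have : toSer g = MvPolynomial.C (a : PowerSeries R) := by
    rw [ha, toSer, MvPolynomial.map_C]; rfl
  rw [this]
  refine IsUnit.map MvPolynomial.C (PowerSeries.isUnit_iff_constantCoeff.2 ?_)
  rw [← PowerSeries.coeff_zero_eq_constantCoeff_apply, Polynomial.coeff_coe, ha0]
  exact isUnit_one

/-- In a g + b m (p - t) the coefficient of m is a lc(g) + b p = 1, and the additional term -b t m
is below m because t < 1. -/
theorem normalise_spec (hI : toSer (cst p - tVar) ∈ I)
    (hunit : ∀ c : R, ¬ p ∣ c → ∃ a b, a * c + b * p = 1) (σ : Choices R n p)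
    {L : List (Poly R n)} (hhom : ∀ g ∈ L, XHomogeneous g) (hmem : ∀ g ∈ L, toSer g ∈ I) :
    (∀ g ∈ normalise o p σ L, IsPre o I (xdeg g) g (plm o g)) ∧
    ∀ g ∈ L, ¬ p ∣ plc o g → ∃ g' ∈ normalise o p σ L, plm o g' = plm o g := by
  classical
  have key : ∀ g ∈ L, ¬ p ∣ plc o g → ∀ g', g' = (if plc o g = 1 then g else
      cst (σ.bezout (plc o g)).1 * g +
        cst (σ.bezout (plc o g)).2 * term (plm o g) 1 * (cst p - tVar)) →
      IsPre o I (xdeg g') g' (plm o g') ∧ plm o g' = plm o g := by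
    intro g hg hpg g' hg'
    obtain ⟨d, hd⟩ := hhom g hg
    have hpre : IsPre o I d g' (plm o g) := by
      by_cases h1 : plc o g = 1
      · rw [if_pos h1] at hg'
        rw [hg']
        exact ⟨isMonicAt_of_plc h1, hd, hmem g hg⟩
      · rw [if_neg h1] at hg'
        set a := (σ.bezout (plc o g)).1
        set b := (σ.bezout (plc o g)).2
        have hab : a * plc o g + b * p = 1 := σ.bezout_spec _ (hunit _ hpg)
        have hg0 : g ≠ 0 := by
          rintro rfl
          apply hpg
          simp [plc]
        have hm0 : pc (plm o g) g ≠ 0 := by simpa [plm] using (isLeadMon_lm o _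
          (toSer_ne_zero.2 hg0)).1
        have e : cst b * term (plm o g) 1 * (cst p - tVar) =
            (term (plm o g) (b * p) - term (plm o g + (1, 0)) b : Poly R n) := by
          rw [show (cst b : Poly R n) = term 0 b from rfl,
            show (cst p - tVar : Poly R n) = term 0 p - term (1, 0) 1 from rfl,
            term_mul_term, mul_sub, term_mul_term, term_mul_term]
          simp
        have hne : plm o g + (1, 0) ≠ plm o g := fun h => by
          have := congrArg Prod.fst h
          simp at this
        refine ⟨⟨?_, fun m' hm' => ?_⟩, ?_, ?_⟩
        · rw [hg', e, pc_add, pc_cst_mul, pc_sub, pc_term, pc_term, if_pos rfl, if_neg hne, sub_zero]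
          rw [plc, lc, coeffAt_toSer] at hab
          exact hab
        · have h2 : pc m' g = 0 := by simpa using coeffAt_eq_zero_of_lm_lt o hm'
          rw [hg', e, pc_add, pc_cst_mul, pc_sub, pc_term, pc_term, h2,
            if_neg (TLocalOrder.ne_of_lt hm'), if_neg]
          · simp
          · rintro rfl
            refine TLocalOrder.lt_asymm hm' ?_
            have : o.lt ((plm o g).1 + 1, (plm o g).2) ((plm o g).1, (plm o g).2) :=
              o.lt_of_t_lt _ (Nat.lt_succ_self _)
            have e3 : plm o g + (1, 0) = ((plm o g).1 + 1, (plm o g).2) := by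
              ext <;> simp
            rw [e3]
            exact this
        · rw [hg', cst_sub_tVar]
          have hdeg : (plm o g).2.degree = d := isHomogeneous_iff.1 hd _ fun h => hm0 (by
            rw [pc, h]; simp)
          have h1 : MvPolynomial.IsHomogeneous (cst a * g) d := by
            have := (MvPolynomial.isHomogeneous_C (Fin n) (Polynomial.C a)).mul hd
            rwa [zero_add] at this
          have h2 : MvPolynomial.IsHomogeneous (cst b * term (plm o g) 1 *
              MvPolynomial.C (pMinusT p) : Poly R n) d := by
            have := ((MvPolynomial.isHomogeneous_C (Fin n) (Polynomial.C b)).mul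
              (MvPolynomial.isHomogeneous_monomial (Polynomial.monomial (plm o g).1 (1 : R))
                hdeg)).mul (MvPolynomial.isHomogeneous_C (Fin n) (pMinusT p))
            rwa [zero_add, add_zero] at this
          exact h1.add h2
        · rw [hg', map_add, map_mul, map_mul]
          exact I.add_mem (I.mul_mem_left _ (hmem g hg)) (I.mul_mem_left _ hI)
    have hplm : plm o g' = plm o g := hpre.monic.plm_eq
    have hx : xdeg g' = d := hpre.hom.totalDegree hpre.monic.ne_zero
    rw [hplm, hx]
    exact ⟨hpre, rfl⟩
  constructor
  · intro g' hg'
    simp only [normalise, List.mem_map, List.mem_filter, decide_eq_true_eq] at hg'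
    obtain ⟨g, ⟨hg, hpg⟩, e⟩ := hg'
    exact (key g hg hpg g' e.symm).1
  · intro g hg hpg
    refine ⟨_, ?_, (key g hg hpg _ rfl).2⟩
    simp only [normalise, List.mem_map, List.mem_filter, decide_eq_true_eq]
    exact ⟨g, ⟨hg, hpg⟩, rfl⟩

omit [IsDomain R] in
-- The loop maintains that `kept` is an antichain for divisibility and is not divided by anything
-- still to come. A removed element is covered by one that remains, which in turn is covered at the
-- end.
theorem minimise_spec (rest kept : List (Poly R n))
    (h1 : kept.Pairwise fun g h => ¬ plm o g ≤ plm o h ∧ ¬ plm o h ≤ plm o g)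
    (h2 : ∀ k ∈ kept, ∀ r ∈ rest, ¬ plm o r ≤ plm o k) :
    (∀ g ∈ minimise o kept rest, g ∈ kept ++ rest) ∧
    ((minimise o kept rest).Pairwise fun g h => ¬ plm o g ≤ plm o h ∧ ¬ plm o h ≤ plm o g) ∧
    ∀ g ∈ kept ++ rest, ∃ g' ∈ minimise o kept rest, plm o g' ≤ plm o g := by
  induction rest generalizing kept with
  | nil => simpa [minimise] using ⟨h1, fun g hg => ⟨g, hg, le_rfl⟩⟩
  | cons g rest ih =>
    by_cases h : ∃ g' ∈ kept ++ rest, plm o g' ≤ plm o g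
    · simp only [minimise, h, if_true]
      obtain ⟨i1, i2, i3⟩ := ih kept h1 fun k hk r hr => h2 k hk r (by simp [hr])
      refine ⟨fun x hx => ?_, i2, fun x hx => ?_⟩
      · have := i1 x hx
        simp only [List.mem_append, List.mem_cons] at this ⊢
        tauto
      · by_cases hxg : x = g
        · obtain ⟨g', hg', hle⟩ := h
          obtain ⟨g'', hg'', hle'⟩ := i3 g' hg'
          exact ⟨g'', hg'', hle'.trans (hxg ▸ hle)⟩
        · refine i3 x ?_
          simp only [List.mem_append, List.mem_cons] at hx ⊢
          tauto
    · simp only [minimise, h, if_false]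
      push Not at h
      have e : kept ++ [g] ++ rest = kept ++ g :: rest := by simp
      rw [← e]
      refine ih (kept ++ [g]) ?_ ?_
      · refine List.pairwise_append.2 ⟨h1, List.pairwise_singleton _ _, fun k hk x hx => ?_⟩
        rw [List.mem_singleton.1 hx]
        exact ⟨h k (by simp [hk]), h2 k hk g (by simp)⟩
      · intro k hk r hr
        rcases List.mem_append.1 hk with hk | hk
        · exact h2 k hk r (by simp [hr])
        · rw [List.mem_singleton.1 hk]
          exact h r (by simp [hr])

/-- What is preserved by the main loop. -/
structure MainInv (o : TLocalOrder n) (p : R) (I : Ideal (Ser R n))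
    (s : List (Poly R n) × List (Poly R n)) : Prop where
  good : ∀ g ∈ s.1, ∃ d, IsGood o p I d g (plm o g)
  red : ∀ g ∈ s.1, ∀ m, IsInitial g m → ∀ h ∈ s.1, plm o h ≤ m → m = plm o g ∧ h = g
  pre : ∀ g ∈ s.2, IsPre o I (xdeg g) g (plm o g)
  min : s.2.Pairwise fun g h => ¬ plm o g ≤ plm o h ∧ ¬ plm o h ≤ plm o g
  lower : ∀ g ∈ s.1, ∀ h ∈ s.2, ¬ plm o g ≤ plm o h ∧ (plm o g).2.degree < xdeg h
  cover : ∀ f ∈ I, ¬ p ∣ lc o f → ∃ g ∈ s.1 ++ s.2, plm o g ≤ lm o f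

/-- The new elements have x-degree d, larger than that of every element of G. An initial monomial of
lower x-degree cannot be divisible by their leading monomials, so reducedness of G persists, while
(C) reduces the new elements. -/
theorem MainInv.step [IsNoetherianRing R] (hp : Prime p) (hI : toSer (cst p - tVar) ∈ I)
    (σ : Choices R n p) {s : List (Poly R n) × List (Poly R n)} (inv : MainInv o p I s)
    (hs : s.2 ≠ []) :
    ∃ s', Sum.inr s' ∈ mainBody o p σ s ∧ MainInv o p I s' ∧ s'.2.length < s.2.length := by
  classical
  obtain ⟨G, G'⟩ := s
  obtain ⟨hgood, hred, hpre, hmin, hlower, hcover⟩ := inv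
  dsimp only at hgood hred hpre hmin hlower hcover hs
  set d := sInf {e | ∃ g ∈ G', xdeg g = e} with hd
  have hdmem : d ∈ {e | ∃ g ∈ G', xdeg g = e} := by
    obtain ⟨g, hg⟩ := List.exists_mem_of_ne_nil _ hs
    exact Nat.sInf_mem ⟨xdeg g, g, hg, rfl⟩
  have hdle : ∀ g ∈ G', d ≤ xdeg g := fun g hg => Nat.sInf_le ⟨g, hg, rfl⟩
  set H := G'.filter fun g => xdeg g = d with hH
  have hHmem : ∀ g, g ∈ H ↔ g ∈ G' ∧ xdeg g = d := fun g => by simp [hH, List.mem_filter]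
  set K := G'.filter fun g => d < xdeg g with hK
  have hKmem : ∀ g, g ∈ K ↔ g ∈ G' ∧ d < xdeg g := fun g => by simp [hK, List.mem_filter]
  have hHK : ∀ g ∈ G', g ∈ H ∨ g ∈ K := fun g hg => by
    rw [hHmem, hKmem]
    rcases (hdle g hg).eq_or_lt with h | h
    · exact Or.inl ⟨hg, h.symm⟩
    · exact Or.inr ⟨hg, h⟩
  have hHpre : ∀ g ∈ H, IsPre o I d g (plm o g) := fun g hg => by
    have := hpre g ((hHmem g).1 hg).1
    rwa [((hHmem g).1 hg).2] at this
  obtain ⟨H', hm, hmap, hgood', hredG, hredH⟩ := exists_mem_stepByStep hp hI σ hgood H hHpre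
    -- Two monomials with the same x-part are comparable under divisibility; minimality therefore
    -- makes the x-parts distinct.
    ((hmin.filter _).imp_of_mem fun {a b} _ _ h e => by
      rcases le_total (plm o a).1 (plm o b).1 with h' | h'
      · exact h.1 ⟨h', e.le⟩
      · exact h.2 ⟨h', e.ge⟩)
    fun h hh g hg => (hlower g hg h ((hHmem h).1 hh).1).1
  have hback : ∀ g ∈ H', ∃ g₀ ∈ H, plm o g₀ = plm o g := fun g hg => by
    have : plm o g ∈ H.map (plm o) := hmap ▸ List.mem_map_of_mem hg
    exact List.mem_map.1 this
  have hforth : ∀ g ∈ H, ∃ g' ∈ H', plm o g' = plm o g := fun g hg => by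
    have : plm o g ∈ H'.map (plm o) := hmap ▸ List.mem_map_of_mem hg
    exact List.mem_map.1 this
  have hHdeg : ∀ g ∈ H', (plm o g).2.degree = d := fun g hg =>
    (hgood' g hg).degree_eq (hgood' g hg).monic.coeff_ne_zero
  refine ⟨(G ++ H', K), ?_, ⟨?_, ?_, ?_, ?_, ?_, ?_⟩, ?_⟩
  · simp only [mainBody, hs, if_false, Part.bind_eq_bind, Part.mem_bind_iff]
    exact ⟨H', hm, Part.mem_some _⟩
  · intro g hg
    rcases List.mem_append.1 hg with hg | hg
    · exact hgood g hg
    · exact ⟨d, hgood' g hg⟩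
  · intro g hg m hgm h hh hle
    rcases List.mem_append.1 hg with hg | hg <;> rcases List.mem_append.1 hh with hh | hh
    · exact hred g hg m hgm h hh hle
    · exfalso
      obtain ⟨d', hg'⟩ := hgood g hg
      obtain ⟨h₀, hh₀, e⟩ := hback h hh
      have h1 := (hlower g hg h₀ ((hHmem _).1 hh₀).1).2
      rw [((hHmem _).1 hh₀).2, hg'.degree_eq hg'.monic.coeff_ne_zero,
        ← hg'.degree_eq hgm.coeff_ne_zero, ← hHdeg h hh] at h1
      exact absurd (Finsupp.degree_mono hle.2) (not_le.2 h1)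
    · exact absurd hle (hredG g hg m hgm h hh)
    · exact hredH g hg m hgm h hh hle
  · exact fun g hg => hpre g ((hKmem g).1 hg).1
  · exact hmin.filter _
  · intro g hg h hh
    obtain ⟨hh1, hh2⟩ := (hKmem h).1 hh
    rcases List.mem_append.1 hg with hg | hg
    · exact hlower g hg h hh1
    · obtain ⟨g₀, hg₀, e⟩ := hback g hg
      obtain ⟨hg1, hg2⟩ := (hHmem g₀).1 hg₀
      refine ⟨?_, by rw [hHdeg g hg]; exact hh2⟩
      rw [← show plm o g₀ = plm o g from e]
      have hsymm : Std.Symm fun g h : Poly R n => ¬ plm o g ≤ plm o h ∧ ¬ plm o h ≤ plm o g :=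
        ⟨fun _ _ h => ⟨h.2, h.1⟩⟩
      refine (hmin.forall hg1 hh1 ?_).1
      rintro rfl
      omega
  · intro f hf hpf
    obtain ⟨g, hg, hle⟩ := hcover f hf hpf
    rcases List.mem_append.1 hg with hg | hg
    · exact ⟨g, by simp [hg], hle⟩
    · rcases hHK g hg with hg | hg
      · obtain ⟨g', hg', e⟩ := hforth g hg
        exact ⟨g', by simp [hg'], e ▸ hle⟩
      · exact ⟨g, by simp [hg], hle⟩
  -- An element of least degree leaves the list in every pass.
  · obtain ⟨g, hg, hgd⟩ := hdmem
    exact List.length_filter_lt_length_iff_exists.2 ⟨g, hg, by simp [hgd]⟩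

theorem exists_mem_initReducedStdBasis [IsNoetherianRing R] (hp : Prime p)
    (hI : toSer (cst p - tVar) ∈ I)
    (hunit : ∀ c : R, ¬ p ∣ c → ∃ a b, a * c + b * p = 1) (htop : I ≠ ⊤) (σ : Choices R n p)
    {L : List (Poly R n)} (hL : IsXHomStdBasis o I L) :
    ∃ G, IsReducedCore o p I G ∧ G ++ [cst p - tVar] ∈ initReducedStdBasis o p σ L := by
  classical
  obtain ⟨hhom, -, hsub, hlead⟩ := hL
  have hmem : ∀ g ∈ L, toSer g ∈ I := fun g hg => hsub ⟨g, hg, rfl⟩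
  obtain ⟨hpre, hcov⟩ := normalise_spec (o := o) hI hunit σ hhom hmem
  obtain ⟨m1, m2, m3⟩ := minimise_spec (o := o) (normalise o p σ L) [] List.Pairwise.nil (by simp)
  have start : MainInv o p I ([], minimise o [] (normalise o p σ L)) := by
    refine ⟨by simp, by simp, fun g hg => hpre g (by simpa using m1 g hg), m2, by simp,
      fun f hf hpf => ?_⟩
    -- For p not dividing lc(f), the standard basis has an element whose leading coefficient is
    -- prime to p and whose leading monomial divides lm(f). So nothing is lost by dropping the
    -- elements with p ∣ lc(g).
    have h1 : lt o f ∈ leadIdeal o (serSet L) := hlead ▸ Ideal.subset_span ⟨f, hf, rfl⟩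
    obtain ⟨s, ⟨g, hg, rfl⟩, hpg, hle⟩ := exists_lm_le_of_mem_leadIdeal (p := p) h1 (m := lm o f)
      (by rwa [lt, pc_term_self])
    obtain ⟨g', hg', e⟩ := hcov g hg hpg
    obtain ⟨g'', hg'', hle'⟩ := m3 g' (by simpa using hg')
    refine ⟨g'', by simpa using hg'', hle'.trans ?_⟩
    rw [show plm o g' = plm o g from e]
    exact hle
  suffices hloop : ∀ s, MainInv o p I s → ∃ x ∈ mainBody o p σ s,
      (∃ G, x = Sum.inl G ∧ MainInv o p I (G, [])) ∨
      ∃ s', x = Sum.inr s' ∧ MainInv o p I s' ∧ s'.2.length < s.2.length by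
    obtain ⟨G, hG, inv⟩ := exists_mem_fix (f := mainBody o p σ)
      (measure fun s : List (Poly R n) × List (Poly R n) => s.2.length).wf hloop _ start
    refine ⟨G, ⟨fun g hg => ?_, fun g hg => ?_, fun g hg => ?_, fun g hg => ?_, fun g hg => ?_,
      inv.red, fun f hf hpf => by simpa using inv.cover f hf hpf⟩, ?_⟩
    · obtain ⟨d, h⟩ := inv.good g hg
      exact ⟨d, h.hom⟩
    · obtain ⟨d, h⟩ := inv.good g hg
      exact h.mem
    · obtain ⟨d, h⟩ := inv.good g hg
      exact h.monic
    · obtain ⟨d, h⟩ := inv.good g hg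
      exact h.plm_ne_zero htop
    · obtain ⟨d, h⟩ := inv.good g hg
      exact h.clean
    · simp only [initReducedStdBasis, Part.bind_eq_bind, Part.mem_bind_iff]
      exact ⟨G, hG, Part.mem_some _⟩
  intro s inv
  by_cases hs : s.2 = []
  · refine ⟨Sum.inl s.1, ?_, Or.inl ⟨s.1, rfl, ?_⟩⟩
    · simp only [mainBody, hs, if_true]
      exact Part.mem_some _
    · rw [← hs]; exact inv
  · obtain ⟨s', h1, h2, h3⟩ := inv.step hp hI σ hs
    exact ⟨_, h1, Or.inr ⟨s', rfl, h2, h3⟩⟩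

end Algorithm

/-! ## Existence of polynomial standard bases -/

section Homogeneous
variable {A : Type*} [CommRing A] {n : ℕ}

theorem homogeneousComponent_mem_span {B : Set (MvPolynomial (Fin n) A)}
    (hB : ∀ b ∈ B, ∃ d, b.IsHomogeneous d) {f : MvPolynomial (Fin n) A} (hf : f ∈ Ideal.span B)
    (d : ℕ) : MvPolynomial.homogeneousComponent d f ∈ Ideal.span B := by
  let _ := MvPolynomial.gradedAlgebra (σ := Fin n) (R := A)
  have h := Ideal.homogeneous_span (MvPolynomial.homogeneousSubmodule (Fin n) A) B
    fun b hb => by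
      obtain ⟨d, hd⟩ := hB b hb
      exact ⟨d, (MvPolynomial.mem_homogeneousSubmodule d b).2 hd⟩
  have := h d hf
  rwa [← MvPolynomial.decomposition.decompose'_apply]

theorem coeff_homogeneousComponent_eq (d : ℕ) (f : MvPolynomial (Fin n) A) (α : Fin n →₀ ℕ) :
    MvPolynomial.coeff α (MvPolynomial.homogeneousComponent d f) =
      if α.degree = d then MvPolynomial.coeff α f else 0 := by
  rw [MvPolynomial.coeff_homogeneousComponent]

end Homogeneous

section Existence
variable {R : Type u} [CommRing R] {n : ℕ} {o : TLocalOrder n}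

theorem idealOf_eq (F : List (Poly R n)) : idealOf F = Ideal.span (toSer '' {g | g ∈ F}) := by
  rw [idealOf]
  congr 1
  ext s
  simp only [serSet, Set.mem_ofPred_eq, Set.mem_image, eq_comm]

theorem toSer_mem_span {B : Set (Poly R n)} {f : Poly R n} (hf : f ∈ Ideal.span B) :
    toSer f ∈ Ideal.span (toSer '' B : Set (Ser R n)) := by
  rw [← Ideal.map_span]
  exact Ideal.mem_map_of_mem _ hf

theorem isHomogeneous_toSer {f : Poly R n} {d : ℕ} (hf : f.IsHomogeneous d) :
    (toSer f).IsHomogeneous d := hf.map _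

theorem coe_X_pow_dvd_iff {k : ℕ} {a : Polynomial R} :
    (PowerSeries.X ^ k : PowerSeries R) ∣ (a : PowerSeries R) ↔ X ^ k ∣ a := by
  rw [PowerSeries.X_pow_dvd_iff, Polynomial.X_pow_dvd_iff]
  simp only [Polynomial.coeff_coe]

theorem exists_toSer_approx (a : Ser R n) (N : ℕ) :
    ∃ a' : Poly R n, MvPolynomial.C (PowerSeries.X ^ N) ∣ a - toSer a' := by
  induction a using MvPolynomial.induction_on with
  | C φ =>
    refine ⟨MvPolynomial.C (PowerSeries.trunc N φ), ?_⟩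
    have : (toSer (MvPolynomial.C (PowerSeries.trunc N φ)) : Ser R n) =
        MvPolynomial.C ((PowerSeries.trunc N φ : Polynomial R) : PowerSeries R) := by
      rw [toSer, MvPolynomial.map_C]; rfl
    rw [this, ← map_sub]
    refine map_dvd _ (PowerSeries.X_pow_dvd_iff.2 fun m hm => ?_)
    rw [map_sub, Polynomial.coeff_coe, PowerSeries.coeff_trunc, if_pos hm, sub_self]
  | add a b ha hb =>
    obtain ⟨a', ha⟩ := ha
    obtain ⟨b', hb⟩ := hb
    refine ⟨a' + b', ?_⟩
    have := dvd_add ha hb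
    rwa [sub_add_sub_comm, ← map_add] at this
  | mul_X a i ha =>
    obtain ⟨a', ha⟩ := ha
    refine ⟨a' * MvPolynomial.X i, ?_⟩
    have : toSer (a' * MvPolynomial.X i) = (toSer a' * MvPolynomial.X i : Ser R n) := by
      rw [map_mul, toSer, MvPolynomial.map_X]
    rw [this, ← sub_mul]
    exact ha.mul_right _

/-- Truncate the power series coefficients in a representation of f by B. -/
theorem exists_approx_of_mem_span {B : Set (Poly R n)} {f : Ser R n}
    (hf : f ∈ Ideal.span (toSer '' B)) (N : ℕ) :
    ∃ f' ∈ Ideal.span B, MvPolynomial.C (PowerSeries.X ^ N) ∣ f - toSer f' := by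
  induction hf using Submodule.span_induction with
  | mem s hs =>
    obtain ⟨b, hb, rfl⟩ := hs
    exact ⟨b, Ideal.subset_span hb, by simp⟩
  | zero => exact ⟨0, Ideal.zero_mem _, by simp⟩
  | add f g _ _ hf hg =>
    obtain ⟨f', hf', hf⟩ := hf
    obtain ⟨g', hg', hg⟩ := hg
    refine ⟨f' + g', Ideal.add_mem _ hf' hg', ?_⟩
    have := dvd_add hf hg
    rwa [sub_add_sub_comm, ← map_add] at this
  | smul a f _ hf =>
    obtain ⟨f', hf', hf⟩ := hf
    obtain ⟨a', ha⟩ := exists_toSer_approx a N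
    refine ⟨a' * f', Ideal.mul_mem_left _ _ hf', ?_⟩
    have := dvd_add (hf.mul_left a) (ha.mul_right (toSer f'))
    have e : a * (f - toSer f') + (a - toSer a') * toSer f' = a • f - toSer (a' * f') := by
      rw [map_mul, smul_eq_mul]; ring
    rwa [e] at this

/-- A homogeneous element of an ideal generated by homogeneous polynomials has the same leading
term as some homogeneous polynomial in the ideal. -/
theorem exists_poly_of_isHomogeneous [IsNoetherianRing R] {B : Set (Poly R n)}
    (hB : ∀ b ∈ B, XHomogeneous b) {f : Ser R n} (hf : f ∈ Ideal.span (toSer '' B)) {d : ℕ}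
    (hd : f.IsHomogeneous d) (hf0 : f ≠ 0) :
    ∃ f' ∈ Ideal.span B, f'.IsHomogeneous d ∧ lt o (toSer f') = lt o f := by
  classical
  -- These are the x-monomials of degree d that f does not contain. They must vanish exactly in the
  -- polynomial, since for a general t-local ordering a high power of t does not make t^N x^α small.
  let U : Set (Fin n →₀ ℕ) := {α | α.degree = d ∧ MvPolynomial.coeff α f = 0}
  have hU : Finite U := ((xMonomials n d).finite_toSet.subset fun α hα =>
    mem_xMonomials.2 hα.1).to_subtype
  let ρ : Poly R n →ₗ[Polynomial R] (U → Polynomial R) :=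
    LinearMap.pi fun α => MvPolynomial.lcoeff (Polynomial R) (α : Fin n →₀ ℕ)
  have hρ : ∀ g α, ρ g α = MvPolynomial.coeff (α : Fin n →₀ ℕ) g := fun g α => rfl
  let 𝔞 : Submodule (Polynomial R) (Poly R n) :=
    (Ideal.span B).restrictScalars (Polynomial R) ⊓
      MvPolynomial.homogeneousSubmodule (Fin n) (Polynomial R) d
  -- Artin–Rees for the projection of the degree d part of ⟨B⟩ to the coordinates in U: elements
  -- divisible by t^(K + k) are t^K times elements of the projection.
  obtain ⟨k, hk⟩ := Ideal.exists_pow_inf_eq_pow_smul (Ideal.span {(X : Polynomial R)})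
    (𝔞.map ρ)
  -- Agreement modulo t^K determines the initial terms at all x-monomials that occur in f.
  obtain ⟨K, hK⟩ : ∃ K, ∀ α ∈ f.support, (MvPolynomial.coeff α f).order.toNat < K := by
    refine ⟨f.support.sup (fun α => (MvPolynomial.coeff α f).order.toNat) + 1, fun α hα => ?_⟩
    exact Nat.lt_succ_of_le
      (Finset.le_sup (f := fun α => (MvPolynomial.coeff α f).order.toNat) hα)
  obtain ⟨h', hh', hdvd⟩ := exists_approx_of_mem_span hf (K + k)
  set h := MvPolynomial.homogeneousComponent d h' with hh
  have hmem : h ∈ Ideal.span B := homogeneousComponent_mem_span hB hh' d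
  have hhom : h.IsHomogeneous d := MvPolynomial.homogeneousComponent_isHomogeneous _ _
  have hcoeff : ∀ α, PowerSeries.X ^ (K + k) ∣
      MvPolynomial.coeff α f - ((MvPolynomial.coeff α h : Polynomial R) : PowerSeries R) := by
    intro α
    by_cases hα : α.degree = d
    · have := (MvPolynomial.C_dvd_iff_dvd_coeff _ _).1 hdvd α
      rw [MvPolynomial.coeff_sub, coeff_toSer] at this
      rwa [hh, coeff_homogeneousComponent_eq, if_pos hα]
    · have h1 : MvPolynomial.coeff α f = 0 := by
        by_contra h1; exact hα (isHomogeneous_iff.1 hd α h1)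
      rw [h1, hh, coeff_homogeneousComponent_eq, if_neg hα]
      simp
  have h1 : ρ h ∈ (Ideal.span {(X : Polynomial R)} ^ (K + k) • ⊤ ⊓ 𝔞.map ρ :
      Submodule (Polynomial R) (U → Polynomial R)) := by
    refine ⟨?_, ⟨h, ⟨hmem, hhom⟩, rfl⟩⟩
    have h2 : ∀ α : U, (X ^ (K + k) : Polynomial R) ∣ MvPolynomial.coeff (α : Fin n →₀ ℕ) h := fun α => by
      have := hcoeff α
      rw [α.2.2, zero_sub, dvd_neg, coe_X_pow_dvd_iff] at this
      exact this
    choose w hw using h2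
    have : ρ h = (X ^ (K + k) : Polynomial R) • w := by
      ext1 α
      rw [hρ, hw α]; rfl
    rw [this]
    exact Submodule.smul_mem_smul
      (Ideal.pow_mem_pow (Ideal.mem_span_singleton_self _) _) Submodule.mem_top
  rw [hk (K + k) (Nat.le_add_left _ _), Nat.add_sub_cancel, Ideal.span_singleton_pow,
    Submodule.ideal_span_singleton_smul, Submodule.mem_smul_pointwise_iff_exists] at h1
  obtain ⟨y, ⟨-, w, ⟨hw, hwd⟩, rfl⟩, hy⟩ := h1
  -- The correction t^K w cancels the coordinates in U and changes nothing modulo t^K.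
  set f' : Poly R n := h - (X ^ K : Polynomial R) • w with hf'
  have hf'mem : f' ∈ Ideal.span B := by
    refine Ideal.sub_mem _ hmem ?_
    rw [MvPolynomial.smul_eq_C_mul]
    exact Ideal.mul_mem_left _ _ hw
  have hf'hom : f'.IsHomogeneous d := hhom.sub (Submodule.smul_mem _ _ hwd)
  have hzero : ∀ α, MvPolynomial.coeff α f = 0 → MvPolynomial.coeff α f' = 0 := by
    intro α hα
    by_cases hαd : α.degree = d
    · have := congrFun hy ⟨α, hαd, hα⟩
      simp only [Pi.smul_apply, hρ] at this
      rw [hf', MvPolynomial.coeff_sub, MvPolynomial.coeff_smul, this, sub_self]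
    · by_contra h1; exact hαd (isHomogeneous_iff.1 hf'hom α h1)
  have hclose : ∀ m : Mon n, m.1 < K → coeffAt m f = pc m f' := by
    intro m hm
    have h2 : PowerSeries.X ^ K ∣
        MvPolynomial.coeff m.2 f - ((MvPolynomial.coeff m.2 f' : Polynomial R) : PowerSeries R) := by
      have e : MvPolynomial.coeff m.2 f - ((MvPolynomial.coeff m.2 f' : Polynomial R) :
          PowerSeries R) = (MvPolynomial.coeff m.2 f -
            ((MvPolynomial.coeff m.2 h : Polynomial R) : PowerSeries R)) +
          ((X ^ K * MvPolynomial.coeff m.2 w : Polynomial R) : PowerSeries R) := by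
        rw [hf', MvPolynomial.coeff_sub, MvPolynomial.coeff_smul, smul_eq_mul,
          Polynomial.coe_sub]
        ring
      rw [e]
      exact dvd_add ((pow_dvd_pow _ (Nat.le_add_right _ _)).trans (hcoeff m.2))
        (coe_X_pow_dvd_iff.2 (dvd_mul_right _ _))
    have := PowerSeries.X_pow_dvd_iff.1 h2 m.1 hm
    rw [map_sub, sub_eq_zero, Polynomial.coeff_coe] at this
    exact this
  have hord : ∀ α, MvPolynomial.coeff α f ≠ 0 →
      coeffAt ((MvPolynomial.coeff α f).order.toNat, α) f ≠ 0 := fun α hα =>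
    PowerSeries.coeff_order hα
  have hlead := isLeadMon_lm o f hf0
  set m := lm o f with hm
  have hfm : MvPolynomial.coeff m.2 f ≠ 0 := by
    intro h0
    exact hlead.1 (by simp [coeffAt, h0])
  have hmK : m.1 < K := by
    refine lt_of_le_of_lt ?_ (hK m.2 (MvPolynomial.mem_support_iff.2 hfm))
    rcases hlead.2 _ (hord _ hfm) with h2 | h2
    · rw [← h2]
    · exact ((o.t_lt_iff m.2).1 h2).le
  have hlead' : IsLeadMon o (toSer f') m := by
    refine ⟨by rw [coeffAt_toSer, ← hclose m hmK]; exact hlead.1, fun m' hm' => ?_⟩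
    rw [coeffAt_toSer] at hm'
    have hα : MvPolynomial.coeff m'.2 f ≠ 0 := fun h0 => by
      apply hm'
      rw [pc, hzero _ h0, Polynomial.coeff_zero]
    have hle : (MvPolynomial.coeff m'.2 f).order.toNat ≤ m'.1 := by
      by_contra! hlt
      have h3 := hclose m' (hlt.trans (hK _ (MvPolynomial.mem_support_iff.2 hα)))
      rw [← h3] at hm'
      exact hm' (PowerSeries.coeff_of_lt_order_toNat _ hlt)
    have h4 := hlead.2 _ (hord _ hα)
    rcases hle.eq_or_lt with h5 | h5
    · rwa [show m' = ((MvPolynomial.coeff m'.2 f).order.toNat, m'.2) from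
        Prod.ext h5.symm rfl]
    · right
      have h6 : o.lt m' ((MvPolynomial.coeff m'.2 f).order.toNat, m'.2) := o.lt_of_t_lt m'.2 h5
      rcases h4 with h4 | h4
      · rwa [h4] at h6
      · exact TLocalOrder.lt_trans h6 h4
  refine ⟨f', hf'mem, hf'hom, ?_⟩
  rw [lt, lt, hlead'.lm_eq, lc, lc, hlead'.lm_eq, coeffAt_toSer, ← hclose m hmK]

theorem lt_homogeneousComponent (f : Ser R n) :
    lt o (MvPolynomial.homogeneousComponent (lm o f).2.degree f) = lt o f := by
  by_cases hf : f = 0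
  · simp [hf]
  have hlead := isLeadMon_lm o f hf
  set m := lm o f with hm
  have hc : ∀ m', coeffAt m' (MvPolynomial.homogeneousComponent m.2.degree f) =
      if m'.2.degree = m.2.degree then coeffAt m' f else 0 := fun m' => by
    rw [coeffAt, coeff_homogeneousComponent_eq]
    split_ifs <;> simp [coeffAt]
  have hlead' : IsLeadMon o (MvPolynomial.homogeneousComponent m.2.degree f) m := by
    refine ⟨by rw [hc, if_pos rfl]; exact hlead.1, fun m' hm' => hlead.2 m' ?_⟩
    rw [hc] at hm'
    split_ifs at hm' with h
    · exact hm'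
    · exact absurd rfl hm'
  rw [lt, lt, hlead'.lm_eq, lc, lc, hlead'.lm_eq, hc, if_pos rfl]

theorem exists_poly_lt_eq [IsNoetherianRing R] {B : Set (Poly R n)}
    (hB : ∀ b ∈ B, XHomogeneous b) {f : Ser R n} (hf : f ∈ Ideal.span (toSer '' B)) :
    ∃ f' ∈ Ideal.span B, XHomogeneous f' ∧ lt o (toSer f') = lt o f := by
  by_cases hf0 : f = 0
  · exact ⟨0, Ideal.zero_mem _, ⟨0, MvPolynomial.isHomogeneous_zero _ _ _⟩, by simp [hf0]⟩
  set f₁ := MvPolynomial.homogeneousComponent (lm o f).2.degree f with hf₁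
  have hlt : lt o f₁ = lt o f := lt_homogeneousComponent f
  have hmem : f₁ ∈ Ideal.span (toSer '' B) := by
    refine homogeneousComponent_mem_span ?_ hf _
    rintro _ ⟨b, hb, rfl⟩
    obtain ⟨d, hd⟩ := hB b hb
    exact ⟨d, isHomogeneous_toSer hd⟩
  have h0 : f₁ ≠ 0 := by
    intro h0
    rw [h0, lt_zero] at hlt
    have := congrArg (pc (lm o f)) hlt
    rw [lt, pc_term_self, pc_zero] at this
    exact lc_ne_zero o hf0 this.symm
  obtain ⟨f', h1, h2, h3⟩ := exists_poly_of_isHomogeneous (o := o) hB hmem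
    (MvPolynomial.homogeneousComponent_isHomogeneous _ _) h0
  exact ⟨f', h1, ⟨_, h2⟩, h3.trans hlt⟩

/-- The leading ideal lives in the noetherian ring R[t, x], so finitely many leading terms of
elements of I generate it; each is realised by an x-homogeneous polynomial. -/
theorem exists_isXHomStdBasis [IsNoetherianRing R] (o : TLocalOrder n) {F : List (Poly R n)}
    (hF : ∀ f ∈ F, XHomogeneous f) : ∃ G, IsXHomStdBasis o (idealOf F) G := by
  classical
  obtain ⟨S, hS, hspan⟩ := (Submodule.fg_span_iff_fg_span_finset_subset
    (lt o '' (idealOf F : Set (Ser R n)))).1 (IsNoetherian.noetherian (leadIdeal o _))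
  have h : ∀ s, s ∈ S → ∃ g : Poly R n, toSer g ∈ idealOf F ∧ XHomogeneous g ∧
      lt o (toSer g) = s := by
    intro s hs
    obtain ⟨f, hf, rfl⟩ := hS hs
    rw [SetLike.mem_coe, idealOf_eq] at hf
    obtain ⟨g, h1, h2, h3⟩ := exists_poly_lt_eq (o := o) hF hf
    exact ⟨g, by rw [idealOf_eq]; exact toSer_mem_span h1, h2, h3⟩
  choose! g h1 h2 h3 using h
  have hmem : ∀ x, x ∈ serSet (S.toList.map g) ↔ ∃ s ∈ S, x = toSer (g s) := fun x => by
    simp only [serSet, List.mem_map, Finset.mem_toList, Set.mem_ofPred_eq]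
    constructor
    · rintro ⟨_, ⟨s, hs, rfl⟩, rfl⟩
      exact ⟨s, hs, rfl⟩
    · rintro ⟨s, hs, rfl⟩
      exact ⟨_, ⟨s, hs, rfl⟩, rfl⟩
  refine ⟨S.toList.map g, fun x hx => ?_, ?_, ?_, ?_⟩
  · obtain ⟨s, hs, rfl⟩ := List.mem_map.1 hx
    exact h2 s (by simpa using hs)
  · refine (S.finite_toSet.image fun s => toSer (g s)).subset fun x hx => ?_
    obtain ⟨s, hs, rfl⟩ := (hmem x).1 hx
    exact ⟨s, hs, rfl⟩
  · intro x hx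
    obtain ⟨s, hs, rfl⟩ := (hmem x).1 hx
    exact h1 s hs
  · have e : lt o '' serSet (S.toList.map g) = S := by
      ext s
      constructor
      · rintro ⟨x, hx, rfl⟩
        obtain ⟨s, hs, rfl⟩ := (hmem x).1 hx
        rw [h3 s hs]
        exact hs
      · intro hs
        exact ⟨_, (hmem _).2 ⟨s, hs, rfl⟩, h3 s hs⟩
    rw [leadIdeal, e]
    exact hspan.symm

end Existence

/-! ## Evaluation at `t = p` -/

section Evaluation
variable {R : Type u} [CommRing R] {n : ℕ}

/-- The substitution `t ↦ p`. -/
def evalT (p : R) : Poly R n →+* MvPolynomial (Fin n) R :=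
  MvPolynomial.map (Polynomial.evalRingHom p)

theorem coeff_evalT (p : R) (g : Poly R n) (α : Fin n →₀ ℕ) :
    MvPolynomial.coeff α (evalT p g) = (MvPolynomial.coeff α g).eval p := by
  rw [evalT, MvPolynomial.coeff_map, Polynomial.coe_evalRingHom]

theorem evalT_C (p : R) (a : Polynomial R) :
    evalT p (MvPolynomial.C a : Poly R n) = MvPolynomial.C (a.eval p) := by
  rw [evalT, MvPolynomial.map_C, Polynomial.coe_evalRingHom]

theorem evalT_term (p : R) (m : Mon n) (c : R) :
    evalT p (term m c) = MvPolynomial.monomial m.2 (c * p ^ m.1) := by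
  rw [evalT, term, MvPolynomial.map_monomial, Polynomial.coe_evalRingHom,
    Polynomial.eval_monomial]

theorem evalT_lift (p : R) (s : MvPolynomial (Fin n) R) :
    evalT p (MvPolynomial.map Polynomial.C s) = s := by
  ext α
  rw [coeff_evalT, MvPolynomial.coeff_map, Polynomial.eval_C]

theorem evalT_surjective (p : R) : Function.Surjective (evalT p : Poly R n →+* _) :=
  fun s => ⟨_, evalT_lift p s⟩

theorem pMinusT_dvd_of_eval_eq_zero {p : R} {a : Polynomial R} (h : a.eval p = 0) :
    pMinusT p ∣ a := by
  rw [pMinusT, ← neg_sub, neg_dvd]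
  exact Polynomial.dvd_iff_isRoot.2 h

theorem evalT_eq_zero_iff {p : R} {g : Poly R n} :
    evalT p g = 0 ↔ (cst p - tVar : Poly R n) ∣ g := by
  rw [cst_sub_tVar]
  constructor
  · intro h
    refine (MvPolynomial.C_dvd_iff_dvd_coeff _ _).2 fun α => pMinusT_dvd_of_eval_eq_zero ?_
    rw [← coeff_evalT, h, MvPolynomial.coeff_zero]
  · rintro ⟨w, rfl⟩
    rw [map_mul, evalT_C, eval_pMinusT, map_zero, zero_mul]

theorem isHomogeneous_evalT {p : R} {g : Poly R n} {d : ℕ} (h : g.IsHomogeneous d) :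
    (evalT p g).IsHomogeneous d := h.map _

/-- An ideal containing `p - t` is the preimage of its image under `t ↦ p`. -/
theorem mem_of_evalT_mem {p : R} {J : Ideal (Poly R n)} (hJ : (cst p - tVar : Poly R n) ∈ J)
    {f : Poly R n} (h : evalT p f ∈ J.map (evalT p)) : f ∈ J := by
  obtain ⟨g, hg, he⟩ := (Ideal.mem_map_iff_of_surjective _ (evalT_surjective p)).1 h
  have : evalT p (f - g) = 0 := by rw [map_sub, he, sub_self]
  have := Ideal.mem_of_dvd J (evalT_eq_zero_iff.1 this) hJ
  simpa using Ideal.add_mem _ this hg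

/-- Only the constant coefficient of s contributes to degree d. This turns a multiplier in R[x] into
a scalar. -/
theorem homogeneousComponent_mul_of_isHomogeneous {A : Type*} [CommRing A]
    (s : MvPolynomial (Fin n) A) {f : MvPolynomial (Fin n) A} {d : ℕ} (hf : f.IsHomogeneous d) :
    MvPolynomial.homogeneousComponent d (s * f) = MvPolynomial.C (MvPolynomial.coeff 0 s) * f := by
  let _ := MvPolynomial.gradedAlgebra (σ := Fin n) (R := A)
  have h := DirectSum.coe_decompose_mul_of_right_mem_of_le
    (𝒜 := MvPolynomial.homogeneousSubmodule (Fin n) A) (a := s)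
    ((MvPolynomial.mem_homogeneousSubmodule d f).2 hf) le_rfl
  rw [Nat.sub_self] at h
  rw [← MvPolynomial.homogeneousComponent_zero,
    ← MvPolynomial.decomposition.decompose'_apply, ← MvPolynomial.decomposition.decompose'_apply]
  exact h

/-- The polynomials in the ideal of `R⟦t⟧[x]` generated by homogeneous polynomials, among which
`p - t`, are up to a factor `1 - t r` in the ideal of `R[t, x]` that they generate. -/
theorem exists_mul_mem_span [IsNoetherianRing R] {p : R} {B : Set (Poly R n)}
    (hB : ∀ b ∈ B, XHomogeneous b) (hpt : cst p - tVar ∈ B) {f : Poly R n} (hf : XHomogeneous f)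
    (h : toSer f ∈ Ideal.span (toSer '' B)) :
    ∃ r : Polynomial R, f - MvPolynomial.C (X * r) * f ∈ Ideal.span B := by
  obtain ⟨d, hd⟩ := hf
  set 𝔟 := (Ideal.span B).map (evalT p) with h𝔟
  let I : Ideal (MvPolynomial (Fin n) R) := Ideal.span {MvPolynomial.C p}
  -- Approximation modulo t^N becomes approximation modulo p^N at t = p, so the class of f lies in
  -- every power of ⟨p⟩ times the quotient.
  have h1 : Ideal.Quotient.mk 𝔟 (evalT p f) ∈
      (⨅ i : ℕ, I ^ i • ⊤ : Submodule (MvPolynomial (Fin n) R) (_ ⧸ 𝔟)) := by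
    refine (Submodule.mem_iInf _).2 fun N => ?_
    obtain ⟨f', hf', hdvd⟩ := exists_approx_of_mem_span h N
    have h2 : MvPolynomial.C (X ^ N) ∣ f - f' := by
      refine (MvPolynomial.C_dvd_iff_dvd_coeff _ _).2 fun α => ?_
      have := (MvPolynomial.C_dvd_iff_dvd_coeff _ _).1 hdvd α
      rwa [← map_sub, coeff_toSer, coe_X_pow_dvd_iff] at this
    obtain ⟨w, hw⟩ := h2
    have h3 : evalT p f = evalT p f' + MvPolynomial.C p ^ N * evalT p w := by
      rw [← sub_eq_iff_eq_add', ← map_sub, hw, map_mul, evalT_C, Polynomial.eval_pow,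
        Polynomial.eval_X, map_pow]
    have h4 : Ideal.Quotient.mk 𝔟 (evalT p f) =
        (MvPolynomial.C p ^ N : MvPolynomial (Fin n) R) • Ideal.Quotient.mk 𝔟 (evalT p w) := by
      rw [h3, map_add, Ideal.Quotient.eq_zero_iff_mem.2 (Ideal.mem_map_of_mem _ hf'), zero_add,
        map_mul]
      rfl
    rw [h4]
    exact Submodule.smul_mem_smul
      (Ideal.pow_mem_pow (Ideal.mem_span_singleton_self _) _) Submodule.mem_top
  -- Krull's intersection theorem: some multiple s p of p acts on this class as the identity. It
  -- lifts to s t, because p - t lies in the ideal.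
  obtain ⟨⟨r, hr⟩, hrf⟩ := (Ideal.mem_iInf_smul_pow_eq_bot_iff I _).1 h1
  obtain ⟨s, rfl⟩ := Ideal.mem_span_singleton'.1 hr
  have h2 : evalT p (f - MvPolynomial.C X * MvPolynomial.map Polynomial.C s * f) ∈ 𝔟 := by
    rw [map_sub, map_mul, map_mul, evalT_lift, evalT_C, Polynomial.eval_X,
      ← Ideal.Quotient.eq_zero_iff_mem, map_sub, sub_eq_zero, map_mul, mul_comm _ s]
    exact hrf.symm
  have h3 := homogeneousComponent_mem_span hB
    (mem_of_evalT_mem (Ideal.subset_span hpt) h2) d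
  refine ⟨MvPolynomial.coeff 0 (MvPolynomial.map Polynomial.C s), ?_⟩
  rw [map_sub, homogeneousComponent_mul_of_isHomogeneous _ hd, MvPolynomial.coeff_C_mul] at h3
  rwa [(MvPolynomial.homogeneousComponent_of_mem ((MvPolynomial.mem_homogeneousSubmodule _ _).2 hd)),
    if_pos rfl] at h3

end Evaluation

/-! ## Leading monomials with respect to the `p`-adic valuation -/

section Valuation
variable {R : Type u} [CommRing R] {n : ℕ} {o : TLocalOrder n} {p : R}

/-- `m` is the greatest monomial `t^k x^α` for which `p ^ (k + 1)` does not divide the coefficient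
of `x^α` in `c`. -/
def IsVLead (o : TLocalOrder n) (p : R) (c : MvPolynomial (Fin n) R) (m : Mon n) : Prop :=
  ¬ p ^ (m.1 + 1) ∣ MvPolynomial.coeff m.2 c ∧
    ∀ m', o.lt m m' → p ^ (m'.1 + 1) ∣ MvPolynomial.coeff m'.2 c

variable {c : MvPolynomial (Fin n) R} {m : Mon n}

theorem IsVLead.eq {m' : Mon n} (h : IsVLead o p c m) (h' : IsVLead o p c m') : m = m' := by
  rcases o.lt_trichotomy m m' with h1 | h1 | h1
  · exact absurd (h.2 _ h1) h'.1
  · exact h1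
  · exact absurd (h'.2 _ h1) h.1

theorem IsVLead.not_lt (h : IsVLead o p c m) {k : ℕ} {α : Fin n →₀ ℕ}
    (hk : ¬ p ^ (k + 1) ∣ MvPolynomial.coeff α c) : ¬ o.lt m (k, α) :=
  fun hlt => hk (h.2 (k, α) hlt)

theorem IsVLead.pow_dvd (h : IsVLead o p c m) : p ^ m.1 ∣ MvPolynomial.coeff m.2 c := by
  rcases m with ⟨_ | k, α⟩
  · simp
  · exact h.2 (k, α) (o.lt_of_t_lt α (Nat.lt_succ_self k))

theorem eq_zero_of_forall_pow_dvd [IsDomain R] [IsNoetherianRing R] (hp : Prime p) {a : R}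
    (h : ∀ k, p ^ k ∣ a) : a = 0 := by
  by_contra h0
  exact (FiniteMultiplicity.of_not_isUnit hp.not_isUnit h0).not_pow_dvd_of_multiplicity_lt
    (Nat.lt_succ_self _) (h _)

theorem exists_isVLead [IsDomain R] [IsNoetherianRing R] (hp : Prime p) (hc : c ≠ 0) :
    ∃ m, IsVLead o p c m := by
  let Ω : Set (Mon n) := {m | ¬ p ^ (m.1 + 1) ∣ MvPolynomial.coeff m.2 c}
  have hne : Ω.Nonempty := by
    by_contra hΩ
    refine hc (MvPolynomial.ext _ _ fun α => ?_)
    rw [MvPolynomial.coeff_zero]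
    refine eq_zero_of_forall_pow_dvd hp fun k => ?_
    by_contra hk
    refine hΩ ⟨(k, α), fun h => hk ((pow_dvd_pow p (Nat.le_succ k)).trans h)⟩
  obtain ⟨m, hm, hmax⟩ := o.exists_greatest c.support Ω hne fun m hm => by
    rw [MvPolynomial.mem_support_iff]
    intro h0
    exact hm (h0 ▸ dvd_zero _)
  refine ⟨m, hm, fun m' hlt => ?_⟩
  by_contra h
  exact hmax m' h hlt

theorem IsVLead.monomial_mul (h : IsVLead o p c m) (γ : Fin n →₀ ℕ) :
    IsVLead o p (MvPolynomial.monomial γ 1 * c) (m + (0, γ)) := by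
  constructor
  · have : MvPolynomial.coeff (m + (0, γ)).2 (MvPolynomial.monomial γ 1 * c) =
        MvPolynomial.coeff m.2 c := by
      rw [Prod.snd_add, add_comm, MvPolynomial.coeff_monomial_mul, one_mul]
    rw [this]
    exact h.1
  · rintro ⟨k, α⟩ hlt
    rw [MvPolynomial.coeff_monomial_mul']
    split_ifs with hle
    · rw [one_mul]
      refine h.2 (k, α - γ) ?_
      rw [← o.add_lt_add_iff (0, γ)]
      rwa [show ((k, α - γ) : Mon n) + (0, γ) = (k, α) from
        Prod.ext rfl (tsub_add_cancel_of_le hle)]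
    · exact dvd_zero _

theorem IsVLead.smul_pow [IsDomain R] (hp : Prime p) (h : IsVLead o p c m) {u : R}
    (hu : ¬ p ∣ u) (k : ℕ) : IsVLead o p ((p ^ k * u) • c) (m + (k, 0)) := by
  constructor
  · simp only [Prod.fst_add, Prod.snd_add, add_zero, MvPolynomial.coeff_smul, smul_eq_mul]
    rw [show m.1 + k + 1 = k + (m.1 + 1) by ring, pow_add, mul_assoc,
      mul_dvd_mul_iff_left (pow_ne_zero _ hp.ne_zero)]
    exact fun h' => h.1 (hp.pow_dvd_of_dvd_mul_left _ hu h')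
  · rintro ⟨j, α⟩ hlt
    simp only [MvPolynomial.coeff_smul, smul_eq_mul]
    rw [mul_assoc]
    rcases lt_or_ge j k with hjk | hjk
    · exact (pow_dvd_pow p hjk).mul_right _
    · obtain ⟨i, rfl⟩ := Nat.exists_eq_add_of_le hjk
      rw [add_assoc, pow_add]
      refine mul_dvd_mul_left _ (Dvd.dvd.mul_left (h.2 (i, α) ?_) _)
      rw [← o.add_lt_add_iff (k, 0)]
      rwa [show ((i, α) : Mon n) + (k, 0) = (k + i, α) from
        Prod.ext (add_comm i k) (add_zero α)]

theorem IsVLead.smul [IsDomain R] (hp : Prime p) (h : IsVLead o p c m) {u : R}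
    (hu : ¬ p ∣ u) : IsVLead o p (u • c) m := by
  have := h.smul_pow hp hu 0
  rwa [pow_zero, one_mul, show m + (0, 0) = m from add_zero m] at this

theorem IsVLead.sub (h : IsVLead o p c m) {c' : MvPolynomial (Fin n) R}
    (hc' : ∀ m', ¬ o.lt m' m → p ^ (m'.1 + 1) ∣ MvPolynomial.coeff m'.2 c') :
    IsVLead o p (c - c') m := by
  constructor
  · rw [MvPolynomial.coeff_sub]
    exact fun h' => h.1 ((dvd_sub_left (hc' m (o.lt_irrefl m))).1 h')
  · intro m' hlt
    rw [MvPolynomial.coeff_sub]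
    exact dvd_sub (h.2 m' hlt) (hc' m' (TLocalOrder.lt_asymm hlt))

/-- At x-parts other than that of m the order in t is only a lower bound for the valuation, which
suffices for the monomials above m. At m the bound is attained, since the leading coefficient is
prime to p. -/
theorem IsVLead.of_isLeadMon [IsDomain R] (hp : Prime p) {g : Poly R n}
    (h : IsLeadMon o (toSer g) m) (hc : ¬ p ∣ pc m g) : IsVLead o p (evalT p g) m := by
  have hz : ∀ m', o.lt m m' → pc m' g = 0 := fun m' hlt => by
    by_contra h0
    rcases h.2 m' (by rwa [coeffAt_toSer]) with h1 | h1
    · exact o.lt_irrefl m (h1 ▸ hlt)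
    · exact TLocalOrder.lt_asymm hlt h1
  constructor
  · rw [coeff_evalT]
    have h1 : X ^ m.1 ∣ MvPolynomial.coeff m.2 g :=
      (X_pow_dvd_coeff_iff _ _ _).2 fun j hj => hz (j, m.2) (o.lt_of_t_lt m.2 hj)
    obtain ⟨w, hw⟩ := h1
    have hw0 : w.coeff 0 = pc m g := by
      rw [pc, hw, Polynomial.coeff_X_pow_mul', if_pos le_rfl, Nat.sub_self]
    rw [hw, Polynomial.eval_mul, Polynomial.eval_pow, Polynomial.eval_X, pow_succ,
      mul_dvd_mul_iff_left (pow_ne_zero _ hp.ne_zero), dvd_eval_iff_dvd_coeff_zero, hw0]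
    exact hc
  · rintro ⟨k, α⟩ hlt
    rw [coeff_evalT]
    refine dvd_eval_of_X_pow_dvd p ((X_pow_dvd_coeff_iff _ _ _).2 fun j hj => hz (j, α) ?_)
    rcases (Nat.lt_succ_iff.1 hj).eq_or_lt with rfl | hj
    · exact hlt
    · exact TLocalOrder.lt_trans hlt (o.lt_of_t_lt α hj)

theorem IsMonicAt.isVLead [IsDomain R] (hp : Prime p) {g : Poly R n} (h : IsMonicAt o g m) :
    IsVLead o p (evalT p g) m :=
  IsVLead.of_isLeadMon hp
    (have := hp.ne_zero; have : Nontrivial R := ⟨_, _, this⟩; h.isLeadMon)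
    (by rw [h.1]; exact fun h' => hp.not_isUnit (isUnit_of_dvd_one h'))

/-- There is no cancellation of leading monomials with different `x`-parts. -/
theorem IsVLead.le_of_sum [IsDomain R] [IsNoetherianRing R] (hp : Prime p)
    {A : Finset (Fin n →₀ ℕ)} {e : (Fin n →₀ ℕ) → MvPolynomial (Fin n) R}
    {b : (Fin n →₀ ℕ) → ℕ} (he : ∀ α ∈ A, IsVLead o p (e α) (b α, α)) {r : (Fin n →₀ ℕ) → R}
    (h : IsVLead o p (∑ α ∈ A, r α • e α) m) :
    (m.2 ∈ A ∧ b m.2 ≤ m.1) ∧ ∀ α ∈ A, ∀ k, ¬ p ^ (k + 1) ∣ r α → ¬ o.lt m (b α + k, α) := by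
  classical
  -- For each α the greatest element of this set is the leading monomial of r_α e_α, where k is the
  -- valuation of r_α. Since x-parts differ, the overall greatest one belongs to a single summand.
  let Ω : Set (Mon n) := {m | m.2 ∈ A ∧ ∃ k, m.1 = b m.2 + k ∧ ¬ p ^ (k + 1) ∣ r m.2}
  have hne : Ω.Nonempty := by
    by_contra hΩ
    apply h.1
    have : ∑ α ∈ A, r α • e α = 0 := by
      refine Finset.sum_eq_zero fun α hα => ?_
      rw [eq_zero_of_forall_pow_dvd hp (a := r α) fun k => ?_, zero_smul]
      by_contra hk
      exact hΩ ⟨(b α + k, α), hα, k, rfl,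
        fun h => hk ((pow_dvd_pow p (Nat.le_succ k)).trans h)⟩
    rw [this, MvPolynomial.coeff_zero]
    exact dvd_zero _
  obtain ⟨⟨_, α⟩, ⟨hα, k, hb, hk⟩, hmax⟩ := o.exists_greatest A Ω hne fun m hm => hm.1
  simp only at hα hb hk
  subst hb
  -- At the greatest monomial all other summands have larger valuation than needed, and above it all
  -- summands do.
  have hlarge : ∀ α' ∈ A, ∀ m' : Mon n, o.lt (b α + k, α) m' ∨ (m' = (b α + k, α) ∧ α' ≠ α) →
      p ^ (m'.1 + 1) ∣ MvPolynomial.coeff m'.2 (r α' • e α') := by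
    intro α' hα' m' hm'
    rw [MvPolynomial.coeff_smul, smul_eq_mul]
    by_cases h0 : r α' = 0
    · rw [h0, zero_mul]; exact dvd_zero _
    obtain ⟨j, u, hju, hu⟩ : ∃ j u, r α' = p ^ j * u ∧ ¬ p ∣ u := by
      obtain ⟨u, hu, hu'⟩ :=
        (FiniteMultiplicity.of_not_isUnit hp.not_isUnit h0).exists_eq_pow_mul_and_not_dvd
      exact ⟨_, u, hu, hu'⟩
    have h1 : ¬ o.lt (b α + k, α) (b α' + j, α') := hmax _ ⟨hα', j, rfl, by
      simp only [hju]
      rw [pow_succ, mul_dvd_mul_iff_left (pow_ne_zero _ hp.ne_zero)]; exact hu⟩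
    have h2 : o.lt (b α' + j, α') m' := by
      rcases hm' with hm' | ⟨rfl, hne⟩
      · exact TLocalOrder.lt_of_not_lt_of_lt h1 hm'
      · rcases TLocalOrder.not_lt.1 h1 with h2 | h2
        · exact absurd (congrArg Prod.snd h2) hne
        · exact h2
    have h3 := ((he α' hα').smul_pow hp hu j).2 m' (by simpa using h2)
    rwa [MvPolynomial.coeff_smul, smul_eq_mul, ← hju] at h3
  have hlead : IsVLead o p (∑ α ∈ A, r α • e α) (b α + k, α) := by
    constructor
    · simp only [MvPolynomial.coeff_sum]
      rw [← Finset.add_sum_erase _ _ hα, dvd_add_left (Finset.dvd_sum fun α' hα' =>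
        hlarge α' (Finset.mem_of_mem_erase hα') (b α + k, α)
          (Or.inr ⟨rfl, Finset.ne_of_mem_erase hα'⟩))]
      obtain ⟨u, hu⟩ : p ^ k ∣ r α := by
        rcases k with _ | k
        · simp
        · by_contra hk'
          exact hmax (b α + k, α) ⟨hα, k, rfl, hk'⟩ (o.lt_of_t_lt α (by omega))
      have hu' : ¬ p ∣ u := fun h' => hk (by rw [hu, pow_succ]; exact mul_dvd_mul_left _ h')
      have := ((he α hα).smul_pow hp hu' k).1
      simpa [← hu] using this
    · intro m' hlt
      rw [MvPolynomial.coeff_sum]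
      exact Finset.dvd_sum fun α' hα' => hlarge α' hα' m' (Or.inl hlt)
  obtain rfl := h.eq hlead
  exact ⟨⟨hα, Nat.le_add_right _ _⟩, fun α' hα' k' hk' =>
    hmax (b α' + k', α') ⟨hα', k', rfl, hk'⟩⟩

/-- If every nonzero element of `J` has the same leading monomial as some element of `N ≤ J`,
then `N` and `J` agree after localisation at `p`. -/
theorem exists_smul_mem_of_isVLead [IsDomain R] [IsNoetherianRing R] (hp : Prime p)
    (A : Finset (Fin n →₀ ℕ)) : ∀ N J : Submodule R (MvPolynomial (Fin n) R), N ≤ J →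
    (∀ c ∈ J, ∀ α, MvPolynomial.coeff α c ≠ 0 → α ∈ A) →
    (∀ c ∈ J, ∀ m, IsVLead o p c m → ∃ e ∈ N, IsVLead o p e m) →
    ∀ c ∈ J, ∃ u, ¬ p ∣ u ∧ u • c ∈ N := by
  classical
  induction A using Finset.strongInduction with
  | H A ih =>
  intro N J hNJ hA hlead c hc
  by_cases hJ : ∀ c ∈ J, c = 0
  · exact ⟨1, fun h => hp.not_isUnit (isUnit_of_dvd_one h), by
      rw [hJ c hc, smul_zero]; exact N.zero_mem⟩
  push Not at hJ
  obtain ⟨c₁, hc₁, hc₁0⟩ := hJ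
  -- The greatest element (k₀, α₀) is the greatest leading monomial in J, and e₀ ∈ N realises it.
  -- The proof eliminates the coordinate α₀ with e₀ as pivot and applies induction on A.
  let Ω : Set (Mon n) := {m | ∃ c ∈ J, ¬ p ^ (m.1 + 1) ∣ MvPolynomial.coeff m.2 c}
  have hΩA : ∀ m ∈ Ω, m.2 ∈ A := by
    rintro m ⟨c, hc, hm⟩
    exact hA c hc m.2 fun h0 => hm (h0 ▸ dvd_zero _)
  obtain ⟨⟨k₀, α₀⟩, hm₀, hmax⟩ := o.exists_greatest A Ω
    (by obtain ⟨m, hm⟩ := exists_isVLead (o := o) hp hc₁0; exact ⟨m, c₁, hc₁, hm.1⟩) hΩA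
  obtain ⟨e₀, he₀, hlead₀⟩ : ∃ e ∈ N, IsVLead o p e (k₀, α₀) := by
    obtain ⟨c, hc, hm⟩ := hm₀
    refine hlead c hc (k₀, α₀) ⟨hm, fun m' hlt => ?_⟩
    by_contra h
    exact hmax m' ⟨c, hc, h⟩ hlt
  obtain ⟨w, hw⟩ := hlead₀.pow_dvd
  have hwp : ¬ p ∣ w := fun h => hlead₀.1 (by
    simp only at hw ⊢
    rw [hw, pow_succ]; exact mul_dvd_mul_left _ h)
  -- By maximality no element of J has smaller valuation at α₀ than k₀, so the pivot divides all of
  -- them up to the factor w prime to p.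
  have hdvd : ∀ c ∈ J, ∃ u, MvPolynomial.coeff α₀ c = p ^ k₀ * u := fun c hc => by
    rcases k₀ with _ | k
    · exact ⟨_, by rw [pow_zero, one_mul]⟩
    · by_contra h
      exact hmax (k, α₀) ⟨c, hc, fun h' => h h'⟩ (o.lt_of_t_lt α₀ (Nat.lt_succ_self k))
  let π : MvPolynomial (Fin n) R →ₗ[R] R := MvPolynomial.lcoeff R α₀
  have hπ : ∀ c, π c = MvPolynomial.coeff α₀ c := fun c => rfl
  have hsub : ∀ c u, MvPolynomial.coeff α₀ c = p ^ k₀ * u → π (w • c - u • e₀) = 0 := by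
    intro c u hu
    simp only at hw
    rw [hπ, MvPolynomial.coeff_sub, MvPolynomial.coeff_smul, MvPolynomial.coeff_smul, hu, hw,
      smul_eq_mul, smul_eq_mul]
    ring
  have key := ih (A.erase α₀) (Finset.erase_ssubset (hΩA _ hm₀)) (N ⊓ LinearMap.ker π)
    (J ⊓ LinearMap.ker π) (inf_le_inf_right _ hNJ)
    (fun c hc α hα => Finset.mem_erase.2 ⟨fun h => hα (by
      rw [h, ← hπ]; exact hc.2), hA c hc.1 α hα⟩)
    (by
      rintro c ⟨hc, hcπ⟩ m hm
      obtain ⟨e, he, hem⟩ := hlead c hc m hm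
      obtain ⟨u, hu⟩ := hdvd e (hNJ he)
      refine ⟨w • e - u • e₀, ⟨N.sub_mem (N.smul_mem _ he) (N.smul_mem _ he₀), hsub e u hu⟩, ?_⟩
      -- The element e has leading monomial m, and its coefficient at α₀ is p^(k₀) u. So the leading
      -- monomial of u e₀ is at most m, and strictly below because the x-parts differ; subtracting u
      -- e₀ keeps the lead.
      refine (hem.smul hp hwp).sub fun m' hm' => ?_
      have hmα : m.2 ≠ α₀ := fun h => hm.1 (by
        rw [h, ← hπ, show π c = 0 from hcπ]; exact dvd_zero _)
      by_cases hu0 : u = 0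
      · rw [hu0, zero_smul, MvPolynomial.coeff_zero]; exact dvd_zero _
      obtain ⟨v, hv, hv'⟩ :=
        (FiniteMultiplicity.of_not_isUnit hp.not_isUnit hu0).exists_eq_pow_mul_and_not_dvd
      set j := multiplicity p u
      have h1 : ¬ o.lt m (k₀ + j, α₀) := hem.not_lt (by
        rw [hu, hv, ← mul_assoc, ← pow_add, pow_succ,
          mul_dvd_mul_iff_left (pow_ne_zero _ hp.ne_zero)]
        exact hv')
      have h2 : o.lt (k₀ + j, α₀) m := by
        rcases TLocalOrder.not_lt.1 h1 with h2 | h2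
        · exact absurd (congrArg Prod.snd h2).symm hmα
        · exact h2
      have h3 := (hlead₀.smul_pow hp hv' j).2 m' (by
        simpa using TLocalOrder.lt_of_lt_of_not_lt h2 hm')
      rwa [← hv] at h3)
  obtain ⟨u, hu⟩ := hdvd c hc
  obtain ⟨v, hv, hvN⟩ := key (w • c - u • e₀)
    ⟨J.sub_mem (J.smul_mem _ hc) (J.smul_mem _ (hNJ he₀)), hsub c u hu⟩
  refine ⟨v * w, fun h => (hp.dvd_or_dvd h).elim hv hwp, ?_⟩
  have := N.add_mem hvN.1 (N.smul_mem (v * u) he₀)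
  rwa [smul_sub, smul_smul, smul_smul, sub_add_cancel] at this

end Valuation

/-! ## Linear combinations with terms as coefficients -/

section TermSpan
variable {R : Type u} [CommRing R] {n : ℕ}

/-- The `R`-submodule generated by the products `t^β x^α · h` with `P (β, α) h`. -/
def termSpan (P : Mon n → Poly R n → Prop) : Submodule R (Poly R n) :=
  Submodule.span R {f | ∃ μ h, P μ h ∧ f = term μ 1 * h}

theorem term_mul_mem_termSpan {P : Mon n → Poly R n → Prop} {μ : Mon n} {h : Poly R n}
    (hP : P μ h) : term μ 1 * h ∈ termSpan P := Submodule.subset_span ⟨μ, h, hP, rfl⟩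

theorem smul_term (r c : R) (μ : Mon n) : r • term μ c = term μ (r * c) := by
  rw [term, term, MvPolynomial.smul_monomial, Polynomial.smul_monomial, smul_eq_mul]

theorem span_range_term : Submodule.span R (Set.range fun μ : Mon n => term μ (1 : R)) = ⊤ := by
  refine Submodule.eq_top_iff'.2 fun f => ?_
  induction f using MvPolynomial.induction_on' with
  | monomial α a =>
    induction a using Polynomial.induction_on' with
    | add a b ha hb => rw [map_add]; exact Submodule.add_mem _ ha hb
    | monomial k c =>
      have := Submodule.smul_mem (Submodule.span R (Set.range fun μ : Mon n => term μ (1 : R))) c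
        (Submodule.subset_span ⟨(k, α), rfl⟩)
      rw [smul_term, mul_one] at this
      exact this
  | add f g hf hg => exact Submodule.add_mem _ hf hg

open scoped Pointwise in
theorem mem_ideal_span_iff {B : Set (Poly R n)} {f : Poly R n} :
    f ∈ Ideal.span B ↔ f ∈ termSpan fun _ h => h ∈ B := by
  have h := Submodule.span_smul_of_span_eq_top (span_range_term (R := R) (n := n)) B
  have e : (Set.range fun μ : Mon n => term μ (1 : R)) • B =
      {f | ∃ μ h, h ∈ B ∧ f = term μ 1 * h} := by
    ext f
    simp only [smul_eq_mul, Set.mem_ofPred_eq]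
    constructor
    · rintro ⟨_, ⟨μ, rfl⟩, h, hh, rfl⟩
      exact ⟨μ, h, hh, rfl⟩
    · rintro ⟨μ, h, hh, rfl⟩
      exact ⟨_, ⟨μ, rfl⟩, h, hh, rfl⟩
  rw [termSpan, ← e, h]
  rfl

theorem termSpan_mono {P Q : Mon n → Poly R n → Prop} (h : ∀ μ f, P μ f → Q μ f) :
    termSpan P ≤ termSpan Q := by
  refine Submodule.span_mono ?_
  rintro f ⟨μ, g, hP, rfl⟩
  exact ⟨μ, g, h μ g hP, rfl⟩

/-- The substitution `t ↦ p` as an `R`-linear map. -/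
def evalTₗ (p : R) : Poly R n →ₗ[R] MvPolynomial (Fin n) R where
  toFun := evalT p
  map_add' := map_add _
  map_smul' r f := by
    ext α
    rw [coeff_evalT, MvPolynomial.coeff_smul, Polynomial.eval_smul, RingHom.id_apply,
      MvPolynomial.coeff_smul, coeff_evalT]

theorem evalTₗ_apply (p : R) (f : Poly R n) : evalTₗ p f = evalT p f := rfl

theorem evalT_term_mul (p : R) (μ : Mon n) (h : Poly R n) :
    evalT p (term μ 1 * h) = p ^ μ.1 • (MvPolynomial.monomial μ.2 1 * evalT p h) := by
  rw [map_mul, evalT_term, ← smul_mul_assoc, MvPolynomial.smul_monomial, smul_eq_mul, one_mul,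
    mul_one]

/-- If all multiples of p - t are allowed, membership may be checked after t ↦ p, whose kernel they
span. -/
theorem mem_termSpan_of_evalT_mem {p : R} {P : Mon n → Poly R n → Prop}
    (hP : ∀ μ, P μ (cst p - tVar)) {f : Poly R n}
    (h : evalT p f ∈ (termSpan P).map (evalTₗ p)) : f ∈ termSpan P := by
  obtain ⟨g, hg, he⟩ := h
  have : evalT p (f - g) = 0 := by rw [map_sub, ← he, evalTₗ_apply, sub_self]
  have h1 : f - g ∈ Ideal.span {(cst p - tVar : Poly R n)} :=
    Ideal.mem_span_singleton.2 (evalT_eq_zero_iff.1 this)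
  have h2 : f - g ∈ termSpan P := termSpan_mono
    (fun μ h (hh : h ∈ ({cst p - tVar} : Set (Poly R n))) => by
      rw [Set.mem_singleton_iff.1 hh]; exact hP μ) (mem_ideal_span_iff.1 h1)
  simpa using Submodule.add_mem _ h2 hg

/-- Up to a factor in `1 + t R[t]`, the polynomial `f` is in the ideal generated by `B`. -/
def IsLocalCombination (B : Set (Poly R n)) (f : Poly R n) : Prop :=
  f ∈ termSpan fun μ h => h ∈ B ∨ h = f ∧ 1 ≤ μ.1 ∧ μ.2 = 0

theorem isUnit_one_sub_X_mul (r : PowerSeries R) : IsUnit (1 - PowerSeries.X * r) := by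
  rw [PowerSeries.isUnit_iff_constantCoeff]
  simp

theorem IsLocalCombination.exists_mem {B : Set (Poly R n)} {f : Poly R n}
    (h : IsLocalCombination B f) :
    ∃ r : Polynomial R, f - MvPolynomial.C (X * r) * f ∈ Ideal.span B := by
  have key : ∀ g ∈ termSpan (fun μ h => h ∈ B ∨ h = f ∧ 1 ≤ μ.1 ∧ μ.2 = 0),
      ∃ r : Polynomial R, g - MvPolynomial.C (X * r) * f ∈ Ideal.span B := by
    intro g hg
    induction hg using Submodule.span_induction with
    | mem g hg =>
      obtain ⟨⟨k, α⟩, h, hh | ⟨rfl, hk, hα⟩, rfl⟩ := hg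
      · exact ⟨0, by simpa using Ideal.mul_mem_left _ _ (Ideal.subset_span hh)⟩
      · obtain ⟨j, rfl⟩ := Nat.exists_eq_add_of_le hk
        obtain rfl : α = 0 := hα
        refine ⟨X ^ j, ?_⟩
        have : term ((1 + j, 0) : Mon n) (1 : R) = MvPolynomial.C (X * X ^ j) := by
          rw [term, MvPolynomial.C_apply, Polynomial.monomial_one_right_eq_X_pow, pow_add,
            pow_one]
        rw [this, sub_self]
        exact Ideal.zero_mem _
    | zero => exact ⟨0, by simp⟩
    | add g g' _ _ hg hg' =>
      obtain ⟨r, hr⟩ := hg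
      obtain ⟨r', hr'⟩ := hg'
      refine ⟨r + r', ?_⟩
      have := Ideal.add_mem _ hr hr'
      rwa [sub_add_sub_comm, ← add_mul, ← map_add, ← mul_add] at this
    | smul c g _ hg =>
      obtain ⟨r, hr⟩ := hg
      refine ⟨Polynomial.C c * r, ?_⟩
      have := Ideal.mul_mem_left _ (MvPolynomial.C (Polynomial.C c)) hr
      have e : c • g = MvPolynomial.C (Polynomial.C c) * g := by
        ext α : 1
        rw [MvPolynomial.coeff_smul, MvPolynomial.coeff_C_mul, Polynomial.smul_eq_C_mul]
      rw [e]
      have e' : MvPolynomial.C (Polynomial.C c) * g -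
          MvPolynomial.C (X * (Polynomial.C c * r)) * f = MvPolynomial.C (Polynomial.C c) *
          (g - MvPolynomial.C (X * r) * f) := by
        simp only [map_mul]; ring
      rwa [e']
  exact key f h

/-- The factor 1 - t r is a unit in R⟦t⟧. -/
theorem IsLocalCombination.toSer_mem {B : Set (Poly R n)} {f : Poly R n}
    (h : IsLocalCombination B f) : toSer f ∈ Ideal.span (toSer '' B) := by
  obtain ⟨r, hr⟩ := h.exists_mem
  have h1 := toSer_mem_span hr
  have e : toSer (f - MvPolynomial.C (X * r) * f) =
      MvPolynomial.C (1 - PowerSeries.X * (r : PowerSeries R)) * toSer f := by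
    rw [map_sub, map_mul, map_sub, sub_mul, map_one, one_mul]
    congr 2
    rw [toSer, MvPolynomial.map_C]
    simp
  rw [e] at h1
  exact (Ideal.unit_mul_mem_iff_mem _ ((isUnit_one_sub_X_mul _).map MvPolynomial.C)).1 h1

theorem isLocalCombination_of_mem [IsNoetherianRing R] {p : R} {B : Set (Poly R n)}
    (hB : ∀ b ∈ B, XHomogeneous b) (hpt : cst p - tVar ∈ B) {f : Poly R n} (hf : XHomogeneous f)
    (h : toSer f ∈ Ideal.span (toSer '' B)) : IsLocalCombination B f := by
  obtain ⟨r, hr⟩ := exists_mul_mem_span hB hpt hf h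
  have h1 : f - MvPolynomial.C (X * r) * f ∈
      termSpan fun μ h => h ∈ B ∨ h = f ∧ 1 ≤ μ.1 ∧ μ.2 = 0 :=
    termSpan_mono (fun μ h hh => Or.inl hh) (mem_ideal_span_iff.1 hr)
  have h2 : MvPolynomial.C (X * r) * f ∈
      termSpan fun μ h => h ∈ B ∨ h = f ∧ 1 ≤ μ.1 ∧ μ.2 = 0 := by
    clear hr h1
    induction r using Polynomial.induction_on' with
    | add a b ha hb => rw [mul_add, map_add, add_mul]; exact Submodule.add_mem _ ha hb
    | monomial k c =>
      have : MvPolynomial.C (X * Polynomial.monomial k c) * f =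
          c • (term ((k + 1, 0) : Mon n) (1 : R) * f) := by
        rw [← smul_mul_assoc, smul_term, mul_one, Polynomial.X_mul_monomial, term,
          MvPolynomial.C_apply]
      rw [this]
      exact Submodule.smul_mem _ _ (term_mul_mem_termSpan (Or.inr ⟨rfl, by simp, rfl⟩))
  simpa [IsLocalCombination] using Submodule.add_mem _ h1 h2

end TermSpan

/-! ## A certificate for standard bases -/

section Certificate
variable {R : Type u} [CommRing R] {n : ℕ} {o : TLocalOrder n} {p : R} {G : List (Poly R n)}

/-- The `x`-exponent by which `g` is multiplied to make `x`-parts of leading monomials match. -/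
def sShift (o : TLocalOrder n) (g g' : Poly R n) : Fin n →₀ ℕ := (plm o g').2 - (plm o g).2

/-- `x^a g` is reduced to zero by `G` modulo multiples of `t` and a multiple of `g'`. -/
def IsSReducible (o : TLocalOrder n) (p : R) (G : List (Poly R n)) (g g' : Poly R n) : Prop :=
  term (0, sShift o g g') 1 * g ∈ termSpan fun μ h => h = cst p - tVar ∨ h ∈ G ∧
    μ.2.degree + (plm o h).2.degree = ((plm o g).2 + sShift o g g').degree ∧
    (1 ≤ μ.1 ∨ o.lt (μ + plm o h) (plm o g + (0, sShift o g g')) ∨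
      h = g' ∧ μ.2 + (plm o h).2 = (plm o g).2 + sShift o g g')

/-- The multiples of `x`-degree `d` of the elements of `G` after the substitution `t ↦ p`. -/
def multiples (o : TLocalOrder n) (p : R) (G : List (Poly R n)) (d : ℕ) :
    Submodule R (MvPolynomial (Fin n) R) :=
  Submodule.span R {c | ∃ g ∈ G, ∃ γ : Fin n →₀ ℕ, γ.degree + (plm o g).2.degree = d ∧
    c = MvPolynomial.monomial γ 1 * evalT p g}

/-- `ch α` is an element of `G` whose leading monomial has minimal `t`-exponent among those with
an `x`-part that divides `x^α`. -/
def IsChoice (o : TLocalOrder n) (G : List (Poly R n)) (ch : (Fin n →₀ ℕ) → Poly R n) : Prop :=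
  ∀ α, (∃ h ∈ G, (plm o h).2 ≤ α) → ch α ∈ G ∧ (plm o (ch α)).2 ≤ α ∧
    ∀ h ∈ G, (plm o h).2 ≤ α → (plm o (ch α)).1 ≤ (plm o h).1

theorem exists_isChoice (o : TLocalOrder n) (G : List (Poly R n)) : ∃ ch, IsChoice o G ch := by
  have : ∀ α, ∃ c, (∃ h ∈ G, (plm o h).2 ≤ α) → c ∈ G ∧ (plm o c).2 ≤ α ∧
      ∀ h ∈ G, (plm o h).2 ≤ α → (plm o c).1 ≤ (plm o h).1 := by
    intro α
    by_cases h : ∃ h, h ∈ G ∧ (plm o h).2 ≤ α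
    · obtain ⟨c, hc, hmin⟩ := exists_minimalFor_of_wellFoundedLT _ (fun h => (plm o h).1) h
      refine ⟨c, fun _ => ⟨hc.1, hc.2, fun h hh hle => ?_⟩⟩
      rcases le_total (plm o c).1 (plm o h).1 with h1 | h1
      · exact h1
      · exact hmin ⟨hh, hle⟩ h1
    · exact ⟨0, fun h' => absurd h' h⟩
  choose ch hch using this
  exact ⟨ch, hch⟩

open Classical in
/-- The exponents of degree `d` that are divisible by the `x`-part of a leading monomial. -/
def exponents (o : TLocalOrder n) (G : List (Poly R n)) (d : ℕ) : Finset (Fin n →₀ ℕ) :=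
  (xMonomials n d).filter fun α => ∃ h ∈ G, (plm o h).2 ≤ α

theorem mem_exponents {d : ℕ} {α : Fin n →₀ ℕ} :
    α ∈ exponents o G d ↔ α.degree = d ∧ ∃ h ∈ G, (plm o h).2 ≤ α := by
  rw [exponents, Finset.mem_filter, mem_xMonomials]

/-- The multiple of `ch α` with leading `x`-part `x^α`, after the substitution `t ↦ p`. -/
def chosen (o : TLocalOrder n) (p : R) (ch : (Fin n →₀ ℕ) → Poly R n) (α : Fin n →₀ ℕ) :
    MvPolynomial (Fin n) R :=
  MvPolynomial.monomial (α - (plm o (ch α)).2) 1 * evalT p (ch α)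

variable {ch : (Fin n →₀ ℕ) → Poly R n}

theorem chosen_isVLead [IsDomain R] (hp : Prime p) (hch : IsChoice o G ch)
    (hmon : ∀ g ∈ G, IsMonicAt o g (plm o g)) {d : ℕ} {α : Fin n →₀ ℕ}
    (hα : α ∈ exponents o G d) : IsVLead o p (chosen o p ch α) ((plm o (ch α)).1, α) := by
  obtain ⟨h1, h2, -⟩ := hch α (mem_exponents.1 hα).2
  have := ((hmon _ h1).isVLead hp).monomial_mul (α - (plm o (ch α)).2)
  rwa [show plm o (ch α) + (0, α - (plm o (ch α)).2) = ((plm o (ch α)).1, α) from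
    Prod.ext (add_zero _) (add_tsub_cancel_of_le h2)] at this

/-- Given x^γ g, let g' be the chosen element for its leading x-part and multiply the reduction of
the pair (g, g') by the remaining power of x. Multiples of t become multiples of p, the multiple of
g' is a chosen one, and the other terms have smaller leading monomials, to which induction applies.
-/
theorem multiples_le (hch : IsChoice o G ch)
    (hS : ∀ g ∈ G, ∀ g' ∈ G, (plm o g').1 ≤ (plm o g).1 → IsSReducible o p G g g') (d : ℕ) :
    multiples o p G d ≤ Submodule.span R (chosen o p ch '' exponents o G d) ⊔
      Ideal.span {p} • multiples o p G d := by
  classical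
  set N := Submodule.span R (chosen o p ch '' exponents o G d) with hN
  -- The ordering need not be well-founded, but only finitely many leading monomials of multiples of
  -- degree d occur.
  let V : Finset (Mon n) :=
    (G.toFinset ×ˢ xMonomials n d).image fun gα => ((plm o gα.1).1, gα.2)
  have hwf : (V : Set (Mon n)).WellFoundedOn o.lt :=
    have := o.total
    V.finite_toSet.wellFoundedOn
  have hV : ∀ g ∈ G, ∀ γ : Fin n →₀ ℕ, γ.degree + (plm o g).2.degree = d →
      plm o g + (0, γ) ∈ (V : Set (Mon n)) := by
    intro g hg γ hγ
    refine Finset.mem_coe.2 (Finset.mem_image.2 ⟨(g, (plm o g).2 + γ), ?_, rfl⟩)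
    refine Finset.mem_product.2 ⟨List.mem_toFinset.2 hg, mem_xMonomials.2 ?_⟩
    rw [map_add, add_comm, hγ]
  have key : ∀ m ∈ (V : Set (Mon n)), ∀ g ∈ G, ∀ γ : Fin n →₀ ℕ,
      γ.degree + (plm o g).2.degree = d → plm o g + (0, γ) = m →
      MvPolynomial.monomial γ 1 * evalT p g ∈ N ⊔ Ideal.span {p} • multiples o p G d := by
    intro m hm
    refine hwf.induction hm (P := fun m => ∀ g ∈ G, ∀ γ : Fin n →₀ ℕ,
      γ.degree + (plm o g).2.degree = d → plm o g + (0, γ) = m →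
      MvPolynomial.monomial γ 1 * evalT p g ∈ N ⊔ Ideal.span {p} • multiples o p G d) ?_
    rintro m - ih g hg γ hγ rfl
    set α := (plm o g).2 + γ with hα
    have hex : α ∈ exponents o G d :=
      mem_exponents.2 ⟨by rw [hα, map_add, add_comm, hγ], g, hg, le_self_add⟩
    obtain ⟨h1, h2, h3⟩ := hch α (mem_exponents.1 hex).2
    set g' := ch α with hg'
    -- The choice minimises the exponent of t, and g itself competes, so the pair satisfies the
    -- condition under which reducibility is required.
    have hSg := hS g hg g' h1 (h3 g hg le_self_add)
    unfold IsSReducible at hSg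
    set a := sShift o g g' with ha
    have haγ : a ≤ γ := tsub_le_iff_left.2 h2
    clear_value a g' α
    obtain ⟨δ, rfl⟩ := exists_add_of_le haγ
    have hmul : ∀ f ∈ termSpan (fun μ h => h = cst p - tVar ∨ h ∈ G ∧
        μ.2.degree + (plm o h).2.degree = ((plm o g).2 + a).degree ∧
        (1 ≤ μ.1 ∨ o.lt (μ + plm o h) (plm o g + (0, a)) ∨
          h = g' ∧ μ.2 + (plm o h).2 = (plm o g).2 + a)),
        MvPolynomial.monomial δ 1 * evalT p f ∈ N ⊔ Ideal.span {p} • multiples o p G d := by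
      intro f hf
      induction hf using Submodule.span_induction with
      | zero => rw [map_zero, mul_zero]; exact Submodule.zero_mem _
      | add f f' _ _ hf hf' => rw [map_add, mul_add]; exact Submodule.add_mem _ hf hf'
      | smul r f _ hf =>
        rw [← evalTₗ_apply, map_smul, mul_smul_comm]
        exact Submodule.smul_mem _ _ hf
      | mem f hf =>
        obtain ⟨⟨k, μ⟩, h, hh, rfl⟩ := hf
        rcases hh with rfl | ⟨hh, hdeg, hcond⟩
        · have : evalT p (cst p - tVar : Poly R n) = 0 := evalT_eq_zero_iff.2 dvd_rfl
          rw [map_mul, this, mul_zero, mul_zero]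
          exact Submodule.zero_mem _
        simp only at hdeg hcond
        have e : MvPolynomial.monomial δ 1 * evalT p (term (k, μ) 1 * h) =
            p ^ k • (MvPolynomial.monomial (δ + μ) 1 * evalT p h) := by
          rw [evalT_term_mul, mul_smul_comm, ← mul_assoc, MvPolynomial.monomial_mul, one_mul]
        have hdeg' : (δ + μ).degree + (plm o h).2.degree = d := by
          rw [map_add, add_assoc, hdeg, ← hγ, map_add, map_add]
          ring
        have hmem : MvPolynomial.monomial (δ + μ) 1 * evalT p h ∈ multiples o p G d :=
          Submodule.subset_span ⟨h, hh, δ + μ, hdeg', rfl⟩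
        rw [e]
        rcases k with _ | k
        · rw [pow_zero, one_smul]
          rcases hcond with hk | hlt | ⟨hhg, hμ⟩
          · exact absurd hk (by norm_num)
          · refine ih (plm o h + (0, δ + μ)) (hV h hh _ hdeg') ?_ h hh (δ + μ) hdeg' rfl
            have := (o.add_lt_add_iff (0, δ)).2 hlt
            rwa [show ((0, μ) : Mon n) + plm o h + (0, δ) = plm o h + (0, δ + μ) from
                Prod.ext (by simp) (by simp only [Prod.snd_add]; abel),
              show plm o g + (0, a) + (0, δ) = plm o g + (0, a + δ) from
                Prod.ext (by simp) (by simp only [Prod.snd_add]; abel)] at this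
          · refine Submodule.mem_sup_left (Submodule.subset_span ⟨α, hex, ?_⟩)
            rw [hhg] at hμ ⊢
            rw [chosen, ← hg']
            congr 2
            have : α = δ + μ + (plm o g').2 := by rw [hα, add_assoc, hμ]; abel
            rw [this, add_tsub_cancel_right]
        · refine Submodule.mem_sup_right ?_
          rw [pow_succ', mul_smul]
          exact Submodule.smul_mem_smul (Ideal.mem_span_singleton_self p)
            (Submodule.smul_mem _ _ hmem)
    have := hmul _ hSg
    rwa [map_mul, evalT_term, ← mul_assoc, MvPolynomial.monomial_mul, pow_zero, mul_one, one_mul,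
      add_comm δ a] at this
  refine Submodule.span_le.2 ?_
  rintro c ⟨g, hg, γ, hγ, rfl⟩
  exact key _ (hV g hg γ hγ) g hg γ hγ rfl

theorem multiples_fg (d : ℕ) : (multiples o p G d).FG := by
  classical
  refine Submodule.fg_span (((G.toFinset ×ˢ (Finset.range (d + 1)).biUnion fun e =>
    xMonomials n e).finite_toSet.image fun gγ : Poly R n × (Fin n →₀ ℕ) =>
      MvPolynomial.monomial gγ.2 (1 : R) * evalT p gγ.1).subset ?_)
  rintro c ⟨g, hg, γ, hγ, rfl⟩
  refine ⟨(g, γ), Finset.mem_coe.2 (Finset.mem_product.2 ⟨List.mem_toFinset.2 hg,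
    Finset.mem_biUnion.2 ⟨γ.degree, Finset.mem_range.2 (by omega), mem_xMonomials.2 rfl⟩⟩), rfl⟩

end Certificate

/-! ### Soundness of the criterion on pairs -/

section CertificateSound
variable {R : Type u} [CommRing R] {n : ℕ} {o : TLocalOrder n} {p : R} {G : List (Poly R n)}

theorem xhom_degree {g : Poly R n} (h : XHomogeneous g) (hm : IsMonicAt o g (plm o g))
    [Nontrivial R] : g.IsHomogeneous (plm o g).2.degree := by
  obtain ⟨d, hd⟩ := h
  rwa [isHomogeneous_iff.1 hd _ hm.coeff_ne_zero]

theorem isHomogeneous_monomial_mul_evalT {g : Poly R n} {e : ℕ} (hg : g.IsHomogeneous e)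
    (γ : Fin n →₀ ℕ) :
    (MvPolynomial.monomial γ 1 * evalT p g).IsHomogeneous (γ.degree + e) :=
  (MvPolynomial.isHomogeneous_monomial _ rfl).mul (isHomogeneous_evalT hg)

theorem homogeneousComponent_mem_multiples [Nontrivial R] (hhom : ∀ g ∈ G, XHomogeneous g)
    (hmon : ∀ g ∈ G, IsMonicAt o g (plm o g)) {B : Set (Poly R n)}
    (hB : ∀ b ∈ B, b = cst p - tVar ∨ b ∈ G) {f : Poly R n} (hf : f ∈ Ideal.span B) (d : ℕ) :
    MvPolynomial.homogeneousComponent d (evalT p f) ∈ multiples o p G d := by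
  have h := mem_ideal_span_iff.1 hf
  clear hf
  induction h using Submodule.span_induction with
  | zero => rw [map_zero, map_zero]; exact Submodule.zero_mem _
  | add f f' _ _ hf hf' =>
    rw [map_add, map_add]
    exact Submodule.add_mem _ hf hf'
  | smul r f _ hf =>
    rw [← evalTₗ_apply, map_smul, map_smul]
    exact Submodule.smul_mem _ _ hf
  | mem f hf =>
    obtain ⟨μ, h, hh, rfl⟩ := hf
    rcases hB h hh with rfl | hG
    · have : evalT p (cst p - tVar : Poly R n) = 0 := evalT_eq_zero_iff.2 dvd_rfl
      rw [map_mul, this, mul_zero, map_zero]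
      exact Submodule.zero_mem _
    · have e : evalT p (term μ 1 * h) =
          p ^ μ.1 • (MvPolynomial.monomial μ.2 1 * evalT p h) := by
        rw [map_mul, evalT_term, ← smul_mul_assoc, MvPolynomial.smul_monomial, smul_eq_mul,
          one_mul, mul_one]
      have hh' := isHomogeneous_monomial_mul_evalT (p := p)
        (xhom_degree (hhom h hG) (hmon h hG)) μ.2
      rw [evalT_term_mul, map_smul, MvPolynomial.homogeneousComponent_of_mem
        ((MvPolynomial.mem_homogeneousSubmodule _ _).2 hh')]
      refine Submodule.smul_mem _ _ ?_
      split_ifs with hd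
      · exact Submodule.subset_span ⟨h, hG, μ.2, hd.symm, rfl⟩
      · exact Submodule.zero_mem _

theorem plm_eq_of_lt_eq {f : Ser R n} {g : Poly R n} (hf : f ≠ 0) (h : plt o g = lt o f) :
    plm o g = lm o f ∧ plc o g = lc o f := by
  have h1 := congrArg (pc (lm o f)) h
  rw [show plt o g = term (plm o g) (plc o g) from rfl, lt, pc_term, pc_term_self] at h1
  split_ifs at h1 with h2
  · exact ⟨h2, h1⟩
  · exact absurd h1.symm (lc_ne_zero o hf)

/-- Replace f by an x-homogeneous polynomial with the same leading term and pass to t = p. There the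
leading monomial is a p-adic one, and it suffices that a multiple by an element prime to p is a
combination of chosen multiples. -/
theorem cover_of_isSReducible [IsDomain R] [IsNoetherianRing R] (hp : Prime p)
    (hhom : ∀ g ∈ G, XHomogeneous g) (hmon : ∀ g ∈ G, IsMonicAt o g (plm o g))
    (hS : ∀ g ∈ G, ∀ g' ∈ G, (plm o g').1 ≤ (plm o g).1 → IsSReducible o p G g g')
    {B : Set (Poly R n)} (hBhom : ∀ b ∈ B, XHomogeneous b)
    (hB : ∀ b ∈ B, b = cst p - tVar ∨ b ∈ G) {f : Ser R n} (hf : f ∈ Ideal.span (toSer '' B))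
    (hlc : ¬ p ∣ lc o f) : ∃ g ∈ G, plm o g ≤ lm o f := by
  have hf0 : f ≠ 0 := by
    rintro rfl
    exact hlc (by rw [lc_zero]; exact dvd_zero p)
  obtain ⟨f', hf', ⟨d, hd⟩, hlt⟩ := exists_poly_lt_eq (o := o) hBhom hf
  obtain ⟨h1, h2⟩ := plm_eq_of_lt_eq hf0 hlt
  have hf'0 : f' ≠ 0 := by
    rintro rfl
    rw [show plc o (0 : Poly R n) = 0 by rw [plc, map_zero, lc_zero]] at h2
    exact hlc (h2 ▸ dvd_zero p)
  have hlead : IsVLead o p (evalT p f') (lm o f) := by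
    rw [← h1]
    refine IsVLead.of_isLeadMon hp (isLeadMon_lm o _ (toSer_ne_zero.2 hf'0)) ?_
    rw [← h2] at hlc
    rwa [← coeffAt_toSer]
  have hJ : evalT p f' ∈ multiples o p G d := by
    have := homogeneousComponent_mem_multiples (o := o) hhom hmon hB hf' d
    rwa [MvPolynomial.homogeneousComponent_of_mem
      ((MvPolynomial.mem_homogeneousSubmodule _ _).2 (isHomogeneous_evalT hd)), if_pos rfl] at this
  obtain ⟨ch, hch⟩ := exists_isChoice o G
  -- Nakayama's lemma for the finitely generated module of multiples: some u ≡ 1 modulo p maps it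
  -- into the span of the chosen multiples.
  obtain ⟨u, hu, hle⟩ := Submodule.exists_sub_one_mem_and_smul_le_of_fg_of_le_sup
    (multiples_fg d) le_rfl (multiples_le hch hS d)
  have hup : ¬ p ∣ u := fun h => hp.not_isUnit (isUnit_of_dvd_one (by
    have := dvd_sub h (Ideal.mem_span_singleton.1 hu)
    rwa [sub_sub_cancel] at this))
  have hmem : u • evalT p f' ∈ Submodule.span R (chosen o p ch '' exponents o G d) :=
    hle (Submodule.smul_mem_pointwise_smul _ _ _ hJ)
  obtain ⟨r, hr⟩ := (Submodule.mem_span_image_finset_iff_exists_fun' R).1 hmem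
  have hlead' := hlead.smul hp hup
  rw [← hr] at hlead'
  obtain ⟨⟨h3, h4⟩, -⟩ := hlead'.le_of_sum hp (b := fun α => (plm o (ch α)).1)
    fun α hα => chosen_isVLead hp hch hmon hα
  obtain ⟨h5, h6, -⟩ := hch _ (mem_exponents.1 h3).2
  exact ⟨_, h5, h4, h6⟩

theorem chosen_eq (p : R) (ch : (Fin n →₀ ℕ) → Poly R n) (α : Fin n →₀ ℕ) :
    chosen o p ch α = evalT p (term (0, α - (plm o (ch α)).2) 1 * ch α) := by
  rw [evalT_term_mul, pow_zero, one_smul]; rfl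

/-- A prescribed g' may be chosen at α₀ unless some other element has a strictly smaller exponent of
t there. -/
theorem exists_isChoice_apply (o : TLocalOrder n) {g' : Poly R n} (hg' : g' ∈ G)
    {α₀ : Fin n →₀ ℕ} (hα₀ : (plm o g').2 ≤ α₀) :
    ∃ ch, IsChoice o G ch ∧ (ch α₀ = g' ∨ (plm o (ch α₀)).1 < (plm o g').1) := by
  classical
  obtain ⟨ch, hch⟩ := exists_isChoice o G
  by_cases hlt : (plm o (ch α₀)).1 < (plm o g').1
  · exact ⟨ch, hch, Or.inr hlt⟩
  refine ⟨Function.update ch α₀ g', fun α hα => ?_, Or.inl (Function.update_self _ _ _)⟩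
  by_cases h : α = α₀
  · subst h
    rw [Function.update_self]
    exact ⟨hg', hα₀, fun h hh hle => (not_lt.1 hlt).trans ((hch α hα).2.2 h hh hle)⟩
  · rw [Function.update_of_ne h]
    exact hch α hα

end CertificateSound

/-! ### Completeness of the criterion on pairs -/

section CertificateComplete
variable {R : Type u} [CommRing R] [IsDomain R] [IsNoetherianRing R] {n : ℕ}
  {o : TLocalOrder n} {p : R} {G : List (Poly R n)} {B : Set (Poly R n)}

/-- The elements of degree `d` that are in the image of the ideal generated by `B` under
`t ↦ p`, up to factors prime to `p`. -/
def localPart (hp : Prime p) (B : Set (Poly R n)) (d : ℕ) :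
    Submodule R (MvPolynomial (Fin n) R) where
  carrier := {c | c.IsHomogeneous d ∧ ∃ u : R, ¬ p ∣ u ∧ u • c ∈ (Ideal.span B).map (evalT p)}
  zero_mem' := ⟨MvPolynomial.isHomogeneous_zero _ _ _, 1,
    fun h => hp.not_isUnit (isUnit_of_dvd_one h), by rw [smul_zero]; exact Ideal.zero_mem _⟩
  add_mem' := by
    rintro c c' ⟨hc, u, hu, h⟩ ⟨hc', u', hu', h'⟩
    refine ⟨hc.add hc', u * u', fun h => (hp.dvd_or_dvd h).elim hu hu', ?_⟩
    have e : (u * u') • (c + c') = MvPolynomial.C u' * (u • c) + MvPolynomial.C u * (u' • c') := by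
      simp only [MvPolynomial.smul_eq_C_mul, map_mul]; ring
    rw [e]
    exact Ideal.add_mem _ (Ideal.mul_mem_left _ _ h) (Ideal.mul_mem_left _ _ h')
  smul_mem' := by
    rintro r c ⟨hc, u, hu, h⟩
    refine ⟨Submodule.smul_mem (MvPolynomial.homogeneousSubmodule (Fin n) R d) r hc, u, hu, ?_⟩
    rw [smul_comm, MvPolynomial.smul_eq_C_mul]
    exact Ideal.mul_mem_left _ _ h

omit [IsDomain R] in
theorem evalT_mem_localPart (hp : Prime p) {g : Poly R n} {d : ℕ} (hd : g.IsHomogeneous d)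
    (hBhom : ∀ b ∈ B, XHomogeneous b) (hpt : cst p - tVar ∈ B)
    (hg : toSer g ∈ Ideal.span (toSer '' B)) (γ : Fin n →₀ ℕ) :
    MvPolynomial.monomial γ 1 * evalT p g ∈ localPart hp B (γ.degree + d) := by
  refine ⟨isHomogeneous_monomial_mul_evalT hd γ, ?_⟩
  obtain ⟨r, hr⟩ := exists_mul_mem_span hBhom hpt ⟨d, hd⟩ hg
  refine ⟨1 - p * r.eval p, fun h => hp.not_isUnit (isUnit_of_dvd_one ?_), ?_⟩
  · exact (dvd_sub_left (dvd_mul_right p _)).1 h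
  · have := Ideal.mul_mem_left _ (MvPolynomial.monomial γ 1) (Ideal.mem_map_of_mem (evalT p) hr)
    rw [map_sub, map_mul, evalT_C, Polynomial.eval_mul, Polynomial.eval_X] at this
    convert this using 1
    rw [MvPolynomial.smul_eq_C_mul, map_sub, map_one]
    ring

/-- Every nonzero polynomial is the value at `t = p` of a polynomial whose coefficients are prime
to `p`. -/
theorem exists_evalT_eq (hp : Prime p) (c : MvPolynomial (Fin n) R) :
    ∃ f : Poly R n, evalT p f = c ∧ ∀ m, pc m f ≠ 0 → ¬ p ∣ pc m f := by
  classical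
  have h : ∀ α, ∃ (k : ℕ) (w : R), MvPolynomial.coeff α c = p ^ k * w ∧ (w ≠ 0 → ¬ p ∣ w) := by
    intro α
    by_cases h0 : MvPolynomial.coeff α c = 0
    · exact ⟨0, 0, by rw [h0, mul_zero], fun h => absurd rfl h⟩
    · obtain ⟨w, h1, h2⟩ :=
        (FiniteMultiplicity.of_not_isUnit hp.not_isUnit h0).exists_eq_pow_mul_and_not_dvd
      exact ⟨_, w, h1, fun _ => h2⟩
  choose k w hkw hw using h
  refine ⟨∑ α ∈ c.support, term (k α, α) (w α), ?_, fun m hm => ?_⟩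
  · rw [map_sum]
    conv_rhs => rw [c.as_sum]
    refine Finset.sum_congr rfl fun α _ => ?_
    rw [evalT_term, hkw α, mul_comm]
  · have e : pc m (∑ α ∈ c.support, term (k α, α) (w α)) =
        ∑ α ∈ c.support, pc m (term (k α, α) (w α)) := by
      rw [pc, MvPolynomial.coeff_sum, Polynomial.finsetSum_coeff]; rfl
    rw [e] at hm ⊢
    rw [Finset.sum_eq_single m.2] at hm ⊢
    · rw [pc_term] at hm ⊢
      split_ifs at hm ⊢ with h1
      · exact hw _ hm
      · exact absurd rfl hm
    all_goals first
      | (intro α _ hα; rw [pc_term, if_neg]; rintro rfl; exact hα rfl)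
      | (intro hα; rw [pc_term]; split_ifs <;> first | rfl | skip
         by_contra h0
         apply hα
         rw [MvPolynomial.mem_support_iff, hkw]
         exact mul_ne_zero (pow_ne_zero _ hp.ne_zero) h0)

variable {ch : (Fin n →₀ ℕ) → Poly R n}

/-- Up to factors prime to `p`, every element of the ideal is a combination of the chosen
multiples of a reduced core. -/
theorem exists_smul_mem_chosen (hp : Prime p) (hBhom : ∀ b ∈ B, XHomogeneous b)
    (hpt : cst p - tVar ∈ B) (hG : IsReducedCore o p (Ideal.span (toSer '' B)) G)
    (hch : IsChoice o G ch) {d : ℕ} {c : MvPolynomial (Fin n) R} (hc : c ∈ localPart hp B d) :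
    ∃ u, ¬ p ∣ u ∧ u • c ∈ Submodule.span R (chosen o p ch '' exponents o G d) := by
  refine exists_smul_mem_of_isVLead (o := o) hp (xMonomials n d) _ (localPart hp B d) ?_
    (fun c hc α hα => mem_xMonomials.2 (isHomogeneous_iff.1 hc.1 α hα)) ?_ c hc
  · refine Submodule.span_le.2 ?_
    rintro _ ⟨α, hα, rfl⟩
    obtain ⟨h1, h2⟩ := mem_exponents.1 hα
    obtain ⟨h3, h4, -⟩ := hch α h2
    have := evalT_mem_localPart hp (xhom_degree (hG.hom _ h3) (hG.monic _ h3)) hBhom hpt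
      (hG.mem _ h3) (α - (plm o (ch α)).2)
    rwa [← map_add, tsub_add_cancel_of_le h4, h1] at this
  · rintro c ⟨hcd, u, hu, huc⟩ m hm
    -- A lift with coefficients prime to p has its leading monomial in R[t, x] equal to the p-adic
    -- one, so `cover` can be applied to it.
    obtain ⟨f, hf, hfc⟩ := exists_evalT_eq hp (u • c)
    have hum := hm.smul hp hu
    have hf0 : f ≠ 0 := by
      rintro rfl
      apply hum.1
      rw [← hf, map_zero, MvPolynomial.coeff_zero]
      exact dvd_zero _
    have hlead := isLeadMon_lm o _ (toSer_ne_zero.2 hf0)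
    have h0 := hlead.1
    rw [coeffAt_toSer] at h0
    have h1 := IsVLead.of_isLeadMon hp hlead (hfc _ h0)
    rw [hf] at h1
    have h2 := h1.eq hum
    rw [← hf] at huc
    have h3 := mem_of_evalT_mem (Ideal.subset_span hpt) huc
    obtain ⟨g, hg, hgm⟩ := hG.cover _ (toSer_mem_span h3) (by
      rw [lc, coeffAt_toSer]; exact hfc _ h0)
    rw [h2] at hgm
    have hd : m.2.degree = d := isHomogeneous_iff.1 hcd _ fun h0 => hm.1 (h0 ▸ dvd_zero _)
    have hex : m.2 ∈ exponents o G d := mem_exponents.2 ⟨hd, g, hg, hgm.2⟩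
    obtain ⟨h4, h5, h6⟩ := hch m.2 ⟨g, hg, hgm.2⟩
    obtain ⟨j, hj⟩ := Nat.exists_eq_add_of_le ((h6 g hg hgm.2).trans hgm.1)
    -- The chosen multiple has the right x-part and too small an exponent of t by j; the factor p^j
    -- stands for t^j.
    refine ⟨(p ^ j * 1) • chosen o p ch m.2,
      Submodule.smul_mem _ _ (Submodule.subset_span ⟨_, hex, rfl⟩), ?_⟩
    have := (chosen_isVLead hp hch hG.monic hex).smul_pow hp
      (fun h => hp.not_isUnit (isUnit_of_dvd_one h)) j
    rwa [show ((plm o (ch m.2)).1, m.2) + ((j, 0) : Mon n) = m from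
      Prod.ext hj.symm (add_zero _)] at this

/-- Some u f with u prime to p is a combination of chosen multiples at t = p. With a u + b p = 1,
the element f is a (u f) + b p f, and p f is the value of t f. -/
theorem IsReducedCore.isLocalCombination (hp : Prime p)
    (hunit : ∀ c : R, ¬ p ∣ c → ∃ a b, a * c + b * p = 1) (hBhom : ∀ b ∈ B, XHomogeneous b)
    (hpt : cst p - tVar ∈ B) (hG : IsReducedCore o p (Ideal.span (toSer '' B)) G)
    {f : Poly R n} (hf : f ∈ B) : IsLocalCombination {h | h = cst p - tVar ∨ h ∈ G} f := by
  obtain ⟨d, hd⟩ := hBhom f hf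
  obtain ⟨ch, hch⟩ := exists_isChoice o G
  have h1 : evalT p f ∈ localPart hp B d := ⟨isHomogeneous_evalT hd, 1,
    fun h => hp.not_isUnit (isUnit_of_dvd_one h), by
      rw [one_smul]; exact Ideal.mem_map_of_mem _ (Ideal.subset_span hf)⟩
  obtain ⟨u, hu, hmem⟩ := exists_smul_mem_chosen hp hBhom hpt hG hch h1
  obtain ⟨a, b, hab⟩ := hunit u hu
  refine mem_termSpan_of_evalT_mem (fun μ => Or.inl (Or.inl rfl)) ?_
  have e : evalT p f = a • (u • evalT p f) + b • evalT p (term (1, 0) 1 * f) := by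
    rw [evalT_term_mul, pow_one, MvPolynomial.monomial_zero', map_one, one_mul, smul_smul,
      smul_smul, ← add_smul, hab, one_smul]
  rw [e]
  refine Submodule.add_mem _ (Submodule.smul_mem _ _ ?_) (Submodule.smul_mem _ _
    (Submodule.mem_map_of_mem (f := evalTₗ p)
      (term_mul_mem_termSpan (Or.inr ⟨rfl, le_rfl, rfl⟩))))
  refine Submodule.span_le.2 ?_ hmem
  rintro _ ⟨α, hα, rfl⟩
  rw [chosen_eq]
  exact Submodule.mem_map_of_mem (f := evalTₗ p)
    (term_mul_mem_termSpan (Or.inl (Or.inr (hch α (mem_exponents.1 hα).2).1)))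

/-- At t = p write u x^a g as a combination of chosen multiples. Summands with coefficient divisible
by p come from multiples of t. The others have leading monomial at most that of x^a g, as nothing
cancels. Equality occurs only at the common x-part, where the choice is g'. -/
theorem IsReducedCore.isSReducible (hp : Prime p)
    (hunit : ∀ c : R, ¬ p ∣ c → ∃ a b, a * c + b * p = 1) (hBhom : ∀ b ∈ B, XHomogeneous b)
    (hpt : cst p - tVar ∈ B) (hG : IsReducedCore o p (Ideal.span (toSer '' B)) G)
    {g g' : Poly R n} (hg : g ∈ G) (hg' : g' ∈ G) (hle : (plm o g').1 ≤ (plm o g).1) :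
    IsSReducible o p G g g' := by
  unfold IsSReducible
  set a := sShift o g g' with ha
  have hα₀ : (plm o g').2 ≤ (plm o g).2 + a := le_add_tsub
  obtain ⟨ch, hch, hchα⟩ := exists_isChoice_apply o hg' hα₀
  have h1 := evalT_mem_localPart hp (xhom_degree (hG.hom _ hg) (hG.monic _ hg)) hBhom hpt
    (hG.mem _ hg) a
  obtain ⟨u, hu, hmem⟩ := exists_smul_mem_chosen hp hBhom hpt hG hch h1
  obtain ⟨r, hr⟩ := (Submodule.mem_span_image_finset_iff_exists_fun' R).1 hmem
  have hlead := (((hG.monic g hg).isVLead hp).monomial_mul a).smul hp hu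
  rw [← hr] at hlead
  have hmax := (hlead.le_of_sum hp (b := fun α => (plm o (ch α)).1)
    fun α hα => chosen_isVLead hp hch hG.monic hα).2
  obtain ⟨v, w, hvw⟩ := hunit u hu
  refine mem_termSpan_of_evalT_mem (fun μ => Or.inl rfl) ?_
  have e : evalT p (term (0, a) 1 * g) = v • (u • (MvPolynomial.monomial a 1 * evalT p g)) +
      w • evalT p (term (1, a) 1 * g) := by
    rw [evalT_term_mul, evalT_term_mul, pow_one, pow_zero, one_smul, smul_smul, smul_smul,
      ← add_smul, hvw, one_smul]
  rw [e]
  refine Submodule.add_mem _ (Submodule.smul_mem _ _ ?_) (Submodule.smul_mem _ _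
    (Submodule.mem_map_of_mem (f := evalTₗ p)
      (term_mul_mem_termSpan (Or.inr ⟨hg, by rw [map_add, add_comm], Or.inl le_rfl⟩))))
  rw [← hr]
  refine Submodule.sum_mem _ fun α hα => ?_
  obtain ⟨hdeg, hex⟩ := mem_exponents.1 hα
  obtain ⟨h2, h3, -⟩ := hch α hex
  have hadd : (α - (plm o (ch α)).2) + (plm o (ch α)).2 = α := tsub_add_cancel_of_le h3
  have hdeg' : (α - (plm o (ch α)).2).degree + (plm o (ch α)).2.degree =
      ((plm o g).2 + a).degree := by
    rw [← map_add, hadd, hdeg, map_add, add_comm]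
  by_cases hrα : p ∣ r α
  · obtain ⟨s, hs⟩ := hrα
    have e' : r α • chosen o p ch α =
        s • evalT p (term (1, α - (plm o (ch α)).2) 1 * ch α) := by
      rw [evalT_term_mul, pow_one, smul_smul, mul_comm s p, ← hs]; rfl
    rw [e']
    exact Submodule.smul_mem _ _ (Submodule.mem_map_of_mem (f := evalTₗ p)
      (term_mul_mem_termSpan (Or.inr ⟨h2, hdeg', Or.inl le_rfl⟩)))
  · have h4 := hmax α hα 0 (by simpa using hrα)
    rw [chosen_eq]
    refine Submodule.smul_mem _ _ (Submodule.mem_map_of_mem (f := evalTₗ p)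
      (term_mul_mem_termSpan (Or.inr ⟨h2, hdeg', Or.inr ?_⟩)))
    have e' : ((0, α - (plm o (ch α)).2) : Mon n) + plm o (ch α) =
        ((plm o (ch α)).1 + 0, α) := Prod.ext (add_comm _ _) hadd
    rcases TLocalOrder.not_lt.1 h4 with h5 | h5
    · right
      have h6 : (plm o (ch α)).1 = (plm o g).1 := by simpa using congrArg Prod.fst h5
      have h7 : α = (plm o g).2 + a := congrArg Prod.snd h5
      refine ⟨?_, hadd.trans h7⟩
      rw [← h7] at hchα
      rcases hchα with h8 | h8
      · exact h8
      -- If g' is not the choice, the chosen element has a smaller exponent of t than g', hence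
      -- smaller than g, and its lead is not equal to that of x^a g.
      · omega
    · left
      rw [e']
      exact h5

end CertificateComplete

/-! ## Computable functions and predicates -/

attribute [fun_prop] Computable

section Computability
variable {α β γ σ : Type*} [Primcodable α] [Primcodable β] [Primcodable γ] [Primcodable σ]

@[fun_prop]
theorem computable_id : Computable fun x : α => x := Computable.id

@[fun_prop]
theorem computable_const (s : σ) : Computable fun _ : α => s := Computable.const s

@[fun_prop]
theorem computable_comp {f : β → σ} {g : α → β} (hf : Computable f) (hg : Computable g) :
    Computable fun x => f (g x) := hf.comp hg

@[fun_prop]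
theorem computable_fst {f : α → β × γ} (hf : Computable f) : Computable fun x => (f x).1 :=
  Computable.fst.comp hf

@[fun_prop]
theorem computable_snd {f : α → β × γ} (hf : Computable f) : Computable fun x => (f x).2 :=
  Computable.snd.comp hf

@[fun_prop]
theorem computable_pair {f : α → β} {g : α → γ} (hf : Computable f) (hg : Computable g) :
    Computable fun x => (f x, g x) := hf.pair hg

@[fun_prop]
theorem computable_nat_add {f g : α → ℕ} (hf : Computable f) (hg : Computable g) :
    Computable fun x => f x + g x := Primrec.nat_add.to_comp.comp hf hg

@[fun_prop]
theorem computable_append {f g : α → List β} (hf : Computable f) (hg : Computable g) :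
    Computable fun x => f x ++ g x := Computable.list_append.comp hf hg

@[fun_prop]
theorem computable_cons {f : α → β} {g : α → List β} (hf : Computable f) (hg : Computable g) :
    Computable fun x => f x :: g x := Computable.list_cons.comp hf hg

theorem computable_ite {p : α → Prop} [DecidablePred p] (hp : ComputablePred p) {f g : α → σ}
    (hf : Computable f) (hg : Computable g) : Computable fun x => if p x then f x else g x :=
  (Computable.cond hp.decide hf hg).of_eq fun x => by
    by_cases h : p x <;> simp [h]

/-- Primitive recursion on the number of processed entries, the current entry being looked up by its
index. -/
theorem computable_foldl {f : α → List β} {g : α → σ} {h : α → σ → β → σ} (hf : Computable f)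
    (hg : Computable g) (hh : Computable fun y : α × σ × β => h y.1 y.2.1 y.2.2) :
    Computable fun a => (f a).foldl (h a) (g a) := by
  have h1 : Computable₂ fun (a : α) (y : ℕ × σ) => (((f a)[y.1]?).map fun b => h a y.2 b).getD y.2 := by
    refine Computable.option_getD (Computable.option_map
      (Computable.list_getElem?.comp (hf.comp Computable.fst)
        (Computable.fst.comp Computable.snd)) ?_) (Computable.snd.comp Computable.snd)
    exact hh.comp (((Computable.fst.comp Computable.fst)).pair
      ((Computable.snd.comp (Computable.snd.comp Computable.fst)).pair Computable.snd))
  have h2 := Computable.nat_rec (Computable.list_length.comp hf) hg h1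
  refine h2.of_eq fun a => ?_
  have key : ∀ k ≤ (f a).length, Nat.rec (motive := fun _ => σ) (g a)
      (fun y IH => (((f a)[y]?).map fun b => h a IH b).getD IH) k =
      ((f a).take k).foldl (h a) (g a) := by
    intro k hk
    induction k with
    | zero => simp
    | succ k ih =>
      simp only
      rw [ih (Nat.le_of_succ_le hk), List.getElem?_eq_getElem hk, List.take_succ_eq_append_getElem hk,
        List.foldl_append]
      rfl
  have := key _ le_rfl
  rw [List.take_length] at this
  exact this

@[fun_prop]
theorem computable_map {f : α → List β} {g : α → β → σ} (hf : Computable f)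
    (hg : Computable fun y : α × β => g y.1 y.2) : Computable fun a => (f a).map (g a) := by
  refine (computable_foldl (g := fun _ => []) (h := fun a s b => s ++ [g a b]) hf
    (Computable.const _) ?_).of_eq fun a => ?_
  · exact Computable.list_concat.comp (Computable.fst.comp Computable.snd)
      (hg.comp (Computable.fst.pair (Computable.snd.comp Computable.snd)))
  · have : ∀ (l : List β) (s : List σ), l.foldl (fun s b => s ++ [g a b]) s = s ++ l.map (g a) := by
      intro l
      induction l with
      | nil => simp
      | cons b l ih => intro s; simp [ih]
    rw [this, List.nil_append]

@[fun_prop]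
theorem computable_flatMap {f : α → List β} {g : α → β → List σ} (hf : Computable f)
    (hg : Computable fun y : α × β => g y.1 y.2) : Computable fun a => (f a).flatMap (g a) := by
  refine (computable_foldl (g := fun _ => []) (h := fun a s b => s ++ g a b) hf
    (Computable.const _) ?_).of_eq fun a => ?_
  · exact Computable.list_append.comp (Computable.fst.comp Computable.snd)
      (hg.comp (Computable.fst.pair (Computable.snd.comp Computable.snd)))
  · have : ∀ (l : List β) (s : List σ), l.foldl (fun s b => s ++ g a b) s =
        s ++ l.flatMap (g a) := by
      intro l
      induction l with
      | nil => simp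
      | cons b l ih => intro s; simp [ih]
    rw [this, List.nil_append]

theorem computablePred_eq {f g : α → β} (hf : Computable f) (hg : Computable g) :
    ComputablePred fun x => f x = g x := by
  obtain ⟨_, h⟩ := (Primrec.eq (α := β)).computablePred
  classical
  refine ⟨inferInstance, (h.comp (hf.pair hg)).of_eq fun x => ?_⟩
  simp

theorem computablePred_le {f g : α → ℕ} (hf : Computable f) (hg : Computable g) :
    ComputablePred fun x => f x ≤ g x := by
  obtain ⟨_, h⟩ := Primrec.nat_le.computablePred
  refine ⟨inferInstance, (h.comp (hf.pair hg)).of_eq fun x => ?_⟩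
  simp

theorem computablePred_lt {f g : α → ℕ} (hf : Computable f) (hg : Computable g) :
    ComputablePred fun x => f x < g x := computablePred_le (Computable.succ.comp hf) hg

theorem computablePred_and {p q : α → Prop} (hp : ComputablePred p) (hq : ComputablePred q) :
    ComputablePred fun x => p x ∧ q x := by
  obtain ⟨_, hp⟩ := hp
  obtain ⟨_, hq⟩ := hq
  exact ⟨inferInstance, (Primrec.and.to_comp.comp hp hq).of_eq fun x => by simp⟩

theorem computablePred_or {p q : α → Prop} (hp : ComputablePred p) (hq : ComputablePred q) :
    ComputablePred fun x => p x ∨ q x := by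
  obtain ⟨_, hp⟩ := hp
  obtain ⟨_, hq⟩ := hq
  exact ⟨inferInstance, (Primrec.or.to_comp.comp hp hq).of_eq fun x => by simp⟩

theorem computablePred_imp {p q : α → Prop} (hp : ComputablePred p) (hq : ComputablePred q) :
    ComputablePred fun x => p x → q x :=
  (computablePred_or hp.not hq).of_eq fun _ => imp_iff_not_or.symm

theorem computablePred_forall_mem {f : α → List β} {p : α → β → Prop} (hf : Computable f)
    (hp : ComputablePred fun y : α × β => p y.1 y.2) :
    ComputablePred fun x => ∀ b ∈ f x, p x b := by
  obtain ⟨_, hp⟩ := hp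
  have (x : α) (b : β) : Decidable (p x b) :=
    inferInstanceAs (Decidable ((fun y : α × β => p y.1 y.2) (x, b)))
  classical
  refine ⟨inferInstance, (computable_foldl (g := fun _ => true)
    (h := fun a s b => s && decide (p a b)) hf (Computable.const _) ?_).of_eq fun x => ?_⟩
  · refine Primrec.and.to_comp.comp (Computable.fst.comp Computable.snd)
      ((hp.comp (Computable.fst.pair (Computable.snd.comp Computable.snd))).of_eq fun y => ?_)
    simp
  · have : ∀ (l : List β) (s : Bool), l.foldl (fun s b => s && decide (p x b)) s =
        (s && decide (∀ b ∈ l, p x b)) := by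
      intro l
      induction l with
      | nil => simp
      | cons b l ih => intro s; simp [ih, Bool.and_assoc]
    rw [this, Bool.true_and]

theorem computablePred_exists_mem {f : α → List β} {p : α → β → Prop} (hf : Computable f)
    (hp : ComputablePred fun y : α × β => p y.1 y.2) :
    ComputablePred fun x => ∃ b ∈ f x, p x b :=
  (computablePred_forall_mem (p := fun x b => ¬ p x b) hf hp.not).not.of_eq
    fun x => by push Not; rfl

theorem computablePred_mem {f : α → β} {g : α → List β} (hf : Computable f) (hg : Computable g) :
    ComputablePred fun x => f x ∈ g x :=
  (computablePred_exists_mem hg (p := fun x b => f x = b)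
    (computablePred_eq (hf.comp Computable.fst) Computable.snd)).of_eq fun x => by simp

/-- Unbounded search. -/
theorem exists_computable_of_forall_exists {P : α → β → Prop}
    (hP : ComputablePred fun y : α × β => P y.1 y.2) (h : ∀ a, ∃ b, P a b) :
    ∃ f : α → β, Computable f ∧ ∀ a, P a (f a) := by
  classical
  let Q : α → ℕ → Option β := fun a k => (Encodable.decode (α := β) k).bind fun b =>
    if P a b then some b else none
  have hQ : Computable₂ Q := by
    refine Computable.option_bind (Computable.decode.comp Computable.snd) ?_
    exact computable_ite (p := fun y : (α × ℕ) × β => P y.1.1 y.2)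
      (by
        obtain ⟨_, hP⟩ := hP
        exact ⟨inferInstance, (hP.comp (((Computable.fst.comp Computable.fst)).pair
          Computable.snd)).of_eq fun y => by simp⟩)
      (Computable.option_some.comp Computable.snd) (Computable.const _)
  have hdom : ∀ a, (Nat.rfindOpt (Q a)).Dom := fun a => by
    obtain ⟨b, hb⟩ := h a
    exact Nat.rfindOpt_dom.2 ⟨Encodable.encode b, b, by simp [Q, hb]⟩
  refine ⟨fun a => (Nat.rfindOpt (Q a)).get (hdom a),
    (Partrec.rfindOpt hQ).of_eq_tot fun a => Part.get_mem _, fun a => ?_⟩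
  obtain ⟨k, hk⟩ := Nat.rfindOpt_spec (Part.get_mem (hdom a))
  simp only [Q, Option.mem_def, Option.bind_eq_some_iff] at hk
  obtain ⟨b, -, hb⟩ := hk
  split_ifs at hb with h1
  · have := Option.some_inj.1 hb
    subst this
    exact h1

end Computability

/-! ### Computability for exponents -/

section Exponents
variable {α : Type*} [Primcodable α] {n : ℕ}

theorem computable_fin_apply {f : α → Fin n → ℕ} (hf : Computable f) (i : Fin n) :
    Computable fun x => f x i :=
  Computable.fin_app.comp hf (Computable.const i)

@[fun_prop]
theorem computable_fin_add {f g : α → Fin n → ℕ} (hf : Computable f) (hg : Computable g) :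
    Computable fun x => f x + g x := by
  have : Primrec₂ fun a b : Fin n → ℕ => a + b :=
    Primrec.fin_curry.2 (Primrec.nat_add.comp
      (Primrec.fin_app.comp (Primrec.fst.comp Primrec.fst) Primrec.snd)
      (Primrec.fin_app.comp (Primrec.snd.comp Primrec.fst) Primrec.snd))
  exact this.to_comp.comp hf hg

@[fun_prop]
theorem computable_fin_sub {f g : α → Fin n → ℕ} (hf : Computable f) (hg : Computable g) :
    Computable fun x => f x - g x := by
  have : Primrec₂ fun a b : Fin n → ℕ => a - b :=
    Primrec.fin_curry.2 (Primrec.nat_sub.comp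
      (Primrec.fin_app.comp (Primrec.fst.comp Primrec.fst) Primrec.snd)
      (Primrec.fin_app.comp (Primrec.snd.comp Primrec.fst) Primrec.snd))
  exact this.to_comp.comp hf hg

@[fun_prop]
theorem computable_mon_add {f g : α → ℕ × (Fin n → ℕ)} (hf : Computable f) (hg : Computable g) :
    Computable fun x => f x + g x := by
  have : Computable fun x => ((f x).1 + (g x).1, (f x).2 + (g x).2) := by fun_prop
  exact this

/-- The total degree of an exponent. -/
def codeDegree (a : Fin n → ℕ) : ℕ := ∑ i, a i

@[fun_prop]
theorem computable_codeDegree {f : α → Fin n → ℕ} (hf : Computable f) :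
    Computable fun x => codeDegree (f x) := by
  have h : Computable fun a : Fin n → ℕ => codeDegree a := by
    refine (computable_foldl (f := fun a : Fin n → ℕ => List.ofFn a) (g := fun _ => 0)
      (h := fun _ s b => s + b)
      (Computable.list_ofFn fun i => computable_fin_apply Computable.id i)
      (Computable.const 0) (by fun_prop)).of_eq fun a => ?_
    rw [codeDegree, ← List.sum_ofFn, List.sum_eq_foldl]
  exact h.comp hf

theorem computablePred_fin_le {f g : α → Fin n → ℕ} (hf : Computable f) (hg : Computable g) :
    ComputablePred fun x => f x ≤ g x :=
  (computablePred_eq (computable_fin_sub hf hg) (Computable.const 0)).of_eq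
    fun _ => tsub_eq_zero_iff_le

theorem computablePred_mon_le {f g : α → ℕ × (Fin n → ℕ)} (hf : Computable f)
    (hg : Computable g) : ComputablePred fun x => f x ≤ g x :=
  computablePred_and (computablePred_le (by fun_prop) (by fun_prop))
    (computablePred_fin_le (by fun_prop) (by fun_prop))

theorem computablePred_order {o : TLocalOrder n} (ho : o.IsComputable)
    {f g : α → ℕ × (Fin n → ℕ)} (hf : Computable f) (hg : Computable g) :
    ComputablePred fun x => o.lt (monOf (f x)) (monOf (g x)) := by
  classical
  exact ⟨inferInstance, (ho.comp hf hg).of_eq fun x => by congr⟩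

end Exponents

/-! ## Codes of polynomials -/

section Codes
variable {R : Type u} [CommRing R] {n : ℕ}

theorem monOf_injective : Function.Injective (monOf : ℕ × (Fin n → ℕ) → Mon n) := by
  rintro ⟨a, α⟩ ⟨b, β⟩ h
  have h1 : a = b := congrArg Prod.fst h
  have h2 : α = β := Finsupp.equivFunOnFinite.symm.injective (congrArg Prod.snd h)
  rw [h1, h2]

theorem monOf_surjective : Function.Surjective (monOf : ℕ × (Fin n → ℕ) → Mon n) :=
  fun m => ⟨(m.1, m.2), Prod.ext rfl (Finsupp.equivFunOnFinite_symm_coe m.2)⟩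

theorem monOf_add (a b : ℕ × (Fin n → ℕ)) : monOf (a + b) = monOf a + monOf b :=
  Prod.ext rfl (Finsupp.ext fun _ => rfl)

@[simp]
theorem monOf_zero : monOf (0 : ℕ × (Fin n → ℕ)) = 0 := Prod.ext rfl (Finsupp.ext fun _ => rfl)

theorem monOf_le {a b : ℕ × (Fin n → ℕ)} : monOf a ≤ monOf b ↔ a ≤ b := Iff.rfl

theorem degree_monOf (a : ℕ × (Fin n → ℕ)) : (monOf a).2.degree = codeDegree a.2 := by
  rw [Finsupp.degree_eq_sum]; rfl

@[simp]
theorem decodePoly_nil : decodePoly ([] : PolyCode R n) = 0 := rfl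

@[simp]
theorem decodePoly_cons (e : R × ℕ × (Fin n → ℕ)) (L : PolyCode R n) :
    decodePoly (e :: L) = term (monOf e.2) e.1 + decodePoly L := by
  rw [decodePoly, List.map_cons, List.sum_cons]; rfl

@[simp]
theorem decodePoly_append (L L' : PolyCode R n) :
    decodePoly (L ++ L') = decodePoly L + decodePoly L' := by
  rw [decodePoly, List.map_append, List.sum_append]; rfl

open Classical in
/-- The coefficient of a monomial in the polynomial with a given code. -/
def codeCoeff (L : PolyCode R n) (m : ℕ × (Fin n → ℕ)) : R :=
  L.foldl (fun s e => if e.2 = m then s + e.1 else s) 0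

theorem pc_decodePoly (L : PolyCode R n) (m : ℕ × (Fin n → ℕ)) :
    pc (monOf m) (decodePoly L) = codeCoeff L m := by
  classical
  have : ∀ s : R, L.foldl (fun s e => if e.2 = m then s + e.1 else s) s =
      s + pc (monOf m) (decodePoly L) := by
    induction L with
    | nil => intro s; simp
    | cons e L ih =>
      intro s
      rw [List.foldl_cons, ih, decodePoly_cons, pc_add, pc_term]
      simp only [monOf_injective.eq_iff]
      split_ifs <;> ring
  rw [codeCoeff]
  convert (this 0).symm using 1
  rw [zero_add]

theorem codeCoeff_eq_zero_of_forall {L : PolyCode R n} {m : ℕ × (Fin n → ℕ)}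
    (h : ∀ e ∈ L, e.2 ≠ m) : codeCoeff L m = 0 := by
  rw [← pc_decodePoly]
  induction L with
  | nil => simp
  | cons e L ih =>
    rw [decodePoly_cons, pc_add, pc_term,
      if_neg fun h' => h e List.mem_cons_self (monOf_injective h'), zero_add]
    exact ih fun e he => h e (List.mem_cons_of_mem _ he)

theorem exists_mem_of_pc_ne_zero {L : PolyCode R n} {m : Mon n} (h : pc m (decodePoly L) ≠ 0) :
    ∃ e ∈ L, monOf e.2 = m := by
  obtain ⟨m, rfl⟩ := monOf_surjective m
  rw [pc_decodePoly] at h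
  by_contra! hne
  exact h (codeCoeff_eq_zero_of_forall fun e he h' => hne e he (h' ▸ rfl))

/-- The polynomial with the code `L` is zero. -/
def IsZeroCode (L : PolyCode R n) : Prop := ∀ e ∈ L, codeCoeff L e.2 = 0

/-- A monomial not listed in the code has coefficient 0, so finitely many tests suffice. Codes may
list a monomial repeatedly. -/
theorem isZeroCode_iff {L : PolyCode R n} : IsZeroCode L ↔ decodePoly L = 0 := by
  constructor
  · intro h
    by_contra h0
    obtain ⟨m, hm⟩ := exists_pc_ne_zero h0
    obtain ⟨e, he, rfl⟩ := exists_mem_of_pc_ne_zero hm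
    exact hm ((pc_decodePoly L e.2).trans (h e he))
  · intro h e _
    rw [← pc_decodePoly, h, pc_zero]

/-- The code of the product with a term. -/
def shiftCode (e : R × ℕ × (Fin n → ℕ)) (L : PolyCode R n) : PolyCode R n :=
  L.map fun e' => (e.1 * e'.1, e.2 + e'.2)

theorem decodePoly_shiftCode (e : R × ℕ × (Fin n → ℕ)) (L : PolyCode R n) :
    decodePoly (shiftCode e L) = term (monOf e.2) e.1 * decodePoly L := by
  induction L with
  | nil => simp [shiftCode]
  | cons e' L ih =>
    rw [shiftCode, List.map_cons, decodePoly_cons, decodePoly_cons, mul_add, term_mul_term,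
      ← monOf_add, ← ih]
    rfl

/-- The code of a sum of products with terms. -/
def combination (W : List ((R × ℕ × (Fin n → ℕ)) × PolyCode R n)) : PolyCode R n :=
  W.flatMap fun w => shiftCode w.1 w.2

theorem decodePoly_combination_cons (w : (R × ℕ × (Fin n → ℕ)) × PolyCode R n)
    (W : List ((R × ℕ × (Fin n → ℕ)) × PolyCode R n)) :
    decodePoly (combination (w :: W)) =
      term (monOf w.1.2) w.1.1 * decodePoly w.2 + decodePoly (combination W) := by
  rw [combination, List.flatMap_cons, decodePoly_append, decodePoly_shiftCode]; rfl

/-- `W` is a representation of `-f` as a sum of products `t^β x^α · h` with `Q (β, α) h`. -/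
def IsRepresentation (Q : ℕ × (Fin n → ℕ) → PolyCode R n → Prop) (f : PolyCode R n)
    (W : List ((R × ℕ × (Fin n → ℕ)) × PolyCode R n)) : Prop :=
  IsZeroCode (f ++ combination W) ∧ ∀ w ∈ W, Q w.1.2 w.2

/-- The condition on polynomials that corresponds to a condition on codes. -/
def decodedRel (Q : ℕ × (Fin n → ℕ) → PolyCode R n → Prop) (μ : Mon n) (h : Poly R n) : Prop :=
  ∃ m c, monOf m = μ ∧ decodePoly c = h ∧ Q m c

/-- A representation stores -f, so that its verification is a single zero test. The scalars of an
R-linear combination are absorbed into the coefficients of the terms. -/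
theorem exists_isRepresentation_iff {Q : ℕ × (Fin n → ℕ) → PolyCode R n → Prop}
    {f : PolyCode R n} :
    (∃ W, IsRepresentation Q f W) ↔ decodePoly f ∈ termSpan (decodedRel Q) := by
  constructor
  · rintro ⟨W, h0, hW⟩
    rw [isZeroCode_iff, decodePoly_append, add_eq_zero_iff_eq_neg] at h0
    rw [h0]
    refine Submodule.neg_mem _ ?_
    clear h0
    induction W with
    | nil => exact Submodule.zero_mem _
    | cons w W ih =>
      rw [decodePoly_combination_cons]
      refine Submodule.add_mem _ ?_ (ih fun w hw => hW w (List.mem_cons_of_mem _ hw))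
      have : term (monOf w.1.2) w.1.1 * decodePoly w.2 =
          w.1.1 • (term (monOf w.1.2) 1 * decodePoly w.2) := by
        rw [← smul_mul_assoc, smul_term, mul_one]
      rw [this]
      exact Submodule.smul_mem _ _
        (term_mul_mem_termSpan ⟨_, _, rfl, rfl, hW w List.mem_cons_self⟩)
  · intro h
    have key : ∀ x ∈ termSpan (decodedRel Q), ∃ W,
        (x + decodePoly (combination W) = 0) ∧ ∀ w ∈ W, Q w.1.2 w.2 := by
      intro x hx
      induction hx using Submodule.span_induction with
      | mem x hx =>
        obtain ⟨_, _, ⟨m, c, rfl, rfl, hQ⟩, rfl⟩ := hx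
        refine ⟨[((-1, m), c)], ?_, fun w hw => ?_⟩
        · rw [decodePoly_combination_cons]
          have : term (monOf m) (-1 : R) = - term (monOf m) 1 := by simp [term]
          simp only [this, combination, List.flatMap_nil, decodePoly_nil]
          ring
        · rw [List.mem_singleton.1 hw]; exact hQ
      | zero => exact ⟨[], by simp [combination], by simp⟩
      | add x y _ _ hx hy =>
        obtain ⟨W, h1, h2⟩ := hx
        obtain ⟨W', h1', h2'⟩ := hy
        refine ⟨W ++ W', ?_, fun w hw => (List.mem_append.1 hw).elim (h2 w) (h2' w)⟩
        rw [combination, List.flatMap_append, decodePoly_append]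
        have := congrArg₂ (· + ·) h1 h1'
        simp only [add_zero] at this
        rw [← this, combination, combination]
        ring
      | smul r x _ hx =>
        obtain ⟨W, h1, h2⟩ := hx
        refine ⟨W.map fun w => ((r * w.1.1, w.1.2), w.2), ?_, fun w hw => ?_⟩
        · have : decodePoly (combination (W.map fun w => ((r * w.1.1, w.1.2), w.2))) =
              r • decodePoly (combination W) := by
            clear h1 h2
            induction W with
            | nil => simp [combination]
            | cons w W ih =>
              rw [List.map_cons, decodePoly_combination_cons, ih, decodePoly_combination_cons,
                smul_add, ← smul_mul_assoc, smul_term]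
          rw [this, ← smul_add, h1, smul_zero]
        · obtain ⟨w', hw', rfl⟩ := List.mem_map.1 hw
          exact h2 w' hw'
    obtain ⟨W, h1, h2⟩ := key _ h
    exact ⟨W, isZeroCode_iff.2 (by rw [decodePoly_append, h1]), h2⟩

theorem exists_decodePoly_eq (f : Poly R n) :
    ∃ L : PolyCode R n, decodePoly L = f ∧ ∀ e ∈ L, pc (monOf e.2) f ≠ 0 := by
  let L : PolyCode R n := f.support.toList.flatMap fun α =>
    (MvPolynomial.coeff α f).support.toList.map fun k =>
      ((MvPolynomial.coeff α f).coeff k, k, (α : Fin n → ℕ))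
  have hmon : ∀ (k : ℕ) (α : Fin n →₀ ℕ), monOf (k, (α : Fin n → ℕ)) = (k, α) := fun k α =>
    Prod.ext rfl (Finsupp.equivFunOnFinite_symm_coe α)
  refine ⟨L, ?_, fun e he => ?_⟩
  · have h1 : ∀ A : List (Fin n →₀ ℕ), decodePoly (A.flatMap fun α =>
        (MvPolynomial.coeff α f).support.toList.map fun k =>
          ((MvPolynomial.coeff α f).coeff k, k, (α : Fin n → ℕ))) =
        (A.map fun α => MvPolynomial.monomial α (MvPolynomial.coeff α f)).sum := by
      intro A
      induction A with
      | nil => rfl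
      | cons α A ih =>
        rw [List.flatMap_cons, decodePoly_append, ih, List.map_cons, List.sum_cons]
        congr 1
        have h2 : ∀ K : List ℕ, decodePoly (K.map fun k =>
            ((MvPolynomial.coeff α f).coeff k, k, (α : Fin n → ℕ))) =
            MvPolynomial.monomial α
              (K.map fun k => Polynomial.monomial k ((MvPolynomial.coeff α f).coeff k)).sum := by
          intro K
          induction K with
          | nil => simp
          | cons k K ih =>
            rw [List.map_cons, decodePoly_cons, ih, List.map_cons, List.sum_cons, map_add, hmon]
            rfl
        rw [h2, Finset.sum_map_toList, ← Polynomial.as_sum_support]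
    rw [h1, Finset.sum_map_toList, ← MvPolynomial.as_sum]
  · obtain ⟨α, hα, he⟩ := List.mem_flatMap.1 he
    obtain ⟨k, hk, rfl⟩ := List.mem_map.1 he
    rw [hmon]
    exact Polynomial.mem_support_iff.1 (Finset.mem_toList.1 hk)

theorem exists_lists_of_forall_exists {A C : Type*} {Q : A → C → Prop} (L : List A)
    (h : ∀ a ∈ L, ∃ c, Q a c) : ∃ K : List C, ∀ a ∈ L, ∃ c ∈ K, Q a c := by
  induction L with
  | nil => exact ⟨[], by simp⟩
  | cons a L ih =>
    obtain ⟨K, hK⟩ := ih fun a ha => h a (List.mem_cons_of_mem _ ha)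
    obtain ⟨c, hc⟩ := h a List.mem_cons_self
    refine ⟨c :: K, fun b hb => ?_⟩
    rcases List.mem_cons.1 hb with rfl | hb
    · exact ⟨c, List.mem_cons_self, hc⟩
    · obtain ⟨d, hd, hQ⟩ := hK b hb
      exact ⟨d, List.mem_cons_of_mem _ hd, hQ⟩

end Codes

/-! ### Computability for codes of polynomials -/

section CodesComputable
variable {R : Type u} [CommRing R] [Primcodable R] {n : ℕ} {α : Type*} [Primcodable α]

theorem computable_codeCoeff (hR : LinearEquationsSolvable R) {f : α → PolyCode R n}
    {g : α → ℕ × (Fin n → ℕ)} (hf : Computable f) (hg : Computable g) :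
    Computable fun x => codeCoeff (f x) (g x) := by
  classical
  have hadd : ∀ {β : Type _} [Primcodable β] {f g : β → R}, Computable f → Computable g →
    Computable fun x => f x + g x := fun hf hg => hR.add.comp hf hg
  refine (computable_foldl (g := fun _ => (0 : R))
    (h := fun x s e => if e.2 = g x then s + e.1 else s) hf (Computable.const 0) ?_).of_eq
    fun x => ?_
  · exact computable_ite (p := fun y : α × R × (R × ℕ × (Fin n → ℕ)) => y.2.2.2 = g y.1)
      (computablePred_eq (by fun_prop) (by fun_prop)) (hadd (by fun_prop) (by fun_prop))
      (by fun_prop)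
  · rw [codeCoeff]

theorem computable_shiftCode (hR : LinearEquationsSolvable R) {f : α → R × ℕ × (Fin n → ℕ)}
    {g : α → PolyCode R n} (hf : Computable f) (hg : Computable g) :
    Computable fun x => shiftCode (f x) (g x) := by
  have hmul : Computable fun y : α × (R × ℕ × (Fin n → ℕ)) => (f y.1).1 * y.2.1 :=
    hR.mul.comp (by fun_prop) (by fun_prop)
  unfold shiftCode
  fun_prop

theorem computable_combination (hR : LinearEquationsSolvable R)
    {f : α → List ((R × ℕ × (Fin n → ℕ)) × PolyCode R n)} (hf : Computable f) :
    Computable fun x => combination (f x) := by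
  unfold combination
  exact computable_flatMap hf (computable_shiftCode hR (by fun_prop) (by fun_prop))

theorem computablePred_isZeroCode (hR : LinearEquationsSolvable R) {f : α → PolyCode R n}
    (hf : Computable f) : ComputablePred fun x => IsZeroCode (f x) := by
  unfold IsZeroCode
  exact computablePred_forall_mem hf (computablePred_eq
    (computable_codeCoeff hR (by fun_prop) (by fun_prop)) (by fun_prop))

theorem computablePred_isRepresentation (hR : LinearEquationsSolvable R)
    {Q : α → ℕ × (Fin n → ℕ) → PolyCode R n → Prop} {f : α → PolyCode R n}
    {W : α → List ((R × ℕ × (Fin n → ℕ)) × PolyCode R n)}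
    (hQ : ComputablePred fun y : α × ((R × ℕ × (Fin n → ℕ)) × PolyCode R n) =>
      Q y.1 y.2.1.2 y.2.2) (hf : Computable f) (hW : Computable W) :
    ComputablePred fun x => IsRepresentation (Q x) (f x) (W x) := by
  have := computable_combination hR hW
  exact computablePred_and (computablePred_isZeroCode hR (by fun_prop))
    (computablePred_forall_mem hW hQ)

/-- Divisibility by p is membership in an ideal with one generator. -/
theorem computablePred_dvd (hR : LinearEquationsSolvable R) (p : R) {f : α → R}
    (hf : Computable f) : ComputablePred fun x => p ∣ f x := by
  obtain ⟨solve, hc, hsolve⟩ := hR.membership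
  have h : ComputablePred fun x => ¬ solve (f x, [p]) = none :=
    (computablePred_eq (hc.comp (by fun_prop)) (by fun_prop)).not
  refine h.of_eq fun x => ?_
  obtain ⟨h1, h2⟩ := hsolve (f x) [p]
  constructor
  · intro h
    obtain ⟨a, ha⟩ := Option.ne_none_iff_exists'.1 h
    obtain ⟨h3, h4⟩ := h1 a ha
    obtain ⟨b, rfl⟩ := List.length_eq_one_iff.1 h3
    exact ⟨b, by rw [← h4, mul_comm]; simp⟩
  · intro h hnone
    refine h2 hnone ?_
    have : {x | x ∈ [p]} = {p} := by ext; simp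
    rw [this]
    exact Ideal.mem_span_singleton.2 h

end CodesComputable

/-! ## Certificates for initially reduced standard bases -/

section CertificateDef
variable {R : Type u} [CommRing R] {n : ℕ}

/-- The code of a polynomial with leading term `t^β x^α`, for a pair of `(β, α)` and a code of the
tail. -/
def leadCode (x : (ℕ × (Fin n → ℕ)) × PolyCode R n) : PolyCode R n := (1, x.1) :: x.2

/-- A code of `p - t`. -/
def pMinusTCode (n : ℕ) (p : R) : PolyCode R n := [(p, (0, 0)), (-1, (1, 0))]

theorem decodePoly_pMinusTCode (p : R) :
    decodePoly (pMinusTCode n p) = (cst p - tVar : Poly R n) := by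
  have h0 : monOf ((0, 0) : ℕ × (Fin n → ℕ)) = (0, 0) := monOf_zero
  have h1 : monOf ((1, 0) : ℕ × (Fin n → ℕ)) = (1, 0) := Prod.ext rfl (Finsupp.ext fun _ => rfl)
  have h2 : Polynomial.monomial 1 (-1 : R) = -X := by
    rw [map_neg, Polynomial.monomial_one_one_eq_X]
  rw [pMinusTCode, decodePoly_cons, decodePoly_cons, decodePoly_nil, h0, h1, add_zero, cst, tVar,
    term, term, h2, Polynomial.monomial_zero_left, ← MvPolynomial.C_apply, ← MvPolynomial.C_apply,
    map_neg, sub_eq_add_neg]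

/-- The code has the right leading monomial, is homogeneous in `x`, and is initially reduced with
respect to the leading monomials of the other codes. -/
def IsValidLead (o : TLocalOrder n) (p : R) (L : List ((ℕ × (Fin n → ℕ)) × PolyCode R n))
    (x : (ℕ × (Fin n → ℕ)) × PolyCode R n) : Prop :=
  x.1 ≠ 0 ∧
  (∀ e ∈ x.2, o.lt (monOf e.2) (monOf x.1) ∧ codeDegree e.2.2 = codeDegree x.1.2) ∧
  (∀ e ∈ leadCode x, e.2.2 = x.1.2 ∨
    (∃ e' ∈ leadCode x, e'.2.2 = e.2.2 ∧ e'.2.1 < e.2.1 ∧ codeCoeff (leadCode x) e'.2 ≠ 0) ∨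
    ¬ p ∣ codeCoeff (leadCode x) e.2 ∧ ∀ y ∈ L, ¬ y.1 ≤ e.2) ∧
  ∀ y ∈ L, y.1 ≤ x.1 → y = x

/-- The terms allowed in a representation of `f` by `B` up to multiples of `t`. -/
def localRel (B : List (PolyCode R n)) (f : PolyCode R n) (m : ℕ × (Fin n → ℕ))
    (h : PolyCode R n) : Prop := h ∈ B ∨ h = f ∧ 1 ≤ m.1 ∧ m.2 = 0

/-- The terms allowed in the reduction for the pair `x`, `y`. -/
def reductionRel (o : TLocalOrder n) (p : R) (L : List ((ℕ × (Fin n → ℕ)) × PolyCode R n))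
    (x y : (ℕ × (Fin n → ℕ)) × PolyCode R n) (m : ℕ × (Fin n → ℕ)) (h : PolyCode R n) : Prop :=
  h = pMinusTCode n p ∨ ∃ z ∈ L, h = leadCode z ∧
    codeDegree m.2 + codeDegree z.1.2 = codeDegree (x.1.2 + (y.1.2 - x.1.2)) ∧
    (1 ≤ m.1 ∨ o.lt (monOf (m + z.1)) (monOf (x.1 + (0, y.1.2 - x.1.2))) ∨
      z = y ∧ m.2 + z.1.2 = x.1.2 + (y.1.2 - x.1.2))

/-- `Ws` contains representations that prove that the codes in `L` form, together with `p - t`,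
an initially reduced standard basis of the ideal generated by `F`. -/
def IsCertificate (o : TLocalOrder n) (p : R) (F : List (PolyCode R n))
    (L : List ((ℕ × (Fin n → ℕ)) × PolyCode R n))
    (Ws : List (List ((R × ℕ × (Fin n → ℕ)) × PolyCode R n))) : Prop :=
  (∀ x ∈ L, IsValidLead o p L x) ∧
  (∀ x ∈ L, ∃ W ∈ Ws, IsRepresentation (localRel F (leadCode x)) (leadCode x) W) ∧
  (∀ f ∈ F, ∃ W ∈ Ws,
    IsRepresentation (localRel (pMinusTCode n p :: L.map leadCode) f) f W) ∧
  ∀ x ∈ L, ∀ y ∈ L, y.1.1 ≤ x.1.1 → ∃ W ∈ Ws, IsRepresentation (reductionRel o p L x y)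
    (shiftCode (1, (0, y.1.2 - x.1.2)) (leadCode x)) W

/-- The code is a code of an admissible input. -/
def IsInputCode (p : R) (F : List (PolyCode R n)) : Prop :=
  (∀ f ∈ F, ∀ e ∈ f, ∀ e' ∈ f, codeCoeff f e.2 = 0 ∨ codeCoeff f e'.2 = 0 ∨
    codeDegree e.2.2 = codeDegree e'.2.2) ∧
  ∃ f ∈ F, IsZeroCode (f ++ shiftCode (-1, 0) (pMinusTCode n p))

theorem isInputCode_iff {p : R} {F : List (PolyCode R n)} :
    IsInputCode p F ↔ IsInput p (F.map decodePoly) := by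
  unfold IsInputCode IsInput
  refine and_congr ?_ ?_
  · rw [List.forall_mem_map]
    refine forall₂_congr fun f _ => ?_
    constructor
    · intro h
      by_cases h0 : decodePoly f = 0
      · exact ⟨0, by rw [h0]; exact MvPolynomial.isHomogeneous_zero _ _ _⟩
      obtain ⟨m, hm⟩ := exists_pc_ne_zero h0
      refine ⟨m.2.degree, isHomogeneous_iff.2 fun α hα => ?_⟩
      have h1 := (isInitial_natTrailingDegree hα).pc_ne_zero
      obtain ⟨e, he, rfl⟩ := exists_mem_of_pc_ne_zero hm
      obtain ⟨e', he', h2⟩ := exists_mem_of_pc_ne_zero h1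
      rw [← h2, pc_decodePoly] at h1
      rw [pc_decodePoly] at hm
      have h3 : α = (monOf e'.2).2 := by rw [h2]
      rw [h3, degree_monOf, degree_monOf]
      rcases h e he e' he' with h | h | h
      · exact absurd h hm
      · exact absurd h h1
      · exact h.symm
    · rintro ⟨d, hd⟩ e he e' he'
      have key : ∀ e : R × ℕ × (Fin n → ℕ), codeCoeff f e.2 ≠ 0 → codeDegree e.2.2 = d := by
        intro e h
        rw [← degree_monOf]
        refine isHomogeneous_iff.1 hd _ fun h0 => h ?_
        rw [← pc_decodePoly, pc, h0, Polynomial.coeff_zero]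
      by_cases h1 : codeCoeff f e.2 = 0
      · exact Or.inl h1
      by_cases h2 : codeCoeff f e'.2 = 0
      · exact Or.inr (Or.inl h2)
      · exact Or.inr (Or.inr ((key e h1).trans (key e' h2).symm))
  · rw [List.mem_map]
    refine exists_congr fun f => and_congr_right fun _ => ?_
    have : term (0 : Mon n) (-1 : R) = -1 := by
      simp [term, ← MvPolynomial.C_apply]
    rw [isZeroCode_iff, decodePoly_append, decodePoly_shiftCode, decodePoly_pMinusTCode, monOf_zero,
      this]
    exact ⟨fun h => by linear_combination h, fun h => by linear_combination h⟩

/-- The output `y.1` is correct for the input `F`, as witnessed by `y.2`, or `F` is not an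
admissible input. -/
def IsAcceptable (o : TLocalOrder n) (p : R) (F : List (PolyCode R n))
    (y : List (PolyCode R n) × List ((ℕ × (Fin n → ℕ)) × PolyCode R n) ×
      List (List ((R × ℕ × (Fin n → ℕ)) × PolyCode R n))) : Prop :=
  ¬ IsInputCode p F ∨
  (y.1 = [[(1, 0)]] ∧ ∃ W ∈ y.2.2, IsRepresentation (localRel F [(1, 0)]) [(1, 0)] W) ∨
  y.1 = y.2.1.map leadCode ++ [pMinusTCode n p] ∧ IsCertificate o p F y.2.1 y.2.2

end CertificateDef

/-! ### Certificates can be checked effectively -/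

section CertificateComputable
variable {R : Type u} [CommRing R] [Primcodable R] {n : ℕ} {α : Type*} [Primcodable α]

@[fun_prop]
theorem computable_leadCode {f : α → (ℕ × (Fin n → ℕ)) × PolyCode R n} (hf : Computable f) :
    Computable fun x => leadCode (f x) := by
  unfold leadCode
  fun_prop

omit [CommRing R] in
theorem computablePred_localRel {B : α → List (PolyCode R n)} {f h : α → PolyCode R n}
    {m : α → ℕ × (Fin n → ℕ)} (hB : Computable B) (hf : Computable f) (hm : Computable m)
    (hh : Computable h) : ComputablePred fun x => localRel (B x) (f x) (m x) (h x) :=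
  computablePred_or (computablePred_mem hh hB) (computablePred_and (computablePred_eq hh hf)
    (computablePred_and (computablePred_le (by fun_prop) (by fun_prop))
      (computablePred_eq (by fun_prop) (by fun_prop))))

theorem computablePred_reductionRel {o : TLocalOrder n} (ho : o.IsComputable) (p : R)
    {L : α → List ((ℕ × (Fin n → ℕ)) × PolyCode R n)}
    {f g : α → (ℕ × (Fin n → ℕ)) × PolyCode R n} {m : α → ℕ × (Fin n → ℕ)}
    {h : α → PolyCode R n} (hL : Computable L) (hf : Computable f) (hg : Computable g)
    (hm : Computable m) (hh : Computable h) :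
    ComputablePred fun x => reductionRel o p (L x) (f x) (g x) (m x) (h x) := by
  refine computablePred_or (computablePred_eq hh (by fun_prop))
    (computablePred_exists_mem hL (computablePred_and ?_ (computablePred_and ?_
      (computablePred_or ?_ (computablePred_or ?_ (computablePred_and ?_ ?_))))))
  · exact computablePred_eq (by fun_prop) (by fun_prop)
  · exact computablePred_eq (by fun_prop) (by fun_prop)
  · exact computablePred_le (by fun_prop) (by fun_prop)
  · exact computablePred_order ho (by fun_prop) (by fun_prop)
  · exact computablePred_eq (by fun_prop) (by fun_prop)
  · exact computablePred_eq (by fun_prop) (by fun_prop)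

theorem computablePred_isValidLead (hR : LinearEquationsSolvable R) {o : TLocalOrder n}
    (ho : o.IsComputable) (p : R) {L : α → List ((ℕ × (Fin n → ℕ)) × PolyCode R n)}
    {f : α → (ℕ × (Fin n → ℕ)) × PolyCode R n} (hL : Computable L) (hf : Computable f) :
    ComputablePred fun x => IsValidLead o p (L x) (f x) := by
  refine computablePred_and ?_ (computablePred_and (computablePred_forall_mem (by fun_prop)
    (computablePred_and ?_ ?_)) (computablePred_and (computablePred_forall_mem (by fun_prop)
      (computablePred_or ?_ (computablePred_or (computablePred_exists_mem (by fun_prop)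
        (computablePred_and ?_ (computablePred_and ?_ ?_)))
        (computablePred_and ?_ (computablePred_forall_mem (by fun_prop) ?_)))))
    (computablePred_forall_mem hL (computablePred_imp ?_ ?_))))
  · exact (computablePred_eq (by fun_prop) (by fun_prop)).not
  · exact computablePred_order ho (by fun_prop) (by fun_prop)
  · exact computablePred_eq (by fun_prop) (by fun_prop)
  · exact computablePred_eq (by fun_prop) (by fun_prop)
  · exact computablePred_eq (by fun_prop) (by fun_prop)
  · exact computablePred_lt (by fun_prop) (by fun_prop)
  · exact (computablePred_eq (computable_codeCoeff hR (by fun_prop) (by fun_prop))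
      (by fun_prop)).not
  · exact (computablePred_dvd hR p (computable_codeCoeff hR (by fun_prop) (by fun_prop))).not
  · exact (computablePred_mon_le (by fun_prop) (by fun_prop)).not
  · exact computablePred_mon_le (by fun_prop) (by fun_prop)
  · exact computablePred_eq (by fun_prop) (by fun_prop)

theorem computablePred_isCertificate (hR : LinearEquationsSolvable R) {o : TLocalOrder n}
    (ho : o.IsComputable) (p : R) {F : α → List (PolyCode R n)}
    {L : α → List ((ℕ × (Fin n → ℕ)) × PolyCode R n)}
    {Ws : α → List (List ((R × ℕ × (Fin n → ℕ)) × PolyCode R n))} (hF : Computable F)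
    (hL : Computable L) (hW : Computable Ws) :
    ComputablePred fun x => IsCertificate o p (F x) (L x) (Ws x) := by
  refine computablePred_and (computablePred_forall_mem hL ?_) (computablePred_and
    (computablePred_forall_mem hL (computablePred_exists_mem (by fun_prop) ?_))
    (computablePred_and (computablePred_forall_mem hF
      (computablePred_exists_mem (by fun_prop) ?_))
    (computablePred_forall_mem hL (computablePred_forall_mem (by fun_prop)
      (computablePred_imp ?_ (computablePred_exists_mem (by fun_prop) ?_))))))
  · exact computablePred_isValidLead hR ho p (by fun_prop) (by fun_prop)
  · exact computablePred_isRepresentation hR (computablePred_localRel (by fun_prop) (by fun_prop)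
      (by fun_prop) (by fun_prop)) (by fun_prop) (by fun_prop)
  · exact computablePred_isRepresentation hR (computablePred_localRel (by fun_prop) (by fun_prop)
      (by fun_prop) (by fun_prop)) (by fun_prop) (by fun_prop)
  · exact computablePred_le (by fun_prop) (by fun_prop)
  · exact computablePred_isRepresentation hR (computablePred_reductionRel ho p (by fun_prop)
      (by fun_prop) (by fun_prop) (by fun_prop) (by fun_prop))
      (computable_shiftCode hR (by fun_prop) (by fun_prop)) (by fun_prop)

theorem computablePred_isInputCode (hR : LinearEquationsSolvable R) (p : R)
    {F : α → List (PolyCode R n)} (hF : Computable F) :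
    ComputablePred fun x => IsInputCode p (F x) := by
  refine computablePred_and (computablePred_forall_mem hF (computablePred_forall_mem (by fun_prop)
    (computablePred_forall_mem (by fun_prop) (computablePred_or ?_ (computablePred_or ?_ ?_)))))
    (computablePred_exists_mem hF (computablePred_isZeroCode hR ?_))
  · exact computablePred_eq (computable_codeCoeff hR (by fun_prop) (by fun_prop)) (by fun_prop)
  · exact computablePred_eq (computable_codeCoeff hR (by fun_prop) (by fun_prop)) (by fun_prop)
  · exact computablePred_eq (by fun_prop) (by fun_prop)
  · exact computable_append (by fun_prop) (computable_shiftCode hR (by fun_prop) (by fun_prop))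

theorem computablePred_isAcceptable (hR : LinearEquationsSolvable R) {o : TLocalOrder n}
    (ho : o.IsComputable) (p : R) {F : α → List (PolyCode R n)}
    {Y : α → List (PolyCode R n) × List ((ℕ × (Fin n → ℕ)) × PolyCode R n) ×
      List (List ((R × ℕ × (Fin n → ℕ)) × PolyCode R n))} (hF : Computable F)
    (hY : Computable Y) : ComputablePred fun x => IsAcceptable o p (F x) (Y x) := by
  refine computablePred_or (computablePred_isInputCode hR p hF).not (computablePred_or
    (computablePred_and ?_ (computablePred_exists_mem (by fun_prop) ?_))
    (computablePred_and ?_ (computablePred_isCertificate hR ho p hF (by fun_prop) (by fun_prop))))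
  · exact computablePred_eq (by fun_prop) (by fun_prop)
  · exact computablePred_isRepresentation hR (computablePred_localRel (by fun_prop) (by fun_prop)
      (by fun_prop) (by fun_prop)) (by fun_prop) (by fun_prop)
  · exact computablePred_eq (by fun_prop) (by fun_prop)

end CertificateComputable

/-! ### Certificates prove correctness and exist for correct outputs -/

section CertificateCorrect
variable {R : Type u} [CommRing R] {n : ℕ} {o : TLocalOrder n} {p : R}
  {F : List (PolyCode R n)} {L : List ((ℕ × (Fin n → ℕ)) × PolyCode R n)}
  {Ws : List (List ((R × ℕ × (Fin n → ℕ)) × PolyCode R n))}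

theorem isMonicAt_leadCode {x : (ℕ × (Fin n → ℕ)) × PolyCode R n}
    (h : ∀ e ∈ x.2, o.lt (monOf e.2) (monOf x.1)) :
    IsMonicAt o (decodePoly (leadCode x)) (monOf x.1) := by
  have key : ∀ m, ¬ o.lt m (monOf x.1) → pc m (decodePoly x.2) = 0 := by
    intro m hm
    by_contra h0
    obtain ⟨e, he, rfl⟩ := exists_mem_of_pc_ne_zero h0
    exact hm (h e he)
  rw [leadCode]
  constructor
  · rw [decodePoly_cons, pc_add, pc_term_self, key _ (o.lt_irrefl _), add_zero]
  · intro m hm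
    rw [decodePoly_cons, pc_add, pc_term, if_neg (TLocalOrder.ne_of_lt hm),
      key _ (TLocalOrder.lt_asymm hm), add_zero]

theorem xHomogeneous_leadCode {x : (ℕ × (Fin n → ℕ)) × PolyCode R n}
    (h : ∀ e ∈ x.2, codeDegree e.2.2 = codeDegree x.1.2) :
    XHomogeneous (decodePoly (leadCode x)) := by
  refine ⟨codeDegree x.1.2, isHomogeneous_iff.2 fun α hα => ?_⟩
  obtain ⟨e, he, h1⟩ := exists_mem_of_pc_ne_zero (isInitial_natTrailingDegree hα).pc_ne_zero
  have h2 : α = (monOf e.2).2 := by rw [h1]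
  rw [h2, degree_monOf]
  rcases List.mem_cons.1 he with rfl | he
  · rfl
  · exact h e he

/-- The meaning of initial reducedness for codes. -/
theorem IsValidLead.of_isInitial [Nontrivial R] {x : (ℕ × (Fin n → ℕ)) × PolyCode R n}
    (h : IsValidLead o p L x) {m : Mon n} (hm : IsInitial (decodePoly (leadCode x)) m) :
    m = monOf x.1 ∨
      ¬ p ∣ pc m (decodePoly (leadCode x)) ∧ ∀ y ∈ L, ¬ monOf y.1 ≤ m := by
  obtain ⟨e, he, rfl⟩ := exists_mem_of_pc_ne_zero hm.pc_ne_zero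
  rcases h.2.2.1 e he with h1 | ⟨e', -, h2, h3, h4⟩ | ⟨h2, h3⟩
  · left
    refine hm.eq_of_snd_eq (isMonicAt_leadCode (o := o) fun e he => (h.2.1 e he).1).isInitial ?_
    exact congrArg Finsupp.equivFunOnFinite.symm h1
  -- In this alternative a lower power of t occurs with the same x-part, so the monomial is not
  -- initial.
  · refine absurd ((X_pow_dvd_coeff_iff _ _ _).1 hm.1 _ h3) ?_
    rw [← pc_decodePoly] at h4
    have : monOf e'.2 = (e'.2.1, (monOf e.2).2) :=
      Prod.ext rfl (congrArg Finsupp.equivFunOnFinite.symm h2)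
    rwa [this] at h4
  · right
    rw [pc_decodePoly]
    exact ⟨h2, fun y hy => h3 y hy⟩

theorem IsLocalCombination.of_isRepresentation {B : List (PolyCode R n)} {f : PolyCode R n}
    {W : List ((R × ℕ × (Fin n → ℕ)) × PolyCode R n)}
    (h : IsRepresentation (localRel B f) f W) :
    IsLocalCombination {h | h ∈ B.map decodePoly} (decodePoly f) := by
  refine termSpan_mono ?_ (exists_isRepresentation_iff.1 ⟨W, h⟩)
  rintro _ _ ⟨m, c, rfl, rfl, hc | ⟨rfl, h1, h2⟩⟩
  · exact Or.inl (List.mem_map_of_mem hc)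
  · refine Or.inr ⟨rfl, h1, ?_⟩
    rw [monOf, h2]
    exact Finsupp.ext fun _ => rfl

theorem exists_isRepresentation_localRel {B : List (PolyCode R n)} {f : PolyCode R n}
    {S : Set (Poly R n)} (hS : ∀ h ∈ S, h ∈ B.map decodePoly)
    (h : IsLocalCombination S (decodePoly f)) : ∃ W, IsRepresentation (localRel B f) f W := by
  refine exists_isRepresentation_iff.2 (termSpan_mono ?_ h)
  rintro μ g (hg | ⟨rfl, h1, h2⟩)
  · obtain ⟨c, hc, rfl⟩ := List.mem_map.1 (hS g hg)
    obtain ⟨m, rfl⟩ := monOf_surjective μ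
    exact ⟨m, c, rfl, rfl, Or.inl hc⟩
  · obtain ⟨m, rfl⟩ := monOf_surjective μ
    exact ⟨m, f, rfl, rfl, Or.inr ⟨rfl, h1, Finsupp.equivFunOnFinite.symm.injective
      (h2.trans (Finsupp.ext fun _ => rfl))⟩⟩

theorem monOf_add_shift (a : ℕ × (Fin n → ℕ)) (α : Fin n → ℕ) :
    monOf (a + (0, α)) = monOf a + (0, Finsupp.equivFunOnFinite.symm α) := monOf_add _ _

/-- The first representations put the codes into the ideal of F, the second put F into the ideal
generated by them and p - t, and the third verify the criterion on pairs, which yields `cover`. -/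
theorem IsCertificate.isReducedCore [IsDomain R] [IsNoetherianRing R] (hp : Prime p)
    (hF : IsInput p (F.map decodePoly)) (h : IsCertificate o p F L Ws) :
    IsReducedCore o p (idealOf (F.map decodePoly)) (L.map fun x => decodePoly (leadCode x)) := by
  obtain ⟨h1, h2, h3, h4⟩ := h
  have hmon : ∀ x ∈ L, IsMonicAt o (decodePoly (leadCode x)) (monOf x.1) := fun x hx =>
    isMonicAt_leadCode fun e he => ((h1 x hx).2.1 e he).1
  have hplm : ∀ x ∈ L, plm o (decodePoly (leadCode x)) = monOf x.1 := fun x hx =>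
    (hmon x hx).plm_eq
  have hhom : ∀ x ∈ L, XHomogeneous (decodePoly (leadCode x)) := fun x hx =>
    xHomogeneous_leadCode fun e he => ((h1 x hx).2.1 e he).2
  have hmem : ∀ x ∈ L, toSer (decodePoly (leadCode x)) ∈ idealOf (F.map decodePoly) := by
    intro x hx
    obtain ⟨W, -, hW⟩ := h2 x hx
    rw [idealOf_eq]
    exact (IsLocalCombination.of_isRepresentation hW).toSer_mem
  refine ⟨?_, ?_, ?_, ?_, ?_, ?_, fun f hf hlc => ?_⟩
  · exact List.forall_mem_map.2 hhom
  · exact List.forall_mem_map.2 hmem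
  · exact List.forall_mem_map.2 fun x hx => by rw [hplm x hx]; exact hmon x hx
  · refine List.forall_mem_map.2 fun x hx => ?_
    rw [hplm x hx]
    exact fun h0 => (h1 x hx).1 (monOf_injective (h0.trans monOf_zero.symm))
  · refine List.forall_mem_map.2 fun x hx α hα => ?_
    rcases (h1 x hx).of_isInitial (isInitial_natTrailingDegree hα) with h | h
    · have := (hmon x hx).1
      rw [← h] at this
      rw [Polynomial.trailingCoeff, show (MvPolynomial.coeff α (decodePoly (leadCode x))).coeff _ =
        pc (_, α) (decodePoly (leadCode x)) from rfl, this]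
      exact fun h' => hp.not_isUnit (isUnit_of_dvd_one h')
    · exact h.1
  · refine List.forall_mem_map.2 fun x hx m hm => List.forall_mem_map.2 fun y hy hle => ?_
    rw [hplm y hy] at hle
    rcases (h1 x hx).of_isInitial hm with rfl | h
    · exact ⟨(hplm x hx).symm, by rw [(h1 x hx).2.2.2 y hy (monOf_le.1 hle)]⟩
    · exact absurd hle (h.2 y hy)
  · let B : Set (Poly R n) := {g | g ∈ (pMinusTCode n p :: L.map leadCode).map decodePoly}
    have hB : ∀ b ∈ B, b = cst p - tVar ∨ b ∈ L.map fun x => decodePoly (leadCode x) := by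
      intro b hb
      rw [show B = {g | g ∈ (pMinusTCode n p :: L.map leadCode).map decodePoly} from rfl,
        Set.mem_ofPred_eq, List.map_cons, List.mem_cons, decodePoly_pMinusTCode, List.map_map] at hb
      exact hb
    have hsub : idealOf (F.map decodePoly) ≤ Ideal.span (toSer '' B) := by
      rw [idealOf_eq, Ideal.span_le]
      rintro _ ⟨f, hf, rfl⟩
      obtain ⟨c, hc, rfl⟩ := List.mem_map.1 hf
      obtain ⟨W, -, hW⟩ := h3 c hc
      exact (IsLocalCombination.of_isRepresentation hW).toSer_mem
    refine cover_of_isSReducible hp (List.forall_mem_map.2 hhom)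
      (List.forall_mem_map.2 fun x hx => by rw [hplm x hx]; exact hmon x hx) ?_ (fun b hb => ?_)
      hB (hsub hf) hlc
    · refine List.forall_mem_map.2 fun x hx => List.forall_mem_map.2 fun y hy hle => ?_
      rw [hplm x hx, hplm y hy] at hle
      obtain ⟨W, -, hW⟩ := h4 x hx y hy hle
      have h5 := exists_isRepresentation_iff.1 ⟨W, hW⟩
      have hs : sShift o (decodePoly (leadCode x)) (decodePoly (leadCode y)) =
          Finsupp.equivFunOnFinite.symm (y.1.2 - x.1.2) := by
        rw [sShift, hplm x hx, hplm y hy]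
        exact Finsupp.ext fun _ => rfl
      unfold IsSReducible
      rw [hs]
      rw [decodePoly_shiftCode] at h5
      refine termSpan_mono ?_ h5
      rintro _ _ ⟨m, c, rfl, rfl, rfl | ⟨z, hz, rfl, h6, h7⟩⟩
      · exact Or.inl (decodePoly_pMinusTCode p)
      · refine Or.inr ⟨List.mem_map_of_mem hz, ?_, ?_⟩
        · have h8 := degree_monOf (x.1 + (0, y.1.2 - x.1.2))
          rw [monOf_add_shift] at h8
          rw [hplm x hx, hplm z hz, degree_monOf, degree_monOf, h6]
          exact h8.symm
        · rw [hplm x hx, hplm z hz]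
          refine h7.imp id (Or.imp (fun h => ?_) fun h => ⟨by rw [h.1], ?_⟩)
          · rwa [monOf_add, monOf_add_shift] at h
          · exact Finsupp.ext fun i => congrFun h.2 i
    · rcases hB b hb with rfl | hb
      · exact hF.1 _ hF.2
      · exact List.forall_mem_map.2 hhom b hb

theorem exists_leadCode [Nontrivial R] {g : Poly R n} (hg : IsMonicAt o g (plm o g)) :
    ∃ x : (ℕ × (Fin n → ℕ)) × PolyCode R n, decodePoly (leadCode x) = g ∧
      monOf x.1 = plm o g ∧ ∀ e ∈ x.2, pc (monOf e.2) g ≠ 0 ∧ monOf e.2 ≠ plm o g := by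
  obtain ⟨m, hm⟩ := monOf_surjective (plm o g)
  obtain ⟨L, hL, hne⟩ := exists_decodePoly_eq (g - term (plm o g) 1)
  refine ⟨(m, L), ?_, hm, fun e he => ?_⟩
  · rw [leadCode, decodePoly_cons, hL, hm]
    ring
  · have h1 := hne e he
    have h2 : monOf e.2 ≠ plm o g := by
      intro h
      rw [h, pc_sub, pc_term_self, hg.1, sub_self] at h1
      exact h1 rfl
    rw [pc_sub, pc_term, if_neg (Ne.symm h2), sub_zero] at h1
    exact ⟨h1, h2⟩

/-- Encode each g as its leading monomial followed by the nonzero terms of the tail. Validity is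
then a translation of `IsReducedCore`, and the three kinds of representations come from the
completeness lemmas. -/
theorem IsReducedCore.exists_isCertificate [IsDomain R] [IsNoetherianRing R] (hp : Prime p)
    (hunit : ∀ c : R, ¬ p ∣ c → ∃ a b, a * c + b * p = 1)
    (hF : IsInput p (F.map decodePoly)) {G : List (Poly R n)}
    (hG : IsReducedCore o p (idealOf (F.map decodePoly)) G) :
    ∃ L Ws, IsCertificate o p F L Ws := by
  classical
  have hcode : ∀ g, ∃ x : (ℕ × (Fin n → ℕ)) × PolyCode R n, g ∈ G → decodePoly (leadCode x) = g ∧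
      monOf x.1 = plm o g ∧ ∀ e ∈ x.2, pc (monOf e.2) g ≠ 0 ∧ monOf e.2 ≠ plm o g := by
    intro g
    by_cases hg : g ∈ G
    · obtain ⟨x, hx⟩ := exists_leadCode (hG.monic g hg)
      exact ⟨x, fun _ => hx⟩
    · exact ⟨(0, []), fun h => absurd h hg⟩
  choose C hC using hcode
  have hdec : ∀ g ∈ G, decodePoly (leadCode (C g)) = g := fun g hg => (hC g hg).1
  have hlm : ∀ g ∈ G, monOf (C g).1 = plm o g := fun g hg => (hC g hg).2.1
  have hcoef : ∀ g ∈ G, ∀ e ∈ leadCode (C g), pc (monOf e.2) g ≠ 0 := by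
    intro g hg e he
    rcases List.mem_cons.1 he with rfl | he
    · simp only
      rw [hlm g hg, (hG.monic g hg).1]
      exact one_ne_zero
    · exact ((hC g hg).2.2 e he).1
  have hGB : ∀ g ∈ G, g ∈ ((G.map C).map leadCode).map decodePoly := fun g hg =>
    List.mem_map.2 ⟨_, List.mem_map_of_mem (List.mem_map_of_mem hg), hdec g hg⟩
  have hBhom : ∀ b ∈ {f | f ∈ F.map decodePoly}, XHomogeneous b := fun b hb => hF.1 b hb
  have hG' := hG
  rw [idealOf_eq] at hG'
  have hvalid : ∀ x ∈ G.map C, IsValidLead o p (G.map C) x := by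
    refine List.forall_mem_map.2 fun g hg => ⟨?_, fun e he => ⟨?_, ?_⟩, fun e he => ?_,
      List.forall_mem_map.2 fun h hh hle => ?_⟩
    · intro h0
      apply hG.ne_zero g hg
      rw [← hlm g hg, h0, monOf_zero]
    · obtain ⟨h1, h2⟩ := (hC g hg).2.2 e he
      rw [hlm g hg]
      by_contra h3
      rcases TLocalOrder.not_lt.1 h3 with h4 | h4
      · exact h2 h4.symm
      · exact h1 ((hG.monic g hg).2 _ h4)
    · obtain ⟨d, hd⟩ := hG.hom g hg
      have key : ∀ m, pc m g ≠ 0 → m.2.degree = d := fun m hm =>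
        isHomogeneous_iff.1 hd _ fun h0 => hm (by rw [pc, h0, Polynomial.coeff_zero])
      rw [← degree_monOf, ← degree_monOf, key _ ((hC g hg).2.2 e he).1, hlm g hg,
        key _ (by rw [(hG.monic g hg).1]; exact one_ne_zero)]
    · have hne := hcoef g hg e he
      by_cases h1 : e.2.2 = (C g).1.2
      · exact Or.inl h1
      have h1' : (monOf e.2).2 ≠ (plm o g).2 := by
        rw [← hlm g hg]
        exact fun h => h1 (Finsupp.equivFunOnFinite.symm.injective h)
      right
      have hα : MvPolynomial.coeff (monOf e.2).2 g ≠ 0 := fun h0 =>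
        hne (by rw [pc, h0, Polynomial.coeff_zero])
      have hini := isInitial_natTrailingDegree hα
      have hle := Polynomial.natTrailingDegree_le_of_ne_zero (p := MvPolynomial.coeff (monOf e.2).2 g)
        hne
      -- Either the term is the lowest of its x-part, hence initial, so that cleanness and
      -- reducedness apply, or the lowest one occurs in the code as the witness e'.
      rcases hle.eq_or_lt with h2 | h2
      · right
        rw [h2, show ((monOf e.2).1, (monOf e.2).2) = monOf e.2 from rfl] at hini
        refine ⟨?_, List.forall_mem_map.2 fun h hh hle' => h1' ?_⟩
        · rw [← pc_decodePoly, hdec g hg]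
          have := hG.clean g hg (monOf e.2).2 hα
          rwa [Polynomial.trailingCoeff, h2] at this
        · rw [(hG.red g hg _ hini h hh (by rw [← hlm h hh]; exact monOf_le.2 hle')).1]
      · left
        have h3 := hini.pc_ne_zero
        obtain ⟨e', he', h4⟩ := exists_mem_of_pc_ne_zero
          (L := leadCode (C g)) (by rw [hdec g hg]; exact h3)
        refine ⟨e', he', ?_, ?_, ?_⟩
        · exact Finsupp.equivFunOnFinite.symm.injective (congrArg Prod.snd h4)
        · have := congrArg Prod.fst h4
          exact lt_of_eq_of_lt this h2
        · rw [← pc_decodePoly, hdec g hg, h4]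
          exact h3
    · have : h = g := hG.eq_of_le hg hh (by rw [← hlm g hg, ← hlm h hh]; exact monOf_le.2 hle)
      rw [this]
  obtain ⟨W₁, hW₁⟩ := exists_lists_of_forall_exists (G.map C)
    (Q := fun x W => IsRepresentation (localRel F (leadCode x)) (leadCode x) W) (by
      refine List.forall_mem_map.2 fun g hg => ?_
      refine exists_isRepresentation_localRel (S := {f | f ∈ F.map decodePoly}) (fun _ h => h) ?_
      rw [hdec g hg]
      exact isLocalCombination_of_mem hBhom hF.2 (hG.hom g hg) (hG'.mem g hg))
  obtain ⟨W₂, hW₂⟩ := exists_lists_of_forall_exists F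
    (Q := fun f W => IsRepresentation
      (localRel (pMinusTCode n p :: (G.map C).map leadCode) f) f W) (by
      intro f hf
      refine exists_isRepresentation_localRel ?_ (hG'.isLocalCombination hp hunit hBhom hF.2
        (List.mem_map_of_mem hf))
      rintro h (rfl | hh)
      · rw [List.map_cons, decodePoly_pMinusTCode]
        exact List.mem_cons_self
      · rw [List.map_cons]
        exact List.mem_cons_of_mem _ (hGB h hh))
  obtain ⟨W₃, hW₃⟩ := exists_lists_of_forall_exists ((G.map C).product (G.map C))
    (Q := fun xy W => xy.2.1.1 ≤ xy.1.1.1 → IsRepresentation (reductionRel o p (G.map C) xy.1 xy.2)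
      (shiftCode (1, (0, xy.2.1.2 - xy.1.1.2)) (leadCode xy.1)) W) (by
      rintro ⟨x, y⟩ hxy
      obtain ⟨hx, hy⟩ := List.mem_product.1 hxy
      obtain ⟨g, hg, rfl⟩ := List.mem_map.1 hx
      obtain ⟨g', hg', rfl⟩ := List.mem_map.1 hy
      by_cases hle : (C g').1.1 ≤ (C g).1.1
      swap
      · exact ⟨[], fun h => absurd h hle⟩
      suffices h : ∃ W, IsRepresentation (reductionRel o p (G.map C) (C g) (C g'))
          (shiftCode (1, (0, (C g').1.2 - (C g).1.2)) (leadCode (C g))) W from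
        h.imp fun W hW _ => hW
      refine exists_isRepresentation_iff.2 ?_
      have hle' : (plm o g').1 ≤ (plm o g).1 := by rw [← hlm g hg, ← hlm g' hg']; exact hle
      have hs := hG'.isSReducible hp hunit hBhom hF.2 hg hg' hle'
      unfold IsSReducible at hs
      have hshift : sShift o g g' = Finsupp.equivFunOnFinite.symm ((C g').1.2 - (C g).1.2) := by
        rw [sShift, ← hlm g hg, ← hlm g' hg']
        exact Finsupp.ext fun _ => rfl
      rw [hshift] at hs
      rw [decodePoly_shiftCode, hdec g hg]
      refine termSpan_mono ?_ hs
      intro μ h hh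
      obtain ⟨m, rfl⟩ := monOf_surjective μ
      rcases hh with rfl | ⟨hh, h5, h6⟩
      · exact ⟨m, _, rfl, decodePoly_pMinusTCode p, Or.inl rfl⟩
      · refine ⟨m, leadCode (C h), rfl, hdec h hh, Or.inr ⟨_, List.mem_map_of_mem hh, rfl, ?_, ?_⟩⟩
        · rw [← hlm g hg, ← hlm h hh, degree_monOf, degree_monOf] at h5
          have h8 := degree_monOf ((C g).1 + (0, (C g').1.2 - (C g).1.2))
          rw [monOf_add_shift] at h8
          exact h5.trans h8
        · refine h6.imp id (Or.imp (fun h7 => ?_) fun h7 => ⟨by rw [h7.1], ?_⟩)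
          · rwa [monOf_add, monOf_add_shift, hlm g hg, hlm h hh]
          · have h8 := h7.2
            rw [← hlm g hg, ← hlm h hh] at h8
            exact funext fun i => DFunLike.congr_fun h8 i)
  refine ⟨G.map C, W₁ ++ (W₂ ++ W₃), hvalid, fun x hx => ?_, fun f hf => ?_,
    fun x hx y hy hle => ?_⟩
  · obtain ⟨W, h1, h2⟩ := hW₁ x hx
    exact ⟨W, List.mem_append_left _ h1, h2⟩
  · obtain ⟨W, h1, h2⟩ := hW₂ f hf
    exact ⟨W, List.mem_append_right _ (List.mem_append_left _ h1), h2⟩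
  · obtain ⟨W, h1, h2⟩ := hW₃ (x, y) (List.mem_product.2 ⟨hx, hy⟩)
    exact ⟨W, List.mem_append_right _ (List.mem_append_right _ h1), h2 hle⟩

end CertificateCorrect

/-! ### The search for a certified output -/

section Effective
variable {R : Type u} [CommRing R] {n : ℕ} {o : TLocalOrder n} {p : R}

theorem one_eq_term : (1 : Poly R n) = term 0 1 := by simp [term, ← MvPolynomial.C_apply]

theorem isMonicAt_one : IsMonicAt o (1 : Poly R n) 0 := by
  rw [one_eq_term]
  exact ⟨pc_term_self _ _, fun m hm => by rw [pc_term, if_neg (TLocalOrder.ne_of_lt hm)]⟩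

theorem toSer_mem_idealOf {F : List (Poly R n)} {f : Poly R n} (hf : f ∈ F) :
    toSer f ∈ idealOf F := Ideal.subset_span ⟨f, hf, rfl⟩

theorem isXHomInitReducedStdBasis_one [Nontrivial R] :
    IsXHomInitReducedStdBasis o (⊤ : Ideal (Ser R n)) [1] := by
  have hset : (serSet [1] : Set (Ser R n)) = {toSer 1} := by
    ext s
    simp [serSet]
  have hlt : lt o (toSer (1 : Poly R n)) = 1 := by
    rw [show lt o (toSer (1 : Poly R n)) = plt o (1 : Poly R n) from rfl, isMonicAt_one.plt_eq,
      ← one_eq_term]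
  have htop : leadIdeal o {toSer (1 : Poly R n)} = ⊤ := by
    rw [leadIdeal, Set.image_singleton, hlt, Ideal.span_singleton_one]
  refine ⟨fun g hg => ?_, ?_, ?_, ?_⟩
  · rw [List.mem_singleton.1 hg]
    exact ⟨0, MvPolynomial.isHomogeneous_one _ _⟩
  · rw [hset]
    refine ⟨Set.finite_singleton _, fun _ _ => Submodule.mem_top, ?_⟩
    rw [htop]
    have h1 : (1 : Poly R n) ∈ lt o '' ((⊤ : Ideal (Ser R n)) : Set (Ser R n)) :=
      ⟨toSer 1, Submodule.mem_top, hlt⟩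
    exact ((Ideal.eq_top_iff_one _).2 (Ideal.subset_span h1)).symm
  · rw [hset]
    intro G' hG' h
    rw [Set.ssubset_singleton_iff.1 hG', htop, leadIdeal, Set.image_empty, Ideal.span_empty] at h
    exact bot_ne_top h
  · rw [hset]
    rintro _ ⟨_, rfl, rfl⟩ m hm
    obtain ⟨h1, h2, -⟩ := tail_initPart one_ne_zero hm
    have h3 := h2.pc_ne_zero
    rw [isMonicAt_one.plm_eq] at h1
    rw [one_eq_term, pc_term, if_neg (Ne.symm h1)] at h3
    exact absurd rfl h3

/-- For effectivity only the existence of some correct output matters, so the choices may be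
resolved noncomputably. -/
theorem exists_choices (n : ℕ) (p : R) : Nonempty (Choices R n p) := by
  classical
  have h1 : ∀ c : R, ∃ ab : R × R, (∃ a b, a * c + b * p = 1) → ab.1 * c + ab.2 * p = 1 := by
    intro c
    by_cases h : ∃ a b, a * c + b * p = 1
    · obtain ⟨a, b, hab⟩ := h
      exact ⟨(a, b), fun _ => hab⟩
    · exact ⟨0, fun h' => absurd h' h⟩
  choose f hf using h1
  exact ⟨{
    bezout := f
    bezout_spec := hf
    pickTerm := fun T => if h : T.Nonempty then h.choose else (0, 0)
    pickTerm_mem := fun T h => by rw [dif_pos h]; exact h.choose_spec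
    pickPoly := fun L => L.headD 0
    pickPoly_mem := fun L h => by cases L <;> simp_all }⟩

variable [IsDomain R] [IsNoetherianRing R]

/-- This is what makes the search stop. If the ideal is everything, 1 is certified as a local
combination of F; otherwise the algorithm of part (i) provides a reduced core, which has a
certificate. Inadmissible inputs accept any answer, so the function is total. -/
theorem exists_isAcceptable (hp : Prime p)
    (hunit : ∀ c : R, ¬ p ∣ c → ∃ a b, a * c + b * p = 1) (F : List (PolyCode R n)) :
    ∃ y, IsAcceptable o p F y := by
  by_cases hF : IsInputCode p F
  swap
  · exact ⟨([], [], []), Or.inl hF⟩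
  have hF' := isInputCode_iff.1 hF
  by_cases htop : idealOf (F.map decodePoly) = ⊤
  · have h1 : decodePoly ([(1, 0)] : PolyCode R n) = 1 := by
      simp [term, ← MvPolynomial.C_apply]
    have h2 : IsLocalCombination {f | f ∈ F.map decodePoly}
        (decodePoly ([(1, 0)] : PolyCode R n)) := by
      rw [h1]
      refine isLocalCombination_of_mem (B := {f | f ∈ F.map decodePoly}) hF'.1 hF'.2
        ⟨0, MvPolynomial.isHomogeneous_one _ _⟩ ?_
      rw [← idealOf_eq, htop]
      exact Submodule.mem_top
    obtain ⟨W, hW⟩ := exists_isRepresentation_localRel (fun _ h => h) h2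
    exact ⟨([[(1, 0)]], [], [W]), Or.inr (Or.inl ⟨rfl, W, List.mem_singleton_self W, hW⟩)⟩
  · obtain ⟨G'', hG''⟩ := exists_isXHomStdBasis o hF'.1
    obtain ⟨σ⟩ := exists_choices n p
    obtain ⟨G, hG, -⟩ := exists_mem_initReducedStdBasis hp
      (toSer_mem_idealOf hF'.2) hunit htop σ hG''
    obtain ⟨L, Ws, h⟩ := hG.exists_isCertificate hp hunit hF'
    exact ⟨(L.map leadCode ++ [pMinusTCode n p], L, Ws), Or.inr (Or.inr ⟨rfl, h⟩)⟩

theorem IsAcceptable.isXHomInitReducedStdBasis (hp : Prime p) {F : List (PolyCode R n)}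
    {y : List (PolyCode R n) × List ((ℕ × (Fin n → ℕ)) × PolyCode R n) ×
      List (List ((R × ℕ × (Fin n → ℕ)) × PolyCode R n))} (h : IsAcceptable o p F y)
    (hF : IsInput p (F.map decodePoly)) :
    IsXHomInitReducedStdBasis o (idealOf (F.map decodePoly)) (y.1.map decodePoly) := by
  rcases h with h | ⟨h, W, -, hW⟩ | ⟨h, hcert⟩
  · exact absurd (isInputCode_iff.2 hF) h
  · have h1 : decodePoly ([(1, 0)] : PolyCode R n) = 1 := by
      simp [term, ← MvPolynomial.C_apply]
    have h2 := (IsLocalCombination.of_isRepresentation hW).toSer_mem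
    rw [h1, map_one] at h2
    rw [idealOf_eq, (Ideal.eq_top_iff_one _).2 h2, h, List.map_singleton, h1]
    exact isXHomInitReducedStdBasis_one
  · rw [h, List.map_append, List.map_map, List.map_singleton, decodePoly_pMinusTCode]
    exact (hcert.isReducedCore hp hF).isXHomInitReducedStdBasis hp
      (toSer_mem_idealOf hF.2)

theorem exists_computable_initReducedStdBasis [Primcodable R] (hp : Prime p)
    (hunit : ∀ c : R, ¬ p ∣ c → ∃ a b, a * c + b * p = 1) (hR : LinearEquationsSolvable R)
    (ho : o.IsComputable) :
    ∃ alg : List (PolyCode R n) → List (PolyCode R n), Computable alg ∧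
      ∀ F : List (PolyCode R n), IsInput p (F.map decodePoly) →
        IsXHomInitReducedStdBasis o (idealOf (F.map decodePoly)) ((alg F).map decodePoly) := by
  obtain ⟨f, hf, hacc⟩ := exists_computable_of_forall_exists
    (computablePred_isAcceptable hR ho p Computable.fst Computable.snd)
    (exists_isAcceptable (o := o) hp hunit)
  exact ⟨fun F => (f F).1, by fun_prop, fun F hF => (hacc F).isXHomInitReducedStdBasis hp hF⟩

end Effective
end
end InRed

/-! ### From the discrete valuation ring to the conditions on R and p -/

theorem mainTheorem11
    {R Rν : Type*} [CommRing R] [IsNoetherianRing R]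
    [CommRing Rν] [IsDomain Rν] [IsDiscreteValuationRing Rν]
    [IsAdicComplete (IsLocalRing.maximalIdeal Rν) Rν] [Algebra R Rν]
    (hinj : Function.Injective (algebraMap R Rν))
    (hdense : ∀ (x : Rν) (k : ℕ), ∃ r : R,
      x - algebraMap R Rν r ∈ IsLocalRing.maximalIdeal Rν ^ k)
    (p : R) (hp : Irreducible (algebraMap R Rν p))
    (hres : RingHom.ker ((IsLocalRing.residue Rν).comp (algebraMap R Rν)) = Ideal.span {p})
    (n : ℕ) (o : InRed.TLocalOrder n) :
    (∀ F : List (InRed.Poly R n), InRed.IsInput p F →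
      (∃ G'' : List (InRed.Poly R n), InRed.IsXHomStdBasis o (InRed.idealOf F) G'') ∧
      (InRed.idealOf F ≠ ⊤ → ∀ (σ : InRed.Choices R n p) (G'' : List (InRed.Poly R n)),
        InRed.IsXHomStdBasis o (InRed.idealOf F) G'' →
        ∃ G ∈ InRed.initReducedStdBasis o p σ G'',
          InRed.IsXHomInitReducedStdBasis o (InRed.idealOf F) G)) ∧
    (∀ [Primcodable R], InRed.LinearEquationsSolvable R → o.IsComputable →
      ∃ alg : List (InRed.PolyCode R n) → List (InRed.PolyCode R n), Computable alg ∧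
        ∀ F : List (InRed.PolyCode R n), InRed.IsInput p (F.map InRed.decodePoly) →
          InRed.IsXHomInitReducedStdBasis o (InRed.idealOf (F.map InRed.decodePoly))
            ((alg F).map InRed.decodePoly)) := by
  have : IsDomain R := hinj.isDomain (algebraMap R Rν)
  have hp0 : p ≠ 0 := by
    rintro rfl
    exact hp.ne_zero (map_zero _)
  -- The ideal ⟨p⟩ is the kernel of a homomorphism to the residue field.
  have hprime : Prime p := by
    rw [← Ideal.span_singleton_prime hp0, ← hres]
    exact RingHom.ker_isPrime _
  -- By density R maps onto the residue field, so R/⟨p⟩ is a field. An element of R whose residue is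
  -- inverse to that of c gives the coefficient a.
  have hunit : ∀ c : R, ¬ p ∣ c → ∃ a b, a * c + b * p = 1 := by
    intro c hc
    have h0 : IsLocalRing.residue Rν (algebraMap R Rν c) ≠ 0 := by
      intro h
      apply hc
      rw [← Ideal.mem_span_singleton, ← hres]
      exact h
    obtain ⟨x, hx⟩ := IsLocalRing.residue_surjective (IsLocalRing.residue Rν (algebraMap R Rν c))⁻¹
    obtain ⟨r, hr⟩ := hdense x 1
    rw [pow_one, ← IsLocalRing.residue_eq_zero_iff, map_sub, sub_eq_zero, hx] at hr
    have h1 : r * c - 1 ∈ Ideal.span {p} := by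
      rw [← hres, RingHom.mem_ker, RingHom.comp_apply, map_sub, map_sub, map_mul, map_mul, ← hr,
        inv_mul_cancel₀ h0, map_one, map_one, sub_self]
    obtain ⟨b, hb⟩ := Ideal.mem_span_singleton.1 h1
    exact ⟨r, -b, by linear_combination hb⟩
  refine ⟨fun F hF => ⟨InRed.exists_isXHomStdBasis o hF.1, fun htop σ G'' hG'' => ?_⟩, ?_⟩
  · have hI : InRed.toSer (InRed.cst p - InRed.tVar) ∈ InRed.idealOf F :=
      InRed.toSer_mem_idealOf hF.2
    obtain ⟨G, hG, h⟩ := InRed.exists_mem_initReducedStdBasis hprime hI hunit htop σ hG''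
    exact ⟨_, h, hG.isXHomInitReducedStdBasis hprime hI⟩
  · intro _ hR ho
    exact InRed.exists_computable_initReducedStdBasis hprime hunit hR ho
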